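/- **Setting.** Identify $\mathbb R^2$ with $\mathbb C$ via $z=x_1+ix_2$. Let $H=-\Delta+|x|^2$ on $L^2(\mathbb R^2)$, with eigenvalues $2N+2$ and eigenspaces $E_N$ ($N\ge 0$), let $\mathcal H^{s}(\mathbb R^2)$ be the space of tempered distributions $u$ with $\|u\|_{\mathcal H^s}=\|H^{s/2}u\|_{L^2}<\infty$, and let $\Pi_N$ be the orthogonal projection on $E_0\oplus\dots\oplus E_N$. Let $\phi_n^{hol}(z)=(\pi n!)^{-1/2}z^ne^{-|z|^2/2}$, and $$X_{hol}^{-1}=\Big(\bigcap_{\sigma>1}\mathcal H^{-\sigma}(\mathbb R^2)\Big)\cap\big(\mathcal O(\mathbb C)\,e^{-|z|^2/2}\big),$$ where $\mathcal O(\mathbb C)$ is the set of entire functions. Let $(g_n)_{n\ge 0}$ be independent standard complex Gaussian variables (density $\pi^{-1}e^{-|z|^2}$) on a probability space, and let the white noise measure $\mu$ be the law of $\gamma=\sum_{n\ge 0}g_n\phi_n^{hol}$. Put, with $x^\perp=(-x_2,x_1)$, $$\mathcal T(f_1,f_2,f_3)(z)=\int_{\mathbb R}\int_{\mathbb R^2}f_1(x+z)\,f_2(\lambda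 x^\perp+z)\,\overline{f_3(x+\lambda x^\perp+z)}\,dx\,d\lambda,\qquad \mathcal T_N(u)=\Pi_N\mathcal T(\Pi_Nu,\Pi_Nu,\Pi_Nu).$$ **Theorem.** The sequence $(\mathcal T_N)$ converges in $L^2(\mu;\mathcal H^{-\sigma}(\mathbb R^2))$ for every $\sigma>1$ to a limit, denoted $\mathcal T$, which does not depend on $\sigma$ and is determined up to $\mu$-null sets. For every representative of $\mathcal T$ there are a set $\Sigma\subset X_{hol}^{-1}$ of full $\mu$-measure, a probability space $(\widetilde\Omega,\widetilde{\mathbf p})$ and a random process $u=(u(t))_{t\in\mathbb R}$ on it such that: 1. for every $\omega\in\widetilde\Omega$, $u_\omega(0)\in\Sigma$ and $u_\omega$ is a global weak solution of $$(CR)\qquad i\partial_tu=\mathcal T(u),\qquad u(0)=f,$$ with $f=u_\omega(0)$, that is, $u_\omega\in\bigcap_{\sigma>1}C(\mathbb R;\mathcal H^{-\sigma}(\mathbb R^2))$, $\mathcal T(u_\omega)\in L^2_{loc}(\mathbb R;\mathcal H^{-\sigma}(\mathbb R^2))$ for all $\sigma>1$, and $u_\omega(t)=f-i\int_0^t\mathcal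 T(u_\omega(s))\,ds$ for all $t\in\mathbb R$; 2. every $f\in\Sigma$ equals $u_\omega(0)$ for some $\omega\in\widetilde\Omega$; in particular, for every $f\in\Sigma$, (CR) has a global weak solution in $\bigcap_{\sigma>1}C(\mathbb R;\mathcal H^{-\sigma}(\mathbb R^2))$ with initial value $f$; 3. for every $t\in\mathbb R$, the law of the random variable $u(t)$ is $\mu$. -/

import Mathlib

open MeasureTheory ProbabilityTheory Filter Topology
open scoped SchwartzMap ENNReal

noncomputable section

namespace CRSystem

/-! The plane `ℝ²` is identified with `ℂ` through `z = x₁ + i x₂`; Lebesgue measure on `ℝ²` is `volume` on `ℂ`. -/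

/-! ### The special Hermite functions -/

/-- The Gaussian `exp (-|z|² / 2)`. -/
def gaussian (z : ℂ) : ℂ := ((Real.exp (-‖z‖ ^ 2 / 2) : ℝ) : ℂ)

theorem pow_mul_exp_le (M : ℕ) (x : ℝ) (hx : 0 ≤ x) :
    (1 + x) ^ M * Real.exp (-x ^ 2 / 2) ≤ M.factorial * Real.exp (3 / 2) := by
  have h1 : (1 + x) ^ M / M.factorial ≤ Real.exp (1 + x) :=
    Real.pow_div_factorial_le_exp (1 + x) (by positivity) M
  have h2 : (1 + x) ^ M ≤ M.factorial * Real.exp (1 + x) := by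
    rwa [div_le_iff₀' (by positivity)] at h1
  calc (1 + x) ^ M * Real.exp (-x ^ 2 / 2)
      ≤ M.factorial * Real.exp (1 + x) * Real.exp (-x ^ 2 / 2) := by gcongr
    _ = M.factorial * Real.exp (1 + x + -x ^ 2 / 2) := by rw [mul_assoc, ← Real.exp_add]
    _ ≤ M.factorial * Real.exp (3 / 2) := by
        gcongr
        nlinarith [sq_nonneg (x - 1)]

theorem hasTemperateGrowth_quad :
    (fun z : ℂ => -‖z‖ ^ 2 / 2).HasTemperateGrowth := by
  have h := (Function.hasTemperateGrowth_norm_sq ℂ).mul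
    (Function.HasTemperateGrowth.const (-(1 / 2) : ℝ))
  have he : (fun z : ℂ => -‖z‖ ^ 2 / 2)
      = (fun z : ℂ => ‖z‖ ^ 2) * (fun _ : ℂ => (-(1 / 2) : ℝ)) := by
    funext z
    simp only [Pi.mul_apply]
    ring
  rw [he]
  exact h

theorem gaussian_decay (k n : ℕ) :
    ∃ C : ℝ, ∀ z : ℂ, ‖z‖ ^ k * ‖iteratedFDeriv ℝ n gaussian z‖ ≤ C := by
  obtain ⟨K, C, hC0, hC⟩ := hasTemperateGrowth_quad.norm_iteratedFDeriv_le_uniform n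
  refine ⟨n.factorial * (C + 1) ^ n * ((k + K * n).factorial * Real.exp (3 / 2)), fun z => ?_⟩
  have hsm : ContDiff ℝ (⊤ : ℕ∞) (fun z : ℂ => -‖z‖ ^ 2 / 2) := hasTemperateGrowth_quad.1
  have hexp : ContDiff ℝ (⊤ : ℕ∞) Real.exp := Real.contDiff_exp
  have hbase : 1 ≤ (C + 1) * (1 + ‖z‖) ^ K := by
    have : 1 ≤ (1 + ‖z‖) ^ K := one_le_pow₀ (by linarith [norm_nonneg z])
    nlinarith
  have hcomp := norm_iteratedFDeriv_comp_le (n := n) (N := (⊤ : ℕ∞)) (𝕜 := ℝ) (g := Real.exp)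
    (f := fun z : ℂ => -‖z‖ ^ 2 / 2) hexp hsm (by exact_mod_cast le_top) z
    (C := Real.exp (-‖z‖ ^ 2 / 2)) (D := (C + 1) * (1 + ‖z‖) ^ K)
    (fun i _ => by
      rw [norm_iteratedFDeriv_eq_norm_iteratedDeriv, iteratedDeriv_eq_iterate,
        Real.iter_deriv_exp, Real.norm_eq_abs, abs_of_pos (Real.exp_pos _)])
    (fun i hi1 hin => by
      refine (hC i hin z).trans ?_
      refine le_trans ?_ (le_self_pow₀ hbase (by omega))
      gcongr
      linarith)
  have hgauss : iteratedFDeriv ℝ n gaussian z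
      = (Complex.ofRealCLM).compContinuousMultilinearMap
        (iteratedFDeriv ℝ n (Real.exp ∘ fun z : ℂ => -‖z‖ ^ 2 / 2) z) := by
    have := Complex.ofRealCLM.iteratedFDeriv_comp_left (i := n) (n := (⊤ : ℕ∞))
      (f := Real.exp ∘ fun z : ℂ => -‖z‖ ^ 2 / 2) (x := z)
      (hexp.comp hsm).contDiffAt (by exact_mod_cast le_top)
    rw [← this]
    rfl
  have hle : ‖iteratedFDeriv ℝ n gaussian z‖
      ≤ n.factorial * Real.exp (-‖z‖ ^ 2 / 2) * ((C + 1) * (1 + ‖z‖) ^ K) ^ n := by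
    rw [hgauss]
    refine (ContinuousLinearMap.norm_compContinuousMultilinearMap_le _ _).trans ?_
    rw [Complex.ofRealCLM_norm, one_mul]
    exact hcomp
  calc ‖z‖ ^ k * ‖iteratedFDeriv ℝ n gaussian z‖
      ≤ (1 + ‖z‖) ^ k *
        (n.factorial * Real.exp (-‖z‖ ^ 2 / 2) * ((C + 1) * (1 + ‖z‖) ^ K) ^ n) := by
        gcongr
        linarith
    _ = n.factorial * (C + 1) ^ n * ((1 + ‖z‖) ^ (k + K * n) * Real.exp (-‖z‖ ^ 2 / 2)) := by
        rw [mul_pow, ← pow_mul, pow_add]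
        ring
    _ ≤ _ := by
        exact mul_le_mul_of_nonneg_left (pow_mul_exp_le _ _ (norm_nonneg z)) (by positivity)

/-- The Gaussian `exp (-|z|² / 2)` as a Schwartz function. -/
def gaussianSchwartz : 𝓢(ℂ, ℂ) where
  toFun := gaussian
  smooth' := Complex.ofRealCLM.contDiff.comp (Real.contDiff_exp.comp hasTemperateGrowth_quad.1)
  decay' := gaussian_decay

/-- The complex Hermite polynomials
`∑ₘ (-1)ᵐ m! (j choose m) (k choose m) z ^ (j - m) * conj z ^ (k - m)`. -/
def complexHermite (j k : ℕ) (z : ℂ) : ℂ :=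
  ∑ m ∈ Finset.range (min j k + 1),
    ((-1) ^ m * (m.factorial * j.choose m * k.choose m : ℂ)) *
      (z ^ (j - m) * (starRingEnd ℂ z) ^ (k - m))

theorem complexHermite_hasTemperateGrowth (j k : ℕ) :
    (complexHermite j k).HasTemperateGrowth := by
  unfold complexHermite
  have hz : (fun z : ℂ => z).HasTemperateGrowth := Function.HasTemperateGrowth.id'
  have hc : (fun z : ℂ => starRingEnd ℂ z).HasTemperateGrowth :=
    (Complex.conjCLE.toContinuousLinearMap).hasTemperateGrowth
  exact Function.HasTemperateGrowth.sum fun m _ =>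
    (Function.HasTemperateGrowth.const _).mul ((hz.pow _).mul (hc.pow _))

/-- The special Hermite functions
`φ_{j,k}(z) = (π j! k!)^{-1/2} H_{j,k}(z, conj z) exp (-|z|² / 2)`. They form an orthonormal basis
of `L²(ℝ²)`, and `φ_{j,k}` is an eigenfunction of the harmonic oscillator `H = -Δ + |x|²` with
eigenvalue `2 (j + k) + 2`: the eigenspace `E_N` is spanned by the `φ_{j,k}` with `j + k = N`.
The complex conjugate of `φ_{j,k}` is `φ_{k,j}`. -/
def hermiteFun (j k : ℕ) : 𝓢(ℂ, ℂ) :=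
  (((Real.sqrt (Real.pi * j.factorial * k.factorial))⁻¹ : ℝ) : ℂ) •
    SchwartzMap.smulLeftCLM ℂ (complexHermite j k) gaussianSchwartz

theorem hermiteFun_apply (j k : ℕ) (z : ℂ) :
    hermiteFun j k z = (((Real.sqrt (Real.pi * j.factorial * k.factorial))⁻¹ : ℝ) : ℂ) *
      (complexHermite j k z * gaussian z) := by
  rw [hermiteFun, smul_apply,
    SchwartzMap.smulLeftCLM_apply_apply (complexHermite_hasTemperateGrowth j k)]
  rfl

/-- The holomorphic Hermite functions `φ_n^{hol}(z) = (π n!)^{-1/2} z ^ n exp (-|z|² / 2)`. -/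
def holFun (n : ℕ) : 𝓢(ℂ, ℂ) := hermiteFun n 0

theorem holFun_apply (n : ℕ) (z : ℂ) :
    holFun n z = (((Real.sqrt (Real.pi * n.factorial))⁻¹ : ℝ) : ℂ) * (z ^ n * gaussian z) := by
  simp [holFun, hermiteFun_apply, complexHermite]

/-! ### Harmonic Sobolev spaces -/

/-- The `L²` coefficient `⟨u, φ_{j,k}⟩ = ∫ u conj φ_{j,k}` of a tempered distribution; since
`conj φ_{j,k} = φ_{k,j}`, it is the value of `u` on the test function `φ_{k,j}`. -/
def coeff (u : 𝓢'(ℂ, ℂ)) (j k : ℕ) : ℂ := u (hermiteFun k j)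

/-- The squared norm of `u` in the harmonic Sobolev space `ℋ^s(ℝ²)`, that is `‖H^{s/2} u‖²` in
`L²(ℝ²)`, computed in an orthonormal eigenbasis of `H`; it is `∞` iff `u ∉ ℋ^s(ℝ²)`. -/
def sobolevNormSq (s : ℝ) (u : 𝓢'(ℂ, ℂ)) : ℝ≥0∞ :=
  ∑' q : ℕ × ℕ, ENNReal.ofReal ((2 * (q.1 + q.2 : ℝ) + 2) ^ s * ‖coeff u q.1 q.2‖ ^ 2)

/-- Membership in `ℋ^s(ℝ²)`. -/
def MemSobolev (s : ℝ) (u : 𝓢'(ℂ, ℂ)) : Prop := sobolevNormSq s u < ∞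

/-- `u ∈ C(ℝ; ℋ^s(ℝ²))`. -/
def ContinuousInSobolev (s : ℝ) (u : ℝ → 𝓢'(ℂ, ℂ)) : Prop :=
  (∀ t, MemSobolev s (u t)) ∧
    ∀ t₀, Tendsto (fun t => sobolevNormSq s (u t - u t₀)) (𝓝 t₀) (𝓝 0)

/-- `X_hol^{-1}(ℝ²) = (⋂_{σ > 1} ℋ^{-σ}(ℝ²)) ∩ (𝒪(ℂ) exp (-|z|² / 2))`. -/
def Xhol : Set 𝓢'(ℂ, ℂ) :=
  {u | (∀ σ : ℝ, 1 < σ → MemSobolev (-σ) u) ∧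
    ∃ F : ℂ → ℂ, Differentiable ℂ F ∧ ∀ ψ : 𝓢(ℂ, ℂ),
      Integrable (fun z => F z * gaussian z * ψ z) ∧ u ψ = ∫ z, F z * gaussian z * ψ z}

/-- The `σ`-algebra on tempered distributions generated by the evaluations `u ↦ u ψ`. On
`X^{-1}(ℝ²) = ⋂_{σ > 1} ℋ^{-σ}(ℝ²)`, a separable Fréchet space, it induces the Borel
`σ`-algebra. -/
instance instMeasurableSpaceTempered : MeasurableSpace 𝓢'(ℂ, ℂ) :=
  ⨆ ψ : 𝓢(ℂ, ℂ), MeasurableSpace.comap (fun u : 𝓢'(ℂ, ℂ) => u ψ) inferInstance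

/-! ### The white noise measure -/

/-- The standard complex Gaussian law `𝒩_ℂ(0, 1)`, with density `π⁻¹ exp (-|z|²)`. -/
def stdComplexGaussian : Measure ℂ :=
  (volume : Measure ℂ).withDensity fun z => ENNReal.ofReal (Real.pi⁻¹ * Real.exp (-‖z‖ ^ 2))

/-- The random series `γ = ∑ₙ gₙ φₙ^{hol}`, convergent in the space of tempered distributions. -/
def gaussianSeries {Ω : Type*} (g : ℕ → Ω → ℂ) (ω : Ω) : 𝓢'(ℂ, ℂ) :=
  ∑' n, g n ω • SchwartzMap.toTemperedDistributionCLM ℂ ℂ volume (holFun n)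

/-- The white noise measure `μ = p ∘ γ⁻¹`. -/
def whiteNoise {Ω : Type*} [MeasurableSpace Ω] (p : Measure Ω) (g : ℕ → Ω → ℂ) :
    Measure 𝓢'(ℂ, ℂ) :=
  p.map (gaussianSeries g)

/-! ### The (CR) nonlinearity -/

/-- The trilinear operator
`𝒯(f₁, f₂, f₃)(z) = ∫_ℝ ∫_{ℝ²} f₁(x + z) f₂(r x^⊥ + z) conj (f₃(x + r x^⊥ + z)) dx dr`,
where `x^⊥ = (-x₂, x₁)`, that is `x^⊥ = i x`. -/
def trilinear (f₁ f₂ f₃ : ℂ → ℂ) (z : ℂ) : ℂ :=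
  ∫ r : ℝ, ∫ x : ℂ,
    f₁ (x + z) * f₂ (r * (Complex.I * x) + z) *
      starRingEnd ℂ (f₃ (x + r * (Complex.I * x) + z))

/-- The orthogonal projection `Π_N` on `E_0 ⊕ ⋯ ⊕ E_N`, on tempered distributions. -/
def proj (N : ℕ) (u : 𝓢'(ℂ, ℂ)) : 𝓢(ℂ, ℂ) :=
  ∑ n ∈ Finset.range (N + 1), ∑ q ∈ Finset.HasAntidiagonal.antidiagonal n,
    coeff u q.1 q.2 • hermiteFun q.1 q.2

/-- The orthogonal projection `Π_N` on `E_0 ⊕ ⋯ ⊕ E_N`, on functions. -/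
def projFun (N : ℕ) (f : ℂ → ℂ) : 𝓢(ℂ, ℂ) :=
  ∑ n ∈ Finset.range (N + 1), ∑ q ∈ Finset.HasAntidiagonal.antidiagonal n,
    (∫ z, f z * starRingEnd ℂ (hermiteFun q.1 q.2 z)) • hermiteFun q.1 q.2

/-- `𝒯_N(u) = Π_N 𝒯(Π_N u, Π_N u, Π_N u)`. -/
def truncated (N : ℕ) (u : 𝓢'(ℂ, ℂ)) : 𝓢'(ℂ, ℂ) :=
  SchwartzMap.toTemperedDistributionCLM ℂ ℂ volume
    (projFun N (trilinear (proj N u) (proj N u) (proj N u)))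

/-- `T` represents the nonlinearity `u ↦ 𝒯(u, u, u)` on the support of `μ`: it is the limit of
`𝒯_N` in `L²(μ; ℋ^{-σ}(ℝ²))` for every `σ > 1`. This determines `T` up to `μ`-null sets. -/
structure IsNonlinearity (μ : Measure 𝓢'(ℂ, ℂ)) (T : 𝓢'(ℂ, ℂ) → 𝓢'(ℂ, ℂ)) : Prop where
  aemeasurable : AEMeasurable T μ
  tendsto : ∀ σ : ℝ, 1 < σ →
    Tendsto (fun N => ∫⁻ v, sobolevNormSq (-σ) (truncated N v - T v) ∂μ) atTop (𝓝 0)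

/-- `u` is a global weak solution of `i ∂ₜ u = T(u)`, `u(0) = f`: it belongs to
`⋂_{σ > 1} C(ℝ; ℋ^{-σ}(ℝ²))`, the nonlinear term `T(u)` belongs to
`L²_loc(ℝ; ℋ^{-σ}(ℝ²))` for all `σ > 1`, and `u(t) = f - i ∫₀ᵗ T(u(s)) ds` for all `t ∈ ℝ`, the
integral being tested against Schwartz functions. -/
structure IsGlobalSolution (T : 𝓢'(ℂ, ℂ) → 𝓢'(ℂ, ℂ)) (f : 𝓢'(ℂ, ℂ)) (u : ℝ → 𝓢'(ℂ, ℂ)) :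
    Prop where
  initial : u 0 = f
  continuous : ∀ σ : ℝ, 1 < σ → ContinuousInSobolev (-σ) u
  aestronglyMeasurable : ∀ ψ : 𝓢(ℂ, ℂ), AEStronglyMeasurable (fun s => T (u s) ψ) volume
  locallySqIntegrable : ∀ σ : ℝ, 1 < σ → ∀ R : ℝ,
    ∫⁻ s in Set.Icc (-R) R, sobolevNormSq (-σ) (T (u s)) < ∞
  equation : ∀ (t : ℝ) (ψ : 𝓢(ℂ, ℂ)), u t ψ = f ψ - Complex.I * ∫ s in (0 : ℝ)..t, T (u s) ψ

end CRSystem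

end

/-!
The proof is carried out in coefficients on the Hermite functions. The special Hermite functions
`φ_{j,k}` are orthonormal (`pair_hermiteFun`) and complete (`hasSum_pair_smul_hermiteFun`), so a
tempered distribution is determined by its coefficients (`ext_of_coeff`), and the map `holSeries`,
`c ↦ ∑ cₙ φₙ^{hol}`, transports the law `gaussianSeq` of a sequence of independent standard complex
Gaussian variables to the white noise measure (`whiteNoise_eq`).

**The nonlinearity.** In the variable `w = x + r x^⊥ + z` the Gaussian factors of the integrand of
`𝒯` decouple, and the integral in `r` is the mean of a polynomial over the circle with diameter
`[0, 1]`, that is, its value at the centre (`trilinear_polynomial_mul_gaussian`). Consequently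
`𝒯(φᵢ, φⱼ, φₘ) = π β φ_{i + j - m}`, where `β` is a product of square roots of binomial
probabilities (`interaction`), and the modes of `𝒯_N` are the cubic polynomials `truncatedField`
(`coeff_truncated`). These converge in mean square, with a bound which is uniform in the mode
(`exists_tendsto_truncatedField`): the resonant monomials, with `m ∈ {i, j}`, have summable
coefficients, and the others are orthogonal up to the exchange of `i` and `j`, with square summable
coefficients. As the weights `(2n + 2)^{-σ}` are summable for `σ > 1`, the sequence `𝒯_N` converges
in `L²(μ; ℋ^{-σ})` (`IsLimitField.isNonlinearity`), and the limit is unique almost everywhere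
(`IsNonlinearity.ae_eq`).

**The dynamics.** The truncated equation, multiplied by a smooth cutoff of the mass, is an ordinary
differential equation with a bounded Lipschitz vector field. Being Hamiltonian and invariant under
`c ↦ e^{iθ} c`, it is divergence-free and preserves the mass, so that its flow preserves the
Gaussian measure (`exists_isFlow_measurePreserving`). This uses Liouville's theorem
(`IsFlow.measurePreserving`), proved with the explicit Euler scheme. Starting the flow from
Gaussian data gives stationary processes, whose laws on `ℕ → C(ℝ, ℂ)` are tight, because the
velocities are bounded in mean square (`isTightMeasureSet_of_stationary`). By Prokhorov's theorem
they have a limit law, which is stationary and carried by the solutions of the limiting system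
(`exists_stationary_limit`, `exists_stationary_solution`).

Almost every path under this law is a trajectory (`IsTrajectory`) and gives a global weak solution
(`IsTrajectory.isGlobalSolution`). The set of initial values of all trajectories need not be
measurable. The underlying probability space is therefore a countable union of compact sets of
trajectories, of full measure, whose initial values form a measurable set
(`exists_measurable_subset_measurable_image`).
-/


noncomputable section

namespace CRSystem

/-! ### The nonlinearity in Hermite coefficients -/

/-- The square root of the probability that a binomial variable of parameters `k`, `1/2` equals
`n`. -/
def binomialWeight (k n : ℕ) : ℝ := Real.sqrt (k.choose n / 2 ^ k)

/-- The coefficient of the interaction of the modes `i`, `j`, `m` in the mode `n`: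
`𝒯(φᵢ, φⱼ, φₘ) = π * interaction i j n m * φₙ` for `n = i + j - m`. -/
def interaction (i j n m : ℕ) : ℝ :=
  if i + j = n + m then binomialWeight (i + j) i * binomialWeight (i + j) n else 0

/-- The `n`-th Hermite coefficient of `𝒯_N(u)` in terms of the coefficients `c` of `u`. -/
def truncatedField (N n : ℕ) (c : ℕ → ℂ) : ℂ :=
  if n ≤ N then
    Real.pi * ∑ i ∈ Finset.range (N + 1), ∑ j ∈ Finset.range (N + 1), ∑ m ∈ Finset.range (N + 1),
      (interaction i j n m : ℂ) * (c i * c j * starRingEnd ℂ (c m))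
  else 0

theorem binomialWeight_nonneg (k n : ℕ) : 0 ≤ binomialWeight k n := Real.sqrt_nonneg _

theorem binomialWeight_sq (k n : ℕ) : binomialWeight k n ^ 2 = k.choose n / 2 ^ k :=
  Real.sq_sqrt (by positivity)

theorem binomialWeight_add_symm (i j : ℕ) : binomialWeight (i + j) i = binomialWeight (i + j) j := by
  rw [binomialWeight, binomialWeight, Nat.choose_symm_add]

theorem interaction_nonneg (i j n m : ℕ) : 0 ≤ interaction i j n m := by
  rw [interaction]
  split_ifs
  · exact mul_nonneg (binomialWeight_nonneg _ _) (binomialWeight_nonneg _ _)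
  · exact le_rfl

theorem interaction_swap_left (i j n m : ℕ) : interaction i j n m = interaction j i n m := by
  rw [interaction, interaction, binomialWeight_add_symm, add_comm i j]

theorem interaction_swap_pairs (i j n m : ℕ) : interaction i j n m = interaction n m i j := by
  rw [interaction, interaction]
  by_cases h : i + j = n + m
  · rw [if_pos h, if_pos h.symm, h, mul_comm]
  · rw [if_neg h, if_neg (Ne.symm h)]

theorem interaction_eq_zero {i j n m : ℕ} (h : i + j ≠ n + m) : interaction i j n m = 0 :=
  if_neg h

theorem continuous_truncatedField (N n : ℕ) : Continuous (truncatedField N n) := by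
  unfold truncatedField
  split_ifs
  · refine continuous_const.mul (continuous_finsetSum _ fun i _ => continuous_finsetSum _
      fun j _ => continuous_finsetSum _ fun m _ => continuous_const.mul ?_)
    exact ((continuous_apply i).mul (continuous_apply j)).mul
      (Complex.continuous_conj.comp (continuous_apply m))
  · exact continuous_const

/-! ### The Gaussian measure -/

theorem lintegral_exp_neg_norm_sq :
    ∫⁻ z : ℂ, ENNReal.ofReal (Real.pi⁻¹ * Real.exp (-‖z‖ ^ 2)) = 1 := by
  have h1 : ∫ z : ℂ, Real.exp (-1 * ‖z‖ ^ 2) = Real.pi := by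
    have := GaussianFourier.integral_rexp_neg_mul_sq_norm (V := ℂ) (b := 1) one_pos
    rw [this]
    simp
  have hint : Integrable fun z : ℂ => Real.exp (-1 * ‖z‖ ^ 2) := by
    refine Integrable.of_integral_ne_zero ?_
    rw [h1]
    exact Real.pi_ne_zero
  have h2 : ∫ z : ℂ, Real.pi⁻¹ * Real.exp (-‖z‖ ^ 2) = 1 := by
    rw [integral_const_mul]
    simp only [neg_one_mul] at h1
    rw [h1, inv_mul_cancel₀ Real.pi_ne_zero]
  rw [← ofReal_integral_eq_lintegral_ofReal, h2, ENNReal.ofReal_one]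
  · simp only [neg_one_mul] at hint
    exact hint.const_mul _
  · exact Eventually.of_forall fun z => by positivity

instance : IsProbabilityMeasure stdComplexGaussian := by
  constructor
  rw [stdComplexGaussian, withDensity_apply _ MeasurableSet.univ, Measure.restrict_univ]
  exact lintegral_exp_neg_norm_sq

/-- The law of a sequence of independent standard complex Gaussian variables. -/
def gaussianSeq : Measure (ℕ → ℂ) := Measure.infinitePi fun _ => stdComplexGaussian

instance : IsProbabilityMeasure gaussianSeq := by
  unfold gaussianSeq
  infer_instance

/-! ### Flows of Lipschitz vector fields -/

section Flow

open scoped NNReal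

variable {E : Type*} [NormedAddCommGroup E] [NormedSpace ℝ E]

/-- `Φ` is a global flow of the vector field `F`: the curve `t ↦ Φ t x` is the solution of
`y' = F y` with `y 0 = x`. -/
structure IsFlow (F : E → E) (Φ : ℝ → E → E) : Prop where
  zero : ∀ x, Φ 0 x = x
  hasDerivAt : ∀ x t, HasDerivAt (fun s => Φ s x) (F (Φ t x)) t

/-- A bounded Lipschitz vector field has global integral curves: the local solutions of the
Picard–Lindelöf theorem on `(-n - 1, n + 1)` agree by uniqueness. -/
theorem exists_integralCurve [CompleteSpace E] {F : E → E} {K C : ℝ≥0} (hK : LipschitzWith K F)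
    (hC : ∀ x, ‖F x‖ ≤ C) (x : E) :
    ∃ γ : ℝ → E, γ 0 = x ∧ ∀ t, HasDerivAt γ (F (γ t)) t := by
  have hloc : ∀ n : ℕ, ∃ γ : ℝ → E, γ 0 = x ∧
      ∀ t ∈ Set.Ioo (-(n + 1 : ℝ)) (n + 1), HasDerivAt γ (F (γ t)) t := by
    intro n
    have h0 : (0 : ℝ) ∈ Set.Icc (-(n + 1 : ℝ)) (n + 1) := ⟨by linarith, by positivity⟩
    have hpl : IsPicardLindelof (fun _ : ℝ => F) ⟨(0 : ℝ), h0⟩ x (C * (n + 1)) 0 C K :=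
      IsPicardLindelof.of_time_independent (fun y _ => hC y) (hK.lipschitzOnWith) (by simp)
    obtain ⟨γ, hγ0, hγ⟩ := hpl.exists_eq_forall_mem_Icc_hasDerivWithinAt₀
    refine ⟨γ, hγ0, fun t ht => (hγ t ⟨ht.1.le, ht.2.le⟩).hasDerivAt (Icc_mem_nhds ht.1 ht.2)⟩
  choose γ hγ0 hγ using hloc
  have hagree : ∀ m n : ℕ, m ≤ n → Set.EqOn (γ m) (γ n) (Set.Ioo (-(m + 1 : ℝ)) (m + 1)) := by
    intro m n hmn
    have hsub : Set.Ioo (-(m + 1 : ℝ)) (m + 1) ⊆ Set.Ioo (-(n + 1 : ℝ)) (n + 1) := by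
      have : (m : ℝ) ≤ n := by exact_mod_cast hmn
      exact Set.Ioo_subset_Ioo (by linarith) (by linarith)
    refine ODE_solution_unique_of_mem_Ioo (v := fun _ => F) (s := fun _ => Set.univ) (K := K)
      (t₀ := 0) (fun t _ => hK.lipschitzOnWith)
      ⟨by linarith [(Nat.cast_nonneg m : (0 : ℝ) ≤ m)], by positivity⟩
      (fun t ht => ⟨hγ m t ht, trivial⟩) (fun t ht => ⟨hγ n t (hsub ht), trivial⟩) ?_
    rw [hγ0, hγ0]
  refine ⟨fun t => γ ⌈|t|⌉₊ t, hγ0 _, fun t => ?_⟩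
  have hev : (fun s => γ ⌈|s|⌉₊ s) =ᶠ[𝓝 t] γ (⌈|t|⌉₊ + 1) := by
    have h1 : ∀ᶠ s in 𝓝 t, |s| < |t| + 1 :=
      (continuous_abs.tendsto t).eventually (gt_mem_nhds (by linarith))
    filter_upwards [h1] with s hs
    refine hagree _ _ ?_ ?_
    · refine Nat.ceil_le.2 (hs.le.trans ?_)
      push_cast
      linarith [Nat.le_ceil |t|]
    · have := Nat.le_ceil |s|
      exact abs_lt.1 (by linarith)
  have hmem : t ∈ Set.Ioo (-((⌈|t|⌉₊ + 1 : ℕ) + 1 : ℝ)) ((⌈|t|⌉₊ + 1 : ℕ) + 1) := by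
    have := Nat.le_ceil |t|
    push_cast
    exact abs_lt.1 (by linarith)
  have := (hγ (⌈|t|⌉₊ + 1) t hmem).congr_of_eventuallyEq hev
  rwa [← hev.eq_of_nhds] at this

theorem exists_isFlow [CompleteSpace E] {F : E → E} {K C : ℝ≥0} (hK : LipschitzWith K F)
    (hC : ∀ x, ‖F x‖ ≤ C) : ∃ Φ, IsFlow F Φ := by
  choose γ h0 h1 using exists_integralCurve hK hC
  exact ⟨fun t x => γ x t, h0, h1⟩

namespace IsFlow

variable {F : E → E} {Φ : ℝ → E → E} {K C : ℝ≥0}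

theorem add (h : IsFlow F Φ) (hK : LipschitzWith K F) (s t : ℝ) (x : E) :
    Φ (s + t) x = Φ s (Φ t x) := by
  have := ODE_solution_unique_univ (v := fun _ => F) (s := fun _ => Set.univ) (K := K) (t₀ := 0)
    (f := fun s => Φ (s + t) x) (g := fun s => Φ s (Φ t x)) (fun t => hK.lipschitzOnWith)
    (fun s => ⟨(h.hasDerivAt x (s + t)).comp_add_const s t, trivial⟩)
    (fun s => ⟨h.hasDerivAt _ s, trivial⟩) (by simp [h.zero])
  exact congrFun this s

theorem neg_comp (h : IsFlow F Φ) (hK : LipschitzWith K F) (t : ℝ) (x : E) :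
    Φ (-t) (Φ t x) = x := by
  rw [← h.add hK, neg_add_cancel, h.zero]

theorem reverse (h : IsFlow F Φ) : IsFlow (fun x => -F x) (fun t => Φ (-t)) where
  zero x := by simp [h.zero]
  hasDerivAt x t := by
    have := (h.hasDerivAt x (-t)).scomp t (hasDerivAt_neg t)
    simpa [Function.comp_def] using this

theorem continuous_left (h : IsFlow F Φ) (x : E) : Continuous fun t => Φ t x :=
  continuous_iff_continuousAt.2 fun t => (h.hasDerivAt x t).continuousAt

theorem dist_le_of_nonneg (h : IsFlow F Φ) (hK : LipschitzWith K F) {t : ℝ} (ht : 0 ≤ t) (x y : E) :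
    dist (Φ t x) (Φ t y) ≤ dist x y * Real.exp (K * t) := by
  have := dist_le_of_trajectories_ODE (v := fun _ => F) (K := K) (a := 0) (b := t)
    (f := fun s => Φ s x) (g := fun s => Φ s y) (δ := dist x y) (fun _ => hK)
    (h.continuous_left x).continuousOn (fun s _ => (h.hasDerivAt x s).hasDerivWithinAt)
    (h.continuous_left y).continuousOn (fun s _ => (h.hasDerivAt y s).hasDerivWithinAt)
    (by simp [h.zero]) t ⟨ht, le_rfl⟩
  simpa using this

theorem dist_le (h : IsFlow F Φ) (hK : LipschitzWith K F) (t : ℝ) (x y : E) :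
    dist (Φ t x) (Φ t y) ≤ dist x y * Real.exp (K * |t|) := by
  rcases le_total 0 t with ht | ht
  · rw [abs_of_nonneg ht]
    exact h.dist_le_of_nonneg hK ht x y
  · rw [abs_of_nonpos ht]
    have hK' : LipschitzWith K fun x => -F x := by
      intro x y
      rw [edist_neg_neg]
      exact hK x y
    simpa using h.reverse.dist_le_of_nonneg hK' (neg_nonneg.2 ht) x y

theorem dist_time_le (h : IsFlow F Φ) (hC : ∀ x, ‖F x‖ ≤ C) (s t : ℝ) (x : E) :
    dist (Φ s x) (Φ t x) ≤ C * |s - t| := by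
  have := Convex.norm_image_sub_le_of_norm_hasDerivWithin_le (f := fun s => Φ s x)
    (f' := fun s => F (Φ s x)) (s := Set.univ) (C := C) (x := t) (y := s)
    (fun r _ => (h.hasDerivAt x r).hasDerivWithinAt) (fun r _ => hC _) convex_univ trivial trivial
  rwa [dist_eq_norm]

theorem continuous_uncurry (h : IsFlow F Φ) (hK : LipschitzWith K F) (hC : ∀ x, ‖F x‖ ≤ C) :
    Continuous fun q : ℝ × E => Φ q.1 q.2 := by
  rw [continuous_iff_continuousAt]
  rintro ⟨t, x⟩
  rw [ContinuousAt, tendsto_iff_dist_tendsto_zero]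
  have hb : ∀ q : ℝ × E, dist (Φ q.1 q.2) (Φ t x)
      ≤ dist q.2 x * Real.exp (K * |q.1|) + C * |q.1 - t| := fun q =>
    (dist_triangle _ (Φ q.1 x) _).trans (add_le_add (h.dist_le hK _ _ _) (h.dist_time_le hC _ _ _))
  refine squeeze_zero (fun _ => dist_nonneg) hb ?_
  have hc : Continuous fun q : ℝ × E => dist q.2 x * Real.exp (K * |q.1|) + C * |q.1 - t| := by
    fun_prop
  simpa using hc.tendsto (t, x)

/-- One step of the explicit Euler scheme has a local error of second order. -/
theorem dist_euler_le (h : IsFlow F Φ) (hK : LipschitzWith K F) (hC : ∀ x, ‖F x‖ ≤ C) {τ : ℝ}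
    (hτ : 0 ≤ τ) (x : E) : dist (x + τ • F x) (Φ τ x) ≤ K * C * τ ^ 2 := by
  have hd : ∀ s ∈ Set.Icc 0 τ, HasDerivWithinAt (fun s => Φ s x - s • F x)
      (F (Φ s x) - F x) (Set.Icc 0 τ) s := fun s _ => by
    have := (h.hasDerivAt x s).fun_sub ((hasDerivAt_id' s).smul_const (F x))
    simpa using this.hasDerivWithinAt
  have hb : ∀ s ∈ Set.Icc 0 τ, ‖F (Φ s x) - F x‖ ≤ K * C * τ := fun s hs => by
    have h1 := hK.dist_le_mul (Φ s x) x
    have h2 := h.dist_time_le hC s 0 x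
    rw [h.zero, sub_zero, abs_of_nonneg hs.1] at h2
    rw [← dist_eq_norm]
    calc _ ≤ K * dist (Φ s x) x := h1
      _ ≤ K * (C * τ) := by gcongr; exact h2.trans (by gcongr; exact hs.2)
      _ = _ := by ring
  have := (convex_Icc 0 τ).norm_image_sub_le_of_norm_hasDerivWithin_le hd hb
    (x := 0) (y := τ) ⟨le_rfl, hτ⟩ ⟨hτ, le_rfl⟩
  rw [h.zero, zero_smul, sub_zero, sub_zero, Real.norm_of_nonneg hτ] at this
  rw [dist_comm, dist_eq_norm]
  calc _ = ‖Φ τ x - τ • F x - x‖ := by congr 1; abel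
    _ ≤ _ := this
    _ = _ := by ring

theorem dist_iterate_euler_le (h : IsFlow F Φ) (hK : LipschitzWith K F) (hC : ∀ x, ‖F x‖ ≤ C)
    {τ : ℝ} (hτ : 0 ≤ τ) (x : E) (n : ℕ) :
    dist ((fun y => y + τ • F y)^[n] x) (Φ (n * τ) x) ≤ n * (K * C * τ ^ 2) * (1 + K * τ) ^ n := by
  have h1 : 1 ≤ 1 + K * τ := by
    have : 0 ≤ K * τ := by positivity
    linarith
  induction n with
  | zero => simp [h.zero]
  | succ n ih =>
    rw [Function.iterate_succ_apply']
    set y := (fun y => y + τ • F y)^[n] x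
    have e : ((n + 1 : ℕ) : ℝ) * τ = τ + n * τ := by push_cast; ring
    rw [e, h.add hK]
    set z := Φ (n * τ) x
    have hs : dist (y + τ • F y) (z + τ • F z) ≤ (1 + K * τ) * dist y z := by
      calc _ ≤ dist y z + dist (τ • F y) (τ • F z) := dist_add_add_le _ _ _ _
        _ ≤ dist y z + τ * (K * dist y z) := by
          rw [dist_smul₀, Real.norm_of_nonneg hτ]
          gcongr
          exact hK.dist_le_mul _ _
        _ = _ := by ring
    calc _ ≤ dist (y + τ • F y) (z + τ • F z) + dist (z + τ • F z) (Φ τ z) := dist_triangle _ _ _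
      _ ≤ (1 + K * τ) * (n * (K * C * τ ^ 2) * (1 + K * τ) ^ n) + K * C * τ ^ 2 := by
        gcongr
        · exact hs.trans (by gcongr)
        · exact h.dist_euler_le hK hC hτ z
      _ ≤ (1 + K * τ) * (n * (K * C * τ ^ 2) * (1 + K * τ) ^ n)
            + K * C * τ ^ 2 * (1 + K * τ) ^ (n + 1) := by
        have h2 : (1 : ℝ) ≤ (1 + K * τ) ^ (n + 1) := one_le_pow₀ h1
        have h3 : 0 ≤ K * C * τ ^ 2 := by positivity
        nlinarith
      _ = _ := by push_cast; ring

theorem tendsto_iterate_euler (h : IsFlow F Φ) (hK : LipschitzWith K F) (hC : ∀ x, ‖F x‖ ≤ C)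
    {t : ℝ} (ht : 0 ≤ t) (x : E) :
    Tendsto (fun n : ℕ => (fun y => y + (t / n) • F y)^[n] x) atTop (𝓝 (Φ t x)) := by
  rw [tendsto_iff_dist_tendsto_zero]
  refine squeeze_zero' (g := fun n : ℕ => K * C * t ^ 2 * Real.exp (K * t) / n)
    (Eventually.of_forall fun _ => dist_nonneg) ?_ (tendsto_const_div_atTop_nhds_zero_nat _)
  filter_upwards [eventually_gt_atTop 0] with n hn
  have hn' : (0 : ℝ) < n := by exact_mod_cast hn
  have h1 := h.dist_iterate_euler_le hK hC (τ := t / n) (by positivity) x n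
  rw [mul_div_cancel₀ _ hn'.ne'] at h1
  refine h1.trans ?_
  have h2 : (1 + K * (t / n)) ^ n ≤ Real.exp (K * t) := by
    calc (1 + K * (t / n)) ^ n ≤ Real.exp (K * (t / n)) ^ n := by
          gcongr
          linarith [Real.add_one_le_exp (K * (t / n))]
      _ = Real.exp (K * t) := by
          rw [← Real.exp_nat_mul]
          congr 1
          field_simp
  calc _ ≤ n * (K * C * (t / n) ^ 2) * Real.exp (K * t) := by gcongr
    _ = _ := by field_simp

end IsFlow

end Flow

/-! ### Divergence-free vector fields and Liouville's theorem -/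

section Liouville

open scoped NNReal

/-- First-order expansion of a product of factors close to `1`. -/
theorem abs_prod_one_add_sub_le {ι : Type*} (s : Finset ι) {τ A : ℝ} (hτ : |τ| ≤ 1) (hA : 0 ≤ A)
    (m : ι → ℝ) (hm : ∀ i ∈ s, |m i| ≤ A) :
    |∏ i ∈ s, (1 + τ * m i) - (1 + τ * ∑ i ∈ s, m i)| ≤ (1 + A) ^ (2 * s.card) * τ ^ 2 := by
  classical
  induction s using Finset.induction_on with
  | empty => simpa using sq_nonneg τ
  | insert i s hi ih =>
    have hs := ih fun j hj => hm j (Finset.mem_insert_of_mem hj)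
    have hi' := hm i (Finset.mem_insert_self i s)
    have hsum : |∑ j ∈ s, m j| ≤ s.card * A := by
      refine (Finset.abs_sum_le_sum_abs _ _).trans ?_
      simpa using Finset.sum_le_card_nsmul s (fun j => |m j|) A
        fun j hj => hm j (Finset.mem_insert_of_mem hj)
    rw [Finset.prod_insert hi, Finset.sum_insert hi, Finset.card_insert_of_notMem hi]
    set P := ∏ j ∈ s, (1 + τ * m j)
    set S := ∑ j ∈ s, m j
    have e : (1 + τ * m i) * P - (1 + τ * (m i + S))
        = (1 + τ * m i) * (P - (1 + τ * S)) + τ ^ 2 * (m i * S) := by ring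
    have h1 : |1 + τ * m i| ≤ 1 + A := by
      refine (abs_add_le _ _).trans ?_
      rw [abs_one, abs_mul]
      nlinarith [abs_nonneg τ, abs_nonneg (m i)]
    have hcard : s.card * A ≤ (1 + A) ^ s.card := by
      have := one_add_mul_le_pow (a := A) (by linarith) s.card
      linarith
    have hpow : (1 + A) ^ s.card ≤ (1 + A) ^ (2 * s.card) :=
      pow_le_pow_right₀ (by linarith) (by omega)
    have hX : 0 ≤ (1 + A) ^ (2 * s.card) := by positivity
    rw [e]
    calc _ ≤ |1 + τ * m i| * |P - (1 + τ * S)| + τ ^ 2 * (|m i| * |S|) := by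
          refine (abs_add_le _ _).trans ?_
          rw [abs_mul, abs_mul, abs_mul, abs_of_nonneg (sq_nonneg τ)]
      _ ≤ (1 + A) * ((1 + A) ^ (2 * s.card) * τ ^ 2) + τ ^ 2 * (A * (1 + A) ^ (2 * s.card)) := by
          gcongr
          exact hsum.trans (hcard.trans hpow)
      _ = ((1 + 2 * A) * (1 + A) ^ (2 * s.card)) * τ ^ 2 := by ring
      _ ≤ ((1 + A) ^ 2 * (1 + A) ^ (2 * s.card)) * τ ^ 2 := by
          gcongr
          nlinarith
      _ = _ := by ring

/-- A perturbation of size `τ` of the identity by a trace-free matrix changes volumes by a factor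
`1 + O(τ²)` only. -/
theorem abs_det_one_add_smul_sub_one_le {ι : Type*} [Fintype ι] [DecidableEq ι] {A : ℝ}
    (hA : 0 ≤ A) (M : Matrix ι ι ℝ) (hM : ∀ i j, |M i j| ≤ A) (htr : M.trace = 0) {τ : ℝ}
    (hτ : |τ| ≤ 1) :
    |(1 + τ • M).det - 1|
      ≤ ((Fintype.card ι).factorial * (1 + A) ^ (2 * Fintype.card ι)) * τ ^ 2 := by
  set d := Fintype.card ι
  have hentry : ∀ i j, (1 + τ • M) i j = (if i = j then 1 else 0) + τ * M i j := fun i j => by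
    simp [Matrix.one_apply]
  have hle : ∀ i j, |(1 + τ • M) i j| ≤ 1 + A := fun i j => by
    rw [hentry]
    refine (abs_add_le _ _).trans ?_
    have : |τ * M i j| ≤ 1 * A := by rw [abs_mul]; gcongr; exact hM i j
    split_ifs <;> simp only [abs_one, abs_zero] <;> linarith
  have hoff : ∀ i j, i ≠ j → |(1 + τ • M) i j| ≤ |τ| * (1 + A) := fun i j hij => by
    rw [hentry, if_neg hij, zero_add, abs_mul]
    gcongr
    linarith [hM i j]
  have hperm : ∀ σ : Equiv.Perm ι,
      |(σ.sign : ℤ) * ∏ i, (1 + τ • M) (σ i) i - if σ = 1 then 1 else 0|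
        ≤ (1 + A) ^ (2 * d) * τ ^ 2 := by
    intro σ
    by_cases hσ : σ = 1
    · subst hσ
      have := abs_prod_one_add_sub_le (Finset.univ : Finset ι) hτ hA (fun i => M i i)
        fun i _ => hM i i
      have h0 : ∑ i, M i i = 0 := htr
      rw [h0, mul_zero, add_zero] at this
      simpa [hentry] using this
    · rw [if_neg hσ, sub_zero, abs_mul]
      have hs : |((σ.sign : ℤ) : ℝ)| = 1 := by
        rcases Int.units_eq_one_or σ.sign with h | h <;> simp [h]
      rw [hs, one_mul, Finset.abs_prod]
      -- a permutation other than the identity moves two indices at least, each of which contributes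
      -- an off-diagonal entry of size `O(τ)`
      obtain ⟨i, hi⟩ : ∃ i, σ i ≠ i := by
        by_contra! hcon
        exact hσ (Equiv.ext hcon)
      have hne : σ i ≠ i := hi
      have hi2 : σ (σ i) ≠ σ i := fun h => hi (σ.injective h)
      have hmem : σ i ∈ Finset.univ.erase i := by simp [hi]
      rw [← Finset.mul_prod_erase _ _ (Finset.mem_univ i), ← Finset.mul_prod_erase _ _ hmem]
      have hrest : ∏ j ∈ (Finset.univ.erase i).erase (σ i), |(1 + τ • M) (σ j) j|
          ≤ (1 + A) ^ (((Finset.univ : Finset ι).erase i).erase (σ i)).card :=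
        (Finset.prod_le_prod (fun _ _ => abs_nonneg _) fun j _ => hle _ _).trans_eq
          (Finset.prod_const _)
      have hcard : (((Finset.univ : Finset ι).erase i).erase (σ i)).card + 2 ≤ 2 * d := by
        have h1 := Finset.card_erase_of_mem hmem
        have h2 := Finset.card_erase_of_mem (Finset.mem_univ i)
        have h3 : 0 < ((Finset.univ : Finset ι).erase i).card := Finset.card_pos.2 ⟨_, hmem⟩
        have h4 : (Finset.univ : Finset ι).card = d := Finset.card_univ
        omega
      have hnn : 0 ≤ ∏ j ∈ (Finset.univ.erase i).erase (σ i), |(1 + τ • M) (σ j) j| :=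
        Finset.prod_nonneg fun _ _ => abs_nonneg _
      calc _ ≤ (|τ| * (1 + A)) * ((|τ| * (1 + A)) *
            (1 + A) ^ (((Finset.univ : Finset ι).erase i).erase (σ i)).card) := by
            gcongr
            · exact hoff _ _ hi
            · exact hoff _ _ hi2
        _ = (1 + A) ^ ((((Finset.univ : Finset ι).erase i).erase (σ i)).card + 2) * τ ^ 2 := by
            rw [← sq_abs τ]
            ring
        _ ≤ _ := by
            gcongr
            linarith
  have hdet : (1 + τ • M).det - 1 = ∑ σ : Equiv.Perm ι,
      ((σ.sign : ℤ) * ∏ i, (1 + τ • M) (σ i) i - if σ = 1 then 1 else 0) := by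
    rw [Finset.sum_sub_distrib, Matrix.det_apply']
    simp
  rw [hdet]
  refine (Finset.abs_sum_le_sum_abs _ _).trans ?_
  refine (Finset.sum_le_card_nsmul _ _ _ fun σ _ => hperm σ).trans ?_
  rw [Finset.card_univ, Fintype.card_perm, nsmul_eq_mul, mul_assoc]

variable {E : Type*} [NormedAddCommGroup E] [NormedSpace ℝ E] [FiniteDimensional ℝ E]
  {F : E → E} {Φ : ℝ → E → E} {K C : ℝ≥0}

theorem exists_abs_det_fderiv_euler_ge (hK : LipschitzWith K F)
    (htr : ∀ x, LinearMap.trace ℝ E (fderiv ℝ F x : E →ₗ[ℝ] E) = 0) :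
    ∃ B : ℝ, 0 ≤ B ∧ ∀ τ : ℝ, |τ| ≤ 1 → ∀ x,
      1 - B * τ ^ 2 ≤ |(ContinuousLinearMap.id ℝ E + τ • fderiv ℝ F x).det| := by
  classical
  let b := Module.finBasis ℝ E
  let c : ∀ i, E →L[ℝ] ℝ := fun i => (b.coord i).toContinuousLinearMap
  let A : ℝ := ∑ i, ∑ j, ‖c i‖ * (K * ‖b j‖)
  have hA : 0 ≤ A := by positivity
  refine ⟨((Fintype.card (Fin (Module.finrank ℝ E))).factorial *
    (1 + A) ^ (2 * Fintype.card (Fin (Module.finrank ℝ E)))), by positivity, fun τ hτ x => ?_⟩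
  set M := LinearMap.toMatrix b b (fderiv ℝ F x : E →ₗ[ℝ] E) with hMdef
  have hM : ∀ i j, |M i j| ≤ A := fun i j => by
    have h1 : M i j = c i (fderiv ℝ F x (b j)) := by
      simp [hMdef, LinearMap.toMatrix_apply, c]
    rw [h1, ← Real.norm_eq_abs]
    calc _ ≤ ‖c i‖ * (K * ‖b j‖) := by
          refine (ContinuousLinearMap.le_opNorm _ _).trans ?_
          gcongr
          refine (ContinuousLinearMap.le_opNorm _ _).trans ?_
          gcongr
          exact norm_fderiv_le_of_lipschitz ℝ hK
      _ ≤ ∑ j, ‖c i‖ * (K * ‖b j‖) :=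
          Finset.single_le_sum (f := fun j => ‖c i‖ * (K * ‖b j‖)) (fun _ _ => by positivity)
            (Finset.mem_univ j)
      _ ≤ A := Finset.single_le_sum (f := fun i => ∑ j, ‖c i‖ * (K * ‖b j‖))
            (fun _ _ => by positivity) (Finset.mem_univ i)
  have htrM : M.trace = 0 := by
    rw [hMdef, ← LinearMap.trace_eq_matrix_trace, htr]
  have hdet : (ContinuousLinearMap.id ℝ E + τ • fderiv ℝ F x).det = (1 + τ • M).det := by
    rw [ContinuousLinearMap.det, ← LinearMap.det_toMatrix b]
    congr 1
    rw [hMdef]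
    ext i j
    simp [LinearMap.toMatrix_apply, Matrix.one_apply, Finsupp.single_apply, eq_comm]
  have := abs_det_one_add_smul_sub_one_le hA M hM htrM hτ
  rw [hdet]
  have h3 := (abs_le.1 this).1
  exact le_trans (by linarith) (le_abs_self _)

variable [MeasurableSpace E] [BorelSpace E] (μ : Measure E) [μ.IsAddHaarMeasure]

/-- One step of the explicit Euler scheme for a divergence-free vector field almost preserves the
volume. Since the step is injective, this follows from the change of variables formula. -/
theorem exists_lintegral_euler_le (hK : LipschitzWith K F) (hF : Differentiable ℝ F)
    (htr : ∀ x, LinearMap.trace ℝ E (fderiv ℝ F x : E →ₗ[ℝ] E) = 0) :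
    ∃ B : ℝ, 0 ≤ B ∧ ∀ τ : ℝ, 0 ≤ τ → τ ≤ 1 → K * τ < 1 → ∀ f : E → ℝ≥0∞,
      ENNReal.ofReal (1 - B * τ ^ 2) * ∫⁻ x, f (x + τ • F x) ∂μ ≤ ∫⁻ x, f x ∂μ := by
  obtain ⟨B, hB, hdet⟩ := exists_abs_det_fderiv_euler_ge hK htr
  refine ⟨B, hB, fun τ h0 h1 hKτ f => ?_⟩
  have hinj : Function.Injective fun x => x + τ • F x := by
    intro x y hxy
    have e : x - y = τ • (F y - F x) := by
      have : x + τ • F x = y + τ • F y := hxy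
      rw [smul_sub, sub_eq_sub_iff_add_eq_add, this, add_comm]
    have h2 : ‖x - y‖ ≤ K * τ * ‖x - y‖ := by
      conv_lhs => rw [e, norm_smul, Real.norm_of_nonneg h0]
      have := hK.dist_le_mul y x
      rw [dist_eq_norm, dist_eq_norm, norm_sub_rev y x] at this
      nlinarith
    have h3 : ‖x - y‖ = 0 := by nlinarith [norm_nonneg (x - y)]
    exact sub_eq_zero.1 (norm_eq_zero.1 h3)
  have hd : ∀ x ∈ Set.univ, HasFDerivWithinAt (fun x => x + τ • F x)
      (ContinuousLinearMap.id ℝ E + τ • fderiv ℝ F x) Set.univ x := fun x _ =>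
    ((hasFDerivAt_id x).fun_add ((hF x).hasFDerivAt.fun_const_smul τ)).hasFDerivWithinAt
  have hcv := lintegral_image_eq_lintegral_abs_det_fderiv_mul μ MeasurableSet.univ hd
    (hinj.injOn) f
  rw [Measure.restrict_univ] at hcv
  calc _ ≤ ∫⁻ x, ENNReal.ofReal (1 - B * τ ^ 2) * f (x + τ • F x) ∂μ :=
        lintegral_const_mul_le _ _
    _ ≤ _ := lintegral_mono fun x => by
        gcongr
        exact hdet τ (by rwa [abs_of_nonneg h0]) x
    _ ≤ _ := hcv.symm.le
    _ ≤ _ := setLIntegral_le_lintegral _ _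

/-- The flow is the limit of `n` Euler steps of size `t / n`, which lose a factor `(1 - B t² / n²) ^
n → 1` at most. By Fatou's lemma the inequality holds for open sets, and for all sets by outer
regularity. -/
theorem IsFlow.measure_preimage_le (h : IsFlow F Φ) (hK : LipschitzWith K F)
    (hC : ∀ x, ‖F x‖ ≤ C) (hF : Differentiable ℝ F)
    (htr : ∀ x, LinearMap.trace ℝ E (fderiv ℝ F x : E →ₗ[ℝ] E) = 0) {t : ℝ} (ht : 0 ≤ t)
    (A : Set E) : μ (Φ t ⁻¹' A) ≤ μ A := by
  obtain ⟨B, hB, hstep⟩ := exists_lintegral_euler_le μ hK hF htr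
  -- outer regularity
  suffices hopen : ∀ U : Set E, IsOpen U → μ (Φ t ⁻¹' U) ≤ μ U by
    rw [A.measure_eq_iInf_isOpen μ]
    refine le_iInf₂ fun U hU => le_iInf fun hUo => ?_
    exact (measure_mono (Set.preimage_mono hU)).trans (hopen U hUo)
  intro U hU
  set f : E → ℝ≥0∞ := U.indicator 1
  have hcont : Continuous (Φ t) := (h.continuous_uncurry hK hC).comp (by fun_prop : Continuous
    fun x : E => (t, x))
  have hiter : ∀ τ : ℝ, 0 ≤ τ → τ ≤ 1 → K * τ < 1 → ∀ n : ℕ,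
      ENNReal.ofReal (1 - B * τ ^ 2) ^ n * ∫⁻ x, f ((fun y => y + τ • F y)^[n] x) ∂μ
        ≤ ∫⁻ x, f x ∂μ := by
    intro τ h0 h1 hKτ n
    induction n with
    | zero => simp
    | succ n ih =>
      refine le_trans ?_ ih
      rw [pow_succ, mul_assoc]
      gcongr
      exact hstep τ h0 h1 hKτ fun x => f ((fun y => y + τ • F y)^[n] x)
  have hn : ∀ᶠ n : ℕ in atTop, ∫⁻ x, ENNReal.ofReal (1 - B * t ^ 2 / n) *
      f ((fun y => y + (t / n) • F y)^[n] x) ∂μ ≤ ∫⁻ x, f x ∂μ := by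
    have h1 : ∀ᶠ n : ℕ in atTop, t / n < 1 :=
      (tendsto_const_div_atTop_nhds_zero_nat t).eventually (gt_mem_nhds one_pos)
    have h2 : ∀ᶠ n : ℕ in atTop, K * t / n < 1 :=
      (tendsto_const_div_atTop_nhds_zero_nat (K * t)).eventually (gt_mem_nhds one_pos)
    have h3 : ∀ᶠ n : ℕ in atTop, B * t ^ 2 / n < 1 :=
      (tendsto_const_div_atTop_nhds_zero_nat (B * t ^ 2)).eventually (gt_mem_nhds one_pos)
    filter_upwards [h1, h2, h3, eventually_gt_atTop 0] with n h1 h2 h3 h4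
    have hn' : (0 : ℝ) < n := by exact_mod_cast h4
    have hn1 : (1 : ℝ) ≤ n := by exact_mod_cast h4
    have key := hiter (t / n) (by positivity) h1.le (by rw [← mul_div_assoc]; exact h2) n
    have hE : Measurable fun y : E => y + (t / n) • F y :=
      (continuous_id.add (hF.continuous.const_smul (t / n))).measurable
    have hfm : Measurable fun x => f ((fun y => y + (t / n) • F y)^[n] x) :=
      (measurable_one.indicator hU.measurableSet).comp (hE.iterate n)
    rw [lintegral_const_mul _ hfm]
    refine le_trans ?_ key
    gcongr
    have hq : 0 ≤ B * (t / n) ^ 2 := by positivity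
    have hq1 : B * (t / n) ^ 2 ≤ B * t ^ 2 / n := by
      rw [div_pow, ← mul_div_assoc]
      gcongr
      nlinarith
    rw [← ENNReal.ofReal_pow (by linarith)]
    refine ENNReal.ofReal_le_ofReal ?_
    -- Bernoulli's inequality
    have hbern := one_add_mul_le_pow (a := -(B * (t / n) ^ 2)) (by linarith) n
    have e : (n : ℝ) * -(B * (t / n) ^ 2) = -(B * t ^ 2 / n) := by field_simp
    rw [e] at hbern
    rwa [← sub_eq_add_neg, ← sub_eq_add_neg] at hbern
  -- the indicator of an open set is lower semicontinuous
  have hlim : ∀ x, f (Φ t x) ≤ liminf (fun n : ℕ => ENNReal.ofReal (1 - B * t ^ 2 / n) *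
      f ((fun y => y + (t / n) • F y)^[n] x)) atTop := by
    intro x
    by_cases hx : Φ t x ∈ U
    · have hev := (h.tendsto_iterate_euler hK hC ht x).eventually (hU.mem_nhds hx)
      have hc : Tendsto (fun n : ℕ => ENNReal.ofReal (1 - B * t ^ 2 / n)) atTop (𝓝 1) := by
        have : Tendsto (fun n : ℕ => 1 - B * t ^ 2 / n) atTop (𝓝 (1 - 0)) :=
          tendsto_const_nhds.sub (tendsto_const_div_atTop_nhds_zero_nat (B * t ^ 2))
        rw [sub_zero] at this
        simpa using ENNReal.tendsto_ofReal this
      have hc' := hc.congr' (f₂ := fun n : ℕ => ENNReal.ofReal (1 - B * t ^ 2 / n) *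
        f ((fun y => y + (t / n) • F y)^[n] x)) (by
          filter_upwards [hev] with n hn
          simp [f, Set.indicator_of_mem hn])
      rw [hc'.liminf_eq]
      simp [f, Set.indicator_of_mem hx]
    · simp [f, Set.indicator_of_notMem hx]
  have hmeas : ∀ n : ℕ, Measurable fun x => ENNReal.ofReal (1 - B * t ^ 2 / n) *
      f ((fun y => y + (t / n) • F y)^[n] x) := fun n => by
    have hE : Measurable fun y : E => y + (t / n) • F y :=
      (continuous_id.add (hF.continuous.const_smul (t / n))).measurable
    exact ((measurable_one.indicator hU.measurableSet).comp (hE.iterate n)).const_mul _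
  calc μ (Φ t ⁻¹' U) = ∫⁻ x, f (Φ t x) ∂μ := by
        rw [← lintegral_indicator_one (hU.preimage hcont).measurableSet]
        rfl
    _ ≤ ∫⁻ x, liminf (fun n : ℕ => ENNReal.ofReal (1 - B * t ^ 2 / n) *
          f ((fun y => y + (t / n) • F y)^[n] x)) atTop ∂μ := lintegral_mono hlim
    _ ≤ liminf (fun n : ℕ => ∫⁻ x, ENNReal.ofReal (1 - B * t ^ 2 / n) *
          f ((fun y => y + (t / n) • F y)^[n] x) ∂μ) atTop := lintegral_liminf_le hmeas
    _ ≤ ∫⁻ x, f x ∂μ := by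
        refine (liminf_le_liminf hn).trans ?_
        simp
    _ = μ U := by rw [lintegral_indicator_one hU.measurableSet]

/-- **Liouville's theorem**: the flow of a divergence-free vector field preserves the volume. -/
theorem IsFlow.measurePreserving (h : IsFlow F Φ) (hK : LipschitzWith K F)
    (hC : ∀ x, ‖F x‖ ≤ C) (hF : Differentiable ℝ F)
    (htr : ∀ x, LinearMap.trace ℝ E (fderiv ℝ F x : E →ₗ[ℝ] E) = 0) (t : ℝ) :
    MeasurePreserving (Φ t) μ μ := by
  have hcont : Continuous (Φ t) := (h.continuous_uncurry hK hC).comp (by fun_prop : Continuous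
    fun x : E => (t, x))
  have hle : ∀ (s : ℝ) (A : Set E), μ (Φ s ⁻¹' A) ≤ μ A := by
    intro s A
    rcases le_total 0 s with hs | hs
    · exact h.measure_preimage_le μ hK hC hF htr hs A
    · have hK' : LipschitzWith K fun x => -F x := fun x y => by
        rw [edist_neg_neg]
        exact hK x y
      have := h.reverse.measure_preimage_le μ hK' (by simpa using hC) hF.neg
        (fun x => by
          have e : fderiv ℝ (fun x => -F x) x = -fderiv ℝ F x := fderiv_fun_neg
          rw [e]
          simpa using htr x) (neg_nonneg.2 hs) A
      simpa using this
  refine ⟨hcont.measurable, Measure.ext fun A hA => ?_⟩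
  rw [Measure.map_apply hcont.measurable hA]
  refine le_antisymm (hle t A) ?_
  have hpre : Φ (-t) ⁻¹' (Φ t ⁻¹' A) = A := by
    ext x
    have := h.neg_comp hK (-t) x
    rw [neg_neg] at this
    simp [this]
  calc μ A = μ (Φ (-t) ⁻¹' (Φ t ⁻¹' A)) := by rw [hpre]
    _ ≤ _ := hle _ _

end Liouville

/-! ### The path space and its compact subsets -/

section PathSpace

open scoped NNReal

instance instMeasurableSpacePath : MeasurableSpace C(ℝ, ℂ) := borel _

instance instBorelSpacePath : BorelSpace C(ℝ, ℂ) := ⟨rfl⟩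

/-- The space of sequences of continuous paths in `ℂ`, with the topology of locally uniform
convergence of each component. It is the space of trajectories of the Hermite coefficients. -/
abbrev PathSpace := ℕ → C(ℝ, ℂ)

/-- The position at time `t` of a path. -/
def pathAt (x : PathSpace) (t : ℝ) : ℕ → ℂ := fun n => x n t

theorem continuous_pathAt_uncurry : Continuous fun q : PathSpace × ℝ => pathAt q.1 q.2 := by
  refine continuous_pi fun n => ?_
  exact ContinuousEval.continuous_eval.comp
    (((continuous_apply n).comp continuous_fst).prodMk continuous_snd)

theorem continuous_pathAt (t : ℝ) : Continuous fun x : PathSpace => pathAt x t :=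
  continuous_pathAt_uncurry.comp (by fun_prop : Continuous fun x : PathSpace => (x, t))

theorem continuous_pathAt_right (x : PathSpace) : Continuous fun t => pathAt x t :=
  continuous_pathAt_uncurry.comp (by fun_prop : Continuous fun t : ℝ => (x, t))

/-- The paths starting in a ball of radius `A` and satisfying, on each interval `[-R, R]`, a Hölder
estimate of exponent `1/2` with a constant depending on `R` only. -/
def holderSet (A : ℝ) (B : ℕ → ℝ) : Set C(ℝ, ℂ) :=
  {x | ‖x 0‖ ≤ A ∧ ∀ (R : ℕ), ∀ s ∈ Set.Icc (-R : ℝ) R, ∀ t ∈ Set.Icc (-R : ℝ) R,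
    ‖x t - x s‖ ^ 2 ≤ B R * |t - s|}

/-- The Arzelà–Ascoli theorem. -/
theorem isCompact_holderSet (A : ℝ) (B : ℕ → ℝ) : IsCompact (holderSet A B) := by
  -- the Hölder condition on functions which are not assumed to be continuous
  let P : Set (ℝ → ℂ) := {f | ‖f 0‖ ≤ A ∧ ∀ (R : ℕ), ∀ s ∈ Set.Icc (-R : ℝ) R,
    ∀ t ∈ Set.Icc (-R : ℝ) R, ‖f t - f s‖ ^ 2 ≤ B R * |t - s|}
  have hmod : ∀ f ∈ P, ∀ (R : ℕ), ∀ s ∈ Set.Icc (-R : ℝ) R, ∀ t ∈ Set.Icc (-R : ℝ) R,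
      ‖f t - f s‖ ≤ Real.sqrt (B R * |t - s|) := fun f hf R s hs t ht =>
    Real.le_sqrt_of_sq_le (hf.2 R s hs t ht)
  have hmem : ∀ s : ℝ, ∃ R : ℕ, ∀ᶠ t in 𝓝 s, t ∈ Set.Icc (-R : ℝ) R := by
    intro s
    refine ⟨⌈|s|⌉₊ + 1, ?_⟩
    have := Nat.le_ceil |s|
    have h := abs_lt.1 (show |s| < (⌈|s|⌉₊ + 1 : ℕ) by push_cast; linarith)
    exact Icc_mem_nhds h.1 h.2
  have hlim : ∀ (s : ℝ) (R : ℕ), Tendsto (fun t => Real.sqrt (B R * |t - s|)) (𝓝 s) (𝓝 0) := by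
    intro s R
    have : Continuous fun t => Real.sqrt (B R * |t - s|) := by fun_prop
    simpa using this.tendsto s
  have himage : ContinuousMap.toFun '' holderSet A B = P := by
    ext f
    constructor
    · rintro ⟨x, hx, rfl⟩
      exact hx
    · intro hf
      refine ⟨⟨f, continuous_iff_continuousAt.2 fun s => ?_⟩, hf, rfl⟩
      obtain ⟨R, hR⟩ := hmem s
      rw [ContinuousAt, tendsto_iff_norm_sub_tendsto_zero]
      refine squeeze_zero' (Eventually.of_forall fun _ => norm_nonneg _) ?_ (hlim s R)
      filter_upwards [hR] with t ht
      exact hmod f hf R s hR.self_of_nhds t ht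
  refine ArzelaAscoli.isCompact_of_equicontinuous _ ?_ ?_
  · rw [himage]
    have hsub : P ⊆ Set.pi Set.univ fun t : ℝ =>
        Metric.closedBall (0 : ℂ) (A + Real.sqrt (B ⌈|t|⌉₊ * |t - 0|)) := by
      intro f hf t _
      rw [mem_closedBall_zero_iff]
      have ht := abs_le.1 (Nat.le_ceil |t|)
      have h0 : (0 : ℝ) ∈ Set.Icc (-(⌈|t|⌉₊ : ℝ)) ⌈|t|⌉₊ := ⟨by simp, by simp⟩
      have := hmod f hf ⌈|t|⌉₊ 0 h0 t ⟨ht.1, ht.2⟩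
      calc ‖f t‖ = ‖f 0 + (f t - f 0)‖ := by congr 1; ring
        _ ≤ ‖f 0‖ + ‖f t - f 0‖ := norm_add_le _ _
        _ ≤ _ := add_le_add hf.1 this
    refine (isCompact_univ_pi fun t => isCompact_closedBall _ _).of_isClosed_subset ?_ hsub
    have : P = {f | ‖f 0‖ ≤ A} ∩ ⋂ (R : ℕ), ⋂ s ∈ Set.Icc (-R : ℝ) R, ⋂ t ∈ Set.Icc (-R : ℝ) R,
        {f | ‖f t - f s‖ ^ 2 ≤ B R * |t - s|} := by
      ext f
      simp only [P, Set.mem_ofPred_eq, Set.mem_inter_iff, Set.mem_iInter]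
    rw [this]
    refine (isClosed_le (by fun_prop) continuous_const).inter ?_
    refine isClosed_iInter fun R => isClosed_biInter fun s _ => isClosed_biInter fun t _ => ?_
    exact isClosed_le (by fun_prop) continuous_const
  · intro s
    obtain ⟨R, hR⟩ := hmem s
    rw [Metric.equicontinuousAt_iff_right]
    intro ε hε
    filter_upwards [hR, (hlim s R).eventually (gt_mem_nhds hε)] with t ht hlt x
    rw [dist_comm, dist_eq_norm]
    exact (Real.le_sqrt_of_sq_le (x.2.2 R s hR.self_of_nhds t ht)).trans_lt hlt

theorem sq_lintegral_le {α : Type*} [MeasurableSpace α] (μ : Measure α) {f : α → ℝ≥0∞}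
    (hf : AEMeasurable f μ) : (∫⁻ a, f a ∂μ) ^ 2 ≤ μ Set.univ * ∫⁻ a, f a ^ 2 ∂μ := by
  have h := ENNReal.lintegral_mul_le_Lp_mul_Lq μ Real.HolderConjugate.two_two
    (f := fun _ => 1) aemeasurable_const hf
  have hr : ∀ y : ℝ≥0∞, (y ^ (2⁻¹ : ℝ)) ^ 2 = y := fun y => by
    rw [← ENNReal.rpow_natCast, ← ENNReal.rpow_mul]
    norm_num
  have h2 := pow_le_pow_left' h 2
  simpa [mul_pow, hr] using h2

/-- A primitive of a square integrable function is Hölder continuous of exponent `1/2`. -/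
theorem sq_enorm_intervalIntegral_le {v : ℝ → ℂ} (s t : ℝ)
    (hv : AEStronglyMeasurable v (volume.restrict (Set.uIoc s t))) :
    ‖∫ r in s..t, v r‖ₑ ^ 2
      ≤ ENNReal.ofReal |t - s| * ∫⁻ r in Set.uIoc s t, ‖v r‖ₑ ^ 2 := by
  have h1 : ‖∫ r in s..t, v r‖ₑ ≤ ∫⁻ r in Set.uIoc s t, ‖v r‖ₑ := by
    rw [← ofReal_norm, intervalIntegral.norm_intervalIntegral_eq, ofReal_norm]
    exact enorm_integral_le_lintegral_enorm _
  refine (pow_le_pow_left' h1 2).trans ?_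
  refine (sq_lintegral_le _ hv.enorm).trans_eq ?_
  rw [Measure.restrict_apply_univ, Real.volume_uIoc]

/-- The time average of an observable along a stationary process. -/
theorem lintegral_lintegral_at {Γ : Measure (ℕ → ℂ)} {ν : Measure PathSpace} [SFinite ν]
    (hmarg : ∀ t, ν.map (fun x => pathAt x t) = Γ) {h : (ℕ → ℂ) → ℝ≥0∞} (hh : Measurable h)
    (I : Set ℝ) :
    ∫⁻ x, (∫⁻ s in I, h (pathAt x s)) ∂ν = volume I * ∫⁻ c, h c ∂Γ := by
  have hm : Measurable fun q : PathSpace × ℝ => h (pathAt q.1 q.2) :=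
    hh.comp continuous_pathAt_uncurry.measurable
  rw [lintegral_lintegral_swap hm.aemeasurable]
  have : ∀ s, ∫⁻ x : PathSpace, h (pathAt x s) ∂ν = ∫⁻ c, h c ∂Γ := fun s => by
    rw [← hmarg s, lintegral_map hh (continuous_pathAt s).measurable]
  simp [this, mul_comm]

end PathSpace

/-! ### Limits of stationary processes -/

section StationaryLimit

open scoped NNReal

variable {Γ : Measure (ℕ → ℂ)}

theorem exists_measure_norm_gt_le [IsProbabilityMeasure Γ] (n : ℕ) {δ : ℝ≥0∞} (hδ : 0 < δ) :
    ∃ A : ℝ, Γ {c | A < ‖c n‖} ≤ δ := by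
  have hanti : Antitone fun k : ℕ => {c : ℕ → ℂ | (k : ℝ) < ‖c n‖} := fun k l hkl c hc =>
    lt_of_le_of_lt (by exact_mod_cast hkl) (show (l : ℝ) < ‖c n‖ from hc)
  have hempty : ⋂ k : ℕ, {c : ℕ → ℂ | (k : ℝ) < ‖c n‖} = ∅ := by
    ext c
    simp only [Set.mem_iInter, Set.mem_ofPred_eq, Set.mem_empty_iff_false, iff_false, not_forall,
      not_lt]
    exact exists_nat_ge _
  have ht := tendsto_measure_iInter_atTop (μ := Γ) (s := fun k : ℕ => {c : ℕ → ℂ | (k : ℝ) < ‖c n‖})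
    (fun k => (measurableSet_lt measurable_const (by fun_prop)).nullMeasurableSet) hanti
    ⟨0, measure_ne_top _ _⟩
  rw [hempty, measure_empty] at ht
  obtain ⟨k, hk⟩ := (ht.eventually (ge_mem_nhds hδ)).exists
  exact ⟨k, hk⟩

/-- Uniform bounds in mean square on the velocities make the laws of stationary processes tight. -/
theorem isTightMeasureSet_of_stationary [IsProbabilityMeasure Γ] {ι : Type*}
    (V : ι → ℕ → (ℕ → ℂ) → ℂ)
    (hVc : ∀ N n, Continuous (V N n))
    (hVb : ∀ n, ∃ C : ℝ≥0, ∀ N, ∫⁻ c, ‖V N n c‖ₑ ^ 2 ∂Γ ≤ C)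
    (ν : ι → Measure PathSpace) [∀ N, IsProbabilityMeasure (ν N)]
    (hmarg : ∀ N t, (ν N).map (fun x => pathAt x t) = Γ)
    (heq : ∀ N, ∀ᵐ x ∂ν N, ∀ n s t, x n t - x n s = -Complex.I * ∫ r in s..t, V N n (pathAt x r)) :
    IsTightMeasureSet (Set.range ν) := by
  rw [isTightMeasureSet_iff_exists_isCompact_measure_compl_le]
  intro ε hε
  obtain ⟨δ, hδ, hδε⟩ := ENNReal.exists_pos_sum_of_countable (ENNReal.half_pos hε.ne').ne' ℕ
  obtain ⟨η, hη, hηε⟩ := ENNReal.exists_pos_sum_of_countable (ENNReal.half_pos hε.ne').ne' (ℕ × ℕ)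
  choose A hA using fun n => exists_measure_norm_gt_le (Γ := Γ) n
    (δ := δ n) (by exact_mod_cast hδ n)
  choose C hC using hVb
  let B : ℕ → ℕ → ℝ≥0 := fun n R => (2 * R * C n + 1) / η (n, R)
  refine ⟨Set.pi Set.univ fun n => holderSet (A n) fun R => B n R,
    isCompact_univ_pi fun n => isCompact_holderSet _ _, ?_⟩
  rintro _ ⟨N, rfl⟩
  -- the exceptional sets: large initial value, large velocity in mean square
  let S₁ : ℕ → Set PathSpace := fun n => {x | A n < ‖x n 0‖}
  let S₂ : ℕ × ℕ → Set PathSpace := fun q =>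
    {x | (B q.1 q.2 : ℝ≥0∞) < ∫⁻ r in Set.Icc (-q.2 : ℝ) q.2, ‖V N q.1 (pathAt x r)‖ₑ ^ 2}
  have hcover : ∀ᵐ x ∂ν N, x ∈ (Set.pi Set.univ fun n => holderSet (A n) fun R => (B n R : ℝ))ᶜ →
      x ∈ (⋃ n, S₁ n) ∪ ⋃ q, S₂ q := by
    filter_upwards [heq N] with x hx hxK
    by_contra hcon
    refine hxK fun n _ => ?_
    simp only [Set.mem_union, Set.mem_iUnion, not_or, not_exists, S₁, S₂, Set.mem_ofPred_eq,
      not_lt] at hcon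
    refine ⟨hcon.1 n, fun R s hs t ht => ?_⟩
    have hcont : Continuous fun r => V N n (pathAt x r) := (hVc N n).comp (continuous_pathAt_right x)
    have h1 := sq_enorm_intervalIntegral_le s t (hcont.aestronglyMeasurable)
    have hsub : Set.uIoc s t ⊆ Set.Icc (-R : ℝ) R :=
      Set.uIoc_subset_uIcc.trans (Set.uIcc_subset_Icc hs ht)
    have h2 : ‖∫ r in s..t, V N n (pathAt x r)‖ₑ ^ 2 ≤ ENNReal.ofReal |t - s| * B n R :=
      h1.trans (mul_le_mul_right ((lintegral_mono_set hsub).trans (hcon.2 (n, R))) _)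
    have h3 : ‖x n t - x n s‖ₑ ^ 2 ≤ ENNReal.ofReal (B n R * |t - s|) := by
      rw [hx n s t, enorm_mul, enorm_neg]
      have hI : ‖Complex.I‖ₑ = 1 := by rw [← ofReal_norm]; simp
      rw [hI, one_mul, mul_comm, ENNReal.ofReal_mul (abs_nonneg _), ENNReal.ofReal_coe_nnreal]
      exact h2
    rw [← ofReal_norm, ← ENNReal.ofReal_pow (norm_nonneg _)] at h3
    exact (ENNReal.ofReal_le_ofReal_iff (by positivity)).1 h3
  have h1 : ∀ n, ν N (S₁ n) ≤ δ n := fun n => by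
    have : ν N (S₁ n) = Γ {c | A n < ‖c n‖} := by
      rw [← hmarg N 0, Measure.map_apply (continuous_pathAt 0).measurable
        (measurableSet_lt measurable_const (by fun_prop))]
      rfl
    rw [this]
    exact hA n
  have h2 : ∀ q, ν N (S₂ q) ≤ η q := fun q => by
    obtain ⟨n, R⟩ := q
    have hmean : ∫⁻ x : PathSpace, (∫⁻ r in Set.Icc (-R : ℝ) R, ‖V N n (pathAt x r)‖ₑ ^ 2) ∂ν N
        ≤ (2 * R * C n : ℝ≥0) := by
      rw [lintegral_lintegral_at (hmarg N) ((hVc N n).measurable.enorm.pow_const 2),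
        Real.volume_Icc]
      have e : ENNReal.ofReal ((R : ℝ) - -R) = ((2 * R : ℝ≥0) : ℝ≥0∞) := by
        rw [show ((R : ℝ) - -R) = ((2 * R : ℝ≥0) : ℝ) by push_cast; ring,
          ENNReal.ofReal_coe_nnreal]
      rw [e, ENNReal.coe_mul]
      exact mul_le_mul_right (hC n N) _
    have hB0 : (B n R : ℝ≥0∞) ≠ 0 := by
      have : 0 < B n R := div_pos (by positivity) (hη _)
      exact_mod_cast this.ne'
    calc ν N (S₂ (n, R)) ≤ ν N {x | (B n R : ℝ≥0∞)
          ≤ ∫⁻ r in Set.Icc (-R : ℝ) R, ‖V N n (pathAt x r)‖ₑ ^ 2} :=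
          measure_mono fun x hx => by
            simp only [S₂, Set.mem_ofPred_eq] at hx ⊢
            exact hx.le
      _ ≤ (∫⁻ x : PathSpace, (∫⁻ r in Set.Icc (-R : ℝ) R, ‖V N n (pathAt x r)‖ₑ ^ 2) ∂ν N) / B n R :=
          meas_ge_le_lintegral_div
            (Measurable.lintegral_prod_right' (f := fun q : PathSpace × ℝ =>
              ‖V N n (pathAt q.1 q.2)‖ₑ ^ 2) (((hVc N n).measurable.enorm.pow_const 2).comp
                continuous_pathAt_uncurry.measurable)).aemeasurable hB0 ENNReal.coe_ne_top
      _ ≤ (2 * R * C n : ℝ≥0) / B n R := by gcongr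
      _ ≤ η (n, R) := by
          rw [← ENNReal.coe_div (by exact_mod_cast hB0), ENNReal.coe_le_coe]
          have hη' := hη (n, R)
          simp only [B]
          rw [div_div_eq_mul_div, div_le_iff₀ (by positivity), mul_comm]
          gcongr
          simp
  calc ν N _ ≤ ν N ((⋃ n, S₁ n) ∪ ⋃ q, S₂ q) := measure_mono_ae hcover
    _ ≤ (∑' n, ν N (S₁ n)) + ∑' q, ν N (S₂ q) :=
        (measure_union_le _ _).trans (add_le_add (measure_iUnion_le _) (measure_iUnion_le _))
    _ ≤ (∑' n, (δ n : ℝ≥0∞)) + ∑' q, (η q : ℝ≥0∞) :=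
        add_le_add (ENNReal.tsum_le_tsum h1) (ENNReal.tsum_le_tsum h2)
    _ ≤ ε / 2 + ε / 2 := add_le_add hδε.le hηε.le
    _ = ε := ENNReal.add_halves ε

/-- The equation satisfied by the component `n` of a path up to time `t`, for a velocity field
`v`, measured by a quantity which vanishes iff the equation holds. -/
def defect (v : (ℕ → ℂ) → ℂ) (n : ℕ) (t : ℝ) (x : PathSpace) : ℂ :=
  x n t - x n 0 + Complex.I * ∫ s in (0 : ℝ)..t, v (pathAt x s)

theorem continuous_defect {v : (ℕ → ℂ) → ℂ} (hv : Continuous v) (n : ℕ) (t : ℝ) :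
    Continuous (defect v n t) := by
  have h1 : ∀ s : ℝ, Continuous fun x : PathSpace => x n s := fun s =>
    (continuous_apply n).comp (continuous_pathAt s)
  have h2 : Continuous fun x : PathSpace => ∫ s in (0 : ℝ)..t, v (pathAt x s) :=
    intervalIntegral.continuous_parametric_intervalIntegral_of_continuous'
      (f := fun (x : PathSpace) s => v (pathAt x s)) (hv.comp continuous_pathAt_uncurry) 0 t
  exact ((h1 t).sub (h1 0)).add (continuous_const.mul h2)

theorem ae_intervalIntegrable_at {ν : Measure PathSpace} [SFinite ν]
    (hmarg : ∀ t, ν.map (fun x => pathAt x t) = Γ) {v : (ℕ → ℂ) → ℂ} (hv : Measurable v)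
    (hi : ∫⁻ c, ‖v c‖ₑ ∂Γ ≠ ∞) (a b : ℝ) :
    ∀ᵐ x : PathSpace ∂ν, IntervalIntegrable (fun s => v (pathAt x s)) volume a b := by
  have h := lintegral_lintegral_at hmarg hv.enorm (Set.uIoc a b)
  have hfin : ∫⁻ x : PathSpace, (∫⁻ s in Set.uIoc a b, ‖v (pathAt x s)‖ₑ) ∂ν ≠ ∞ := by
    rw [h, Real.volume_uIoc]
    exact ENNReal.mul_ne_top ENNReal.ofReal_ne_top hi
  have hm : Measurable fun x : PathSpace => ∫⁻ s in Set.uIoc a b, ‖v (pathAt x s)‖ₑ :=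
    Measurable.lintegral_prod_right' (f := fun q : PathSpace × ℝ => ‖v (pathAt q.1 q.2)‖ₑ)
      (hv.enorm.comp continuous_pathAt_uncurry.measurable)
  filter_upwards [ae_lt_top hm hfin] with x hx
  rw [intervalIntegrable_iff]
  exact ⟨(hv.comp (continuous_pathAt_right x).measurable).aestronglyMeasurable, hx⟩

/-- Two velocity fields which are close in mean have close defects along a stationary process. -/
theorem lintegral_defect_le {ν : Measure PathSpace} [SFinite ν]
    (hmarg : ∀ t, ν.map (fun x => pathAt x t) = Γ) {v w : (ℕ → ℂ) → ℂ} (hv : Measurable v)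
    (hw : Measurable w) (hvi : ∫⁻ c, ‖v c‖ₑ ∂Γ ≠ ∞) (hwi : ∫⁻ c, ‖w c‖ₑ ∂Γ ≠ ∞) (n : ℕ) (t : ℝ) :
    ∫⁻ x, ‖defect v n t x - defect w n t x‖ₑ ∂ν
      ≤ ENNReal.ofReal |t| * ∫⁻ c, ‖v c - w c‖ₑ ∂Γ := by
  have h := lintegral_lintegral_at hmarg (h := fun c => ‖v c - w c‖ₑ) (hv.sub hw).enorm
    (Set.uIoc 0 t)
  rw [Real.volume_uIoc, sub_zero] at h
  rw [← h]
  refine lintegral_mono_ae ?_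
  filter_upwards [ae_intervalIntegrable_at hmarg hv hvi 0 t,
    ae_intervalIntegrable_at hmarg hw hwi 0 t] with x h1 h2
  have e : defect v n t x - defect w n t x
      = Complex.I * ∫ s in (0 : ℝ)..t, (v (pathAt x s) - w (pathAt x s)) := by
    rw [intervalIntegral.integral_sub h1 h2, defect, defect]
    ring
  have hI : ‖Complex.I‖ₑ = 1 := by rw [← ofReal_norm]; simp
  rw [e, enorm_mul, hI, one_mul, ← ofReal_norm,
    intervalIntegral.norm_intervalIntegral_eq, ofReal_norm]
  exact enorm_integral_le_lintegral_enorm _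

/-- Stationary processes with a common marginal law `Γ`, driven by continuous velocity fields `V N`
converging in mean to `τ`, have a limit in law which is stationary and driven by `τ`. -/
theorem exists_stationary_limit [IsProbabilityMeasure Γ] (V : ℕ → ℕ → (ℕ → ℂ) → ℂ)
    (hVc : ∀ N n, Continuous (V N n))
    (hVb : ∀ n, ∃ C : ℝ≥0, ∀ N, ∫⁻ c, ‖V N n c‖ₑ ^ 2 ∂Γ ≤ C)
    (τ : ℕ → (ℕ → ℂ) → ℂ) (hτ : ∀ n, Measurable (τ n)) (hτi : ∀ n, ∫⁻ c, ‖τ n c‖ₑ ∂Γ ≠ ∞)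
    (hlim : ∀ n, Tendsto (fun N => ∫⁻ c, ‖V N n c - τ n c‖ₑ ∂Γ) atTop (𝓝 0))
    (ν : ℕ → Measure PathSpace) [∀ N, IsProbabilityMeasure (ν N)]
    (hmarg : ∀ N t, (ν N).map (fun x => pathAt x t) = Γ)
    (heq : ∀ N, ∀ᵐ x ∂ν N, ∀ n s t, x n t - x n s = -Complex.I * ∫ r in s..t, V N n (pathAt x r)) :
    ∃ ν' : Measure PathSpace, IsProbabilityMeasure ν' ∧ (∀ t, ν'.map (fun x => pathAt x t) = Γ) ∧
      ∀ n t, ∀ᵐ x ∂ν', defect (τ n) n t x = 0 := by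
  let P : ℕ → ProbabilityMeasure PathSpace := fun N => ⟨ν N, inferInstance⟩
  have htight := isTightMeasureSet_of_stationary V hVc hVb ν hmarg heq
  have hcomp : IsCompact (closure (Set.range P)) := by
    refine isCompact_closure_of_isTightMeasureSet ?_
    convert htight using 1
    ext μ
    simp only [Set.mem_ofPred_eq, Set.mem_range, P]
    constructor
    · rintro ⟨_, ⟨N, rfl⟩, rfl⟩
      exact ⟨N, rfl⟩
    · rintro ⟨N, rfl⟩
      exact ⟨_, ⟨N, rfl⟩, rfl⟩
  -- by Prokhorov's theorem the laws have a limit point; a limit along an ultrafilter avoids the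
  -- extraction of a subsequence
  obtain ⟨Q, -, hQ⟩ := hcomp.ultrafilter_le_nhds ((hyperfilter ℕ).map P) (by
    rw [le_principal_iff, Ultrafilter.mem_coe, Ultrafilter.mem_map]
    exact Filter.univ_mem' fun N => subset_closure ⟨N, rfl⟩)
  have hQ' : Tendsto P (hyperfilter ℕ : Filter ℕ) (𝓝 Q) := hQ
  have hle : (hyperfilter ℕ : Filter ℕ) ≤ atTop := by
    rw [← Nat.cofinite_eq_atTop]
    exact hyperfilter_le_cofinite
  have hmargQ : ∀ t, (Q : Measure PathSpace).map (fun x => pathAt x t) = Γ := by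
    intro t
    have h1 := (ProbabilityMeasure.continuous_map (continuous_pathAt t)).tendsto Q |>.comp hQ'
    let G : ProbabilityMeasure (ℕ → ℂ) := ⟨Γ, inferInstance⟩
    have h2 : Tendsto (fun N => (P N).map (continuous_pathAt t).measurable.aemeasurable)
        (hyperfilter ℕ : Filter ℕ) (𝓝 G) := by
      refine tendsto_const_nhds.congr fun N => ?_
      exact Subtype.ext (hmarg N t).symm
    have := tendsto_nhds_unique h1 h2
    exact congrArg (fun μ : ProbabilityMeasure (ℕ → ℂ) => (μ : Measure (ℕ → ℂ))) this
  refine ⟨Q, inferInstance, hmargQ, fun n t => ?_⟩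
  have hVi : ∀ N, ∫⁻ c, ‖V N n c‖ₑ ∂Γ ≠ ∞ := fun N hN => by
    obtain ⟨C, hC⟩ := hVb n
    have h1 := sq_lintegral_le Γ (hVc N n).measurable.enorm.aemeasurable
    rw [measure_univ, one_mul, hN] at h1
    have := h1.trans (hC N)
    simp at this
  set D : ℕ → ℝ≥0∞ := fun N => ∫⁻ c, ‖V N n c - τ n c‖ₑ ∂Γ
  -- the truncated defect is a bounded continuous function on the path space
  have hdef : ∀ M, ∫⁻ x, min ‖defect (V M n) n t x‖ₑ 1 ∂(Q : Measure PathSpace)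
      ≤ ENNReal.ofReal |t| * D M := by
    intro M
    let θ : BoundedContinuousFunction PathSpace ℝ≥0 :=
      BoundedContinuousFunction.mkOfBound
        ⟨fun x => min ‖defect (V M n) n t x‖₊ 1, by
          have := continuous_defect (hVc M n) n t
          fun_prop⟩ 1 fun x y => by
          have h1 : min ‖defect (V M n) n t x‖₊ 1 ≤ 1 := min_le_right _ _
          have h2 : min ‖defect (V M n) n t y‖₊ 1 ≤ 1 := min_le_right _ _
          rw [NNReal.dist_eq]
          refine abs_sub_le_of_nonneg_of_le (NNReal.coe_nonneg _) ?_ (NNReal.coe_nonneg _) ?_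
          · exact_mod_cast h1
          · exact_mod_cast h2
    have hθ : ∀ x, (θ x : ℝ≥0∞) = min ‖defect (V M n) n t x‖ₑ 1 := fun x => by
      change ((min ‖defect (V M n) n t x‖₊ 1 : ℝ≥0) : ℝ≥0∞) = _
      rw [ENNReal.coe_min, ENNReal.coe_one]
      rfl
    have h1 := ProbabilityMeasure.tendsto_iff_forall_lintegral_tendsto.1 hQ' θ
    simp only [hθ] at h1
    have h2 : Tendsto (fun N => ENNReal.ofReal |t| * (D M + D N))
        (hyperfilter ℕ : Filter ℕ) (𝓝 (ENNReal.ofReal |t| * (D M + 0))) :=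
      ENNReal.Tendsto.const_mul (tendsto_const_nhds.add ((hlim n).mono_left hle))
        (Or.inr ENNReal.ofReal_ne_top)
    rw [add_zero] at h2
    refine le_of_tendsto_of_tendsto' h1 h2 fun N => ?_
    have h0 : ∀ᵐ x ∂ν N, defect (V N n) n t x = 0 := by
      filter_upwards [heq N] with x hx
      rw [defect, hx n 0 t]
      ring
    calc ∫⁻ x, min ‖defect (V M n) n t x‖ₑ 1 ∂ν N
        ≤ ∫⁻ x, ‖defect (V M n) n t x - defect (V N n) n t x‖ₑ ∂ν N := by
          refine lintegral_mono_ae ?_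
          filter_upwards [h0] with x hx
          rw [hx, sub_zero]
          exact min_le_left _ _
      _ ≤ ENNReal.ofReal |t| * ∫⁻ c, ‖V M n c - V N n c‖ₑ ∂Γ :=
          lintegral_defect_le (hmarg N) (hVc M n).measurable (hVc N n).measurable (hVi M)
            (hVi N) n t
      _ ≤ _ := by
          gcongr
          have hm : Measurable fun c => ‖V M n c - τ n c‖ₑ :=
            ((hVc M n).measurable.sub (hτ n)).enorm
          change _ ≤ (∫⁻ c, ‖V M n c - τ n c‖ₑ ∂Γ) + ∫⁻ c, ‖V N n c - τ n c‖ₑ ∂Γ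
          rw [← lintegral_add_left hm]
          refine lintegral_mono fun c => ?_
          calc _ = ‖(V M n c - τ n c) - (V N n c - τ n c)‖ₑ := by congr 1; ring
            _ ≤ _ := enorm_sub_le
  -- `V M` is close to `τ` in mean, under the limit law as well
  have hle2 : ∀ M, ∫⁻ x, min ‖defect (τ n) n t x‖ₑ 1 ∂(Q : Measure PathSpace)
      ≤ ENNReal.ofReal |t| * D M + ENNReal.ofReal |t| * D M := by
    intro M
    have h1 := lintegral_defect_le hmargQ (hVc M n).measurable (hτ n) (hVi M) (hτi n) n t
    refine le_trans ?_ (add_le_add (hdef M) h1)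
    have hmeas : Measurable fun x => min ‖defect (V M n) n t x‖ₑ 1 :=
      (continuous_defect (hVc M n) n t).measurable.enorm.min measurable_const
    rw [← lintegral_add_left hmeas]
    refine lintegral_mono fun x => ?_
    have h2 : ‖defect (τ n) n t x‖ₑ
        ≤ ‖defect (V M n) n t x‖ₑ + ‖defect (V M n) n t x - defect (τ n) n t x‖ₑ := by
      calc _ = ‖defect (V M n) n t x - (defect (V M n) n t x - defect (τ n) n t x)‖ₑ := by
            congr 1; ring
        _ ≤ _ := enorm_sub_le
    rcases le_total ‖defect (V M n) n t x‖ₑ 1 with h | h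
    · rw [min_eq_left h]
      exact (min_le_left _ _).trans h2
    · rw [min_eq_right h]
      exact (min_le_right _ _).trans le_self_add
  have hzero : ∫⁻ x, min ‖defect (τ n) n t x‖ₑ 1 ∂(Q : Measure PathSpace) = 0 := by
    have hD : Tendsto (fun M => ENNReal.ofReal |t| * D M) atTop (𝓝 0) := by
      simpa using ENNReal.Tendsto.const_mul (hlim n) (Or.inr (ENNReal.ofReal_ne_top (r := |t|)))
    have := ge_of_tendsto' (hD.add hD) hle2
    simpa using this
  have hmeasτ : Measurable (defect (τ n) n t) := by
    have h1 : Measurable fun x : PathSpace => ∫ s in (0 : ℝ)..t, τ n (pathAt x s) := by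
      have hm : StronglyMeasurable fun q : PathSpace × ℝ => τ n (pathAt q.1 q.2) :=
        ((hτ n).comp continuous_pathAt_uncurry.measurable).stronglyMeasurable
      simp only [intervalIntegral]
      exact (hm.integral_prod_right (ν := volume.restrict (Set.Ioc 0 t))).measurable.sub
        (hm.integral_prod_right (ν := volume.restrict (Set.Ioc t 0))).measurable
    have h2 : ∀ s : ℝ, Measurable fun x : PathSpace => x n s := fun s =>
      ((continuous_apply n).comp (continuous_pathAt s)).measurable
    exact ((h2 t).sub (h2 0)).add (h1.const_mul _)
  rw [lintegral_eq_zero_iff (hmeasτ.enorm.min measurable_const)] at hzero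
  filter_upwards [hzero] with x hx
  have hx' : min ‖defect (τ n) n t x‖ₑ 1 = 0 := hx
  rcases min_choice ‖defect (τ n) n t x‖ₑ 1 with h | h
  · rw [h] at hx'
    exact enorm_eq_zero.1 hx'
  · rw [h] at hx'
    simp at hx'

end StationaryLimit

/-! ### Hamiltonian cubic systems -/

section Hamiltonian

open scoped NNReal ComplexConjugate

variable {ι : Type*} [Fintype ι]

/-- The cubic vector field with the coefficients `β`. -/
def cubicField (β : ι → ι → ι → ι → ℝ) (c : ι → ℂ) (n : ι) : ℂ :=
  ∑ i, ∑ j, ∑ m, (β i j n m : ℂ) * (c i * c j * conj (c m))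

/-- A smooth function of the mass `∑ |cᵢ|²`, equal to `1` if the mass is at most `ε⁻¹` and
vanishing if it is at least `2 ε⁻¹`. -/
def massCutoff (ε : ℝ) (c : ι → ℂ) : ℝ := Real.smoothTransition (2 - ε * ∑ i, ‖c i‖ ^ 2)

/-- The vector field of the equation `i c' = cubicField β c`, cut off at large mass. -/
def cutoffField (β : ι → ι → ι → ι → ℝ) (ε : ℝ) (c : ι → ℂ) (n : ι) : ℂ :=
  -Complex.I * (massCutoff ε c * cubicField β c n)

/-- The cubic field is the gradient of a real quartic energy, invariant under `c ↦ e^{iθ} c`. -/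
theorem sum_im_conj_mul_cubicField {β : ι → ι → ι → ι → ℝ}
    (hswap : ∀ i j n m, β i j n m = β n m i j) (c : ι → ℂ) :
    ∑ n, (conj (c n) * cubicField β c n).im = 0 := by
  have e : ∑ n, conj (c n) * cubicField β c n
      = ∑ n, ∑ i, ∑ j, ∑ m, (β i j n m : ℂ) * (c i * c j * conj (c m) * conj (c n)) := by
    refine Finset.sum_congr rfl fun n _ => ?_
    simp only [cubicField, Finset.mul_sum]
    exact Finset.sum_congr rfl fun i _ => Finset.sum_congr rfl fun j _ =>
      Finset.sum_congr rfl fun m _ => by ring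
  have hconj : conj (∑ n, conj (c n) * cubicField β c n) = ∑ n, conj (c n) * cubicField β c n := by
    rw [e]
    simp only [map_sum, map_mul, Complex.conj_ofReal, Complex.conj_conj]
    rw [Finset.sum_comm]
    refine Finset.sum_congr rfl fun n _ => Finset.sum_congr rfl fun i _ => ?_
    rw [Finset.sum_comm]
    refine Finset.sum_congr rfl fun j _ => Finset.sum_congr rfl fun m _ => ?_
    rw [hswap n m i j]
    ring
  rw [← Complex.im_sum]
  exact Complex.conj_eq_iff_im.1 hconj

/-- The real trace of an endomorphism of `ℂ^ι`, in the basis of the vectors `eₙ`, `i eₙ`. -/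
theorem trace_eq_sum [DecidableEq ι] (L : (ι → ℂ) →ₗ[ℝ] (ι → ℂ)) :
    LinearMap.trace ℝ (ι → ℂ) L
      = ∑ n, ((L (Pi.single n 1) n).re + (L (Pi.single n Complex.I) n).im) := by
  rw [LinearMap.trace_eq_matrix_trace ℝ (Pi.basis fun _ : ι => Complex.basisOneI), Matrix.trace,
    Fintype.sum_sigma]
  refine Finset.sum_congr rfl fun n _ => ?_
  simp [Fin.sum_univ_two, LinearMap.toMatrix_apply, Pi.basis_apply, Pi.basis_repr]

theorem contDiff_massCutoff (ε : ℝ) : ContDiff ℝ 1 (massCutoff (ι := ι) ε) := by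
  have h : ContDiff ℝ 1 fun c : ι → ℂ => 2 - ε * ∑ i, ‖c i‖ ^ 2 :=
    contDiff_const.sub (contDiff_const.mul (ContDiff.sum fun i _ =>
      (contDiff_apply ℝ ℂ i).norm_sq ℝ))
  exact Real.smoothTransition.contDiff.comp h

theorem contDiff_cutoffField (β : ι → ι → ι → ι → ℝ) (ε : ℝ) :
    ContDiff ℝ 1 (cutoffField β ε) := by
  refine contDiff_pi.2 fun n => contDiff_const.mul ?_
  refine (Complex.ofRealCLM.contDiff.comp (contDiff_massCutoff ε)).mul ?_
  refine ContDiff.sum fun i _ => ContDiff.sum fun j _ => ContDiff.sum fun m _ =>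
    contDiff_const.mul ?_
  exact ((contDiff_apply ℝ ℂ i).mul (contDiff_apply ℝ ℂ j)).mul
    (Complex.conjCLE.contDiff.comp (contDiff_apply ℝ ℂ m))

theorem hasCompactSupport_cutoffField (β : ι → ι → ι → ι → ℝ) {ε : ℝ} (hε : 0 < ε) :
    HasCompactSupport (cutoffField β ε) := by
  refine HasCompactSupport.intro (isCompact_closedBall (0 : ι → ℂ) (Real.sqrt (2 / ε)))
    fun c hc => ?_
  have hlt : Real.sqrt (2 / ε) < ‖c‖ := by simpa using hc
  have hex : ∃ i, Real.sqrt (2 / ε) < ‖c i‖ := by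
    by_contra! hcon
    exact absurd ((pi_norm_le_iff_of_nonneg (Real.sqrt_nonneg _)).2 hcon) (not_le.2 hlt)
  obtain ⟨i, hi⟩ := hex
  have h1 : 2 / ε < ‖c i‖ ^ 2 := (Real.sqrt_lt' (by
    exact lt_of_le_of_lt (Real.sqrt_nonneg _) hi)).1 hi
  have h2 : ‖c i‖ ^ 2 ≤ ∑ i, ‖c i‖ ^ 2 :=
    Finset.single_le_sum (f := fun i => ‖c i‖ ^ 2) (fun _ _ => sq_nonneg _) (Finset.mem_univ i)
  have h3 : 2 ≤ ε * ∑ i, ‖c i‖ ^ 2 := by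
    rw [div_lt_iff₀ hε] at h1
    nlinarith
  have h4 : massCutoff ε c = 0 := Real.smoothTransition.zero_of_nonpos (by linarith)
  funext n
  simp [cutoffField, h4]

theorem hasDerivAt_cubicField_line (β : ι → ι → ι → ι → ℝ) (c v : ι → ℂ) (n : ι) :
    HasDerivAt (fun s : ℝ => cubicField β (c + s • v) n)
      (∑ i, ∑ j, ∑ m, (β i j n m : ℂ) * (v i * c j * conj (c m) + c i * v j * conj (c m)
        + c i * c j * conj (v m))) 0 := by
  have hc : ∀ i, HasDerivAt (fun s : ℝ => (c + s • v) i) (v i) 0 := fun i => by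
    have h := ((hasDerivAt_id' (0 : ℝ)).smul_const (v i)).const_add (c i)
    rw [one_smul] at h
    exact h
  unfold cubicField
  refine HasDerivAt.fun_sum fun i _ => HasDerivAt.fun_sum fun j _ => HasDerivAt.fun_sum fun m _ => ?_
  have hm : HasDerivAt (fun s : ℝ => conj ((c + s • v) m)) (conj (v m)) 0 :=
    (hc m).star
  have h := ((((hc i).mul (hc j)).mul hm).const_mul (β i j n m : ℂ))
  simp only [Pi.mul_apply, zero_smul, add_zero] at h
  refine h.congr_deriv ?_
  ring

/-- The gradient of the cutoff is proportional to the position. -/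
theorem hasDerivAt_massCutoff_line (ε : ℝ) (c : ι → ℂ) :
    ∃ κ : ℝ, ∀ v : ι → ℂ, HasDerivAt (fun s : ℝ => massCutoff ε (c + s • v))
      (κ * ∑ i, (conj (c i) * v i).re) 0 := by
  obtain ⟨κ₀, hκ₀⟩ : ∃ κ₀, HasDerivAt Real.smoothTransition κ₀ (2 - ε * ∑ i, ‖c i‖ ^ 2) :=
    ⟨_, ((Real.smoothTransition.contDiff (n := 1)).differentiable (by simp) _).hasDerivAt⟩
  refine ⟨κ₀ * (-(ε * 2)), fun v => ?_⟩
  have hc : ∀ i, HasDerivAt (fun s : ℝ => (c + s • v) i) (v i) 0 := fun i => by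
    have h := ((hasDerivAt_id' (0 : ℝ)).smul_const (v i)).const_add (c i)
    rw [one_smul] at h
    exact h
  have hsum : HasDerivAt (fun s : ℝ => 2 - ε * ∑ i, ‖(c + s • v) i‖ ^ 2)
      (-(ε * ∑ i, 2 * inner ℝ ((c + (0 : ℝ) • v) i) (v i))) 0 :=
    ((HasDerivAt.fun_sum fun i _ => (hc i).norm_sq).const_mul ε).const_sub 2
  have hκ₁ : HasDerivAt Real.smoothTransition κ₀
      ((fun s : ℝ => 2 - ε * ∑ i, ‖(c + s • v) i‖ ^ 2) 0) := by
    simpa using hκ₀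
  have h := hκ₁.comp (0 : ℝ) hsum
  refine h.congr_deriv ?_
  simp only [zero_smul, add_zero, Complex.inner, Finset.mul_sum]
  rw [← Finset.sum_neg_distrib, Finset.mul_sum]
  refine Finset.sum_congr rfl fun i _ => ?_
  rw [mul_comm (v i)]
  ring

/-- The truncated equation is Hamiltonian: its vector field is divergence-free. -/
theorem trace_fderiv_cutoffField {β : ι → ι → ι → ι → ℝ}
    (hswap : ∀ i j n m, β i j n m = β n m i j) (hsymm : ∀ i j n m, β i j n m = β j i n m)
    (hres : ∀ n j m, j ≠ m → β n j n m = 0) (ε : ℝ) (c : ι → ℂ) :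
    LinearMap.trace ℝ (ι → ℂ) (fderiv ℝ (cutoffField β ε) c : (ι → ℂ) →ₗ[ℝ] (ι → ℂ)) = 0 := by
  classical
  obtain ⟨κ, hκ⟩ := hasDerivAt_massCutoff_line ε c
  have hderiv : ∀ v n, fderiv ℝ (cutoffField β ε) c v n = -Complex.I *
      (((κ * ∑ i, (conj (c i) * v i).re : ℝ) : ℂ) * cubicField β c n + massCutoff ε c *
        ∑ i, ∑ j, ∑ m, (β i j n m : ℂ) * (v i * c j * conj (c m) + c i * v j * conj (c m)
        + c i * c j * conj (v m))) := by
    intro v n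
    have hline : HasDerivAt (fun s : ℝ => c + s • v) v 0 := by
      have h := ((hasDerivAt_id' (0 : ℝ)).smul_const v).const_add c
      rwa [one_smul] at h
    have hF : HasFDerivAt (cutoffField β ε) (fderiv ℝ (cutoffField β ε) c) (c + (0 : ℝ) • v) := by
      rw [zero_smul, add_zero]
      exact ((contDiff_cutoffField β ε).differentiable (by simp) c).hasFDerivAt
    have h1 := hasDerivAt_pi.1 (hF.comp_hasDerivAt (0 : ℝ) hline) n
    have h2 : HasDerivAt (fun s : ℝ => cutoffField β ε (c + s • v) n) _ 0 :=
      (((hκ v).ofReal_comp).mul (hasDerivAt_cubicField_line β c v n)).const_mul (-Complex.I)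
    have h3 := h1.unique h2
    rw [h3]
    simp
  have hterm : ∀ n h, fderiv ℝ (cutoffField β ε) c (Pi.single n h) n = -Complex.I *
      (((κ * (conj (c n) * h).re : ℝ) : ℂ) * cubicField β c n + massCutoff ε c *
        (h * ((2 * ∑ j, β n j n j * ‖c j‖ ^ 2 : ℝ) : ℂ)
          + conj h * ∑ i, ∑ j, (β i j n n : ℂ) * (c i * c j))) := by
    intro n h
    rw [hderiv]
    have e1 : ∑ i, (conj (c i) * (Pi.single n h : ι → ℂ) i).re = (conj (c n) * h).re := by
      rw [Finset.sum_eq_single n]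
      · simp
      · intro b _ hb
        simp [hb]
      · simp
    -- by `hres`, only the terms with `j = m` remain, and these are real multiples of `h`
    have hB : ∑ j, ∑ m, (β n j n m : ℂ) * (h * c j * conj (c m))
        = h * ((∑ j, β n j n j * ‖c j‖ ^ 2 : ℝ) : ℂ) := by
      push_cast
      rw [Finset.mul_sum]
      refine Finset.sum_congr rfl fun j _ => ?_
      rw [Finset.sum_eq_single j]
      · rw [← Complex.mul_conj']
        ring
      · intro m _ hm
        rw [hres n j m (Ne.symm hm)]
        simp
      · simp
    have e2 : ∑ i, ∑ j, ∑ m, (β i j n m : ℂ) * ((Pi.single n h : ι → ℂ) i * c j * conj (c m)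
        + c i * (Pi.single n h : ι → ℂ) j * conj (c m)
        + c i * c j * conj ((Pi.single n h : ι → ℂ) m))
        = h * ((2 * ∑ j, β n j n j * ‖c j‖ ^ 2 : ℝ) : ℂ)
          + conj h * ∑ i, ∑ j, (β i j n n : ℂ) * (c i * c j) := by
      simp only [mul_add, Finset.sum_add_distrib]
      have p1 : ∑ i, ∑ j, ∑ m, (β i j n m : ℂ) * ((Pi.single n h : ι → ℂ) i * c j * conj (c m))
          = h * ((∑ j, β n j n j * ‖c j‖ ^ 2 : ℝ) : ℂ) := by
        rw [Finset.sum_eq_single n, ← hB]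
        · simp
        · intro b _ hb
          simp [hb]
        · simp
      have p2 : ∑ i, ∑ j, ∑ m, (β i j n m : ℂ) * (c i * (Pi.single n h : ι → ℂ) j * conj (c m))
          = h * ((∑ j, β n j n j * ‖c j‖ ^ 2 : ℝ) : ℂ) := by
        rw [Finset.sum_comm, Finset.sum_eq_single n, ← hB]
        · refine Finset.sum_congr rfl fun i _ => Finset.sum_congr rfl fun m _ => ?_
          rw [hsymm i n n m, Pi.single_eq_same]
          ring
        · intro b _ hb
          simp [hb]
        · simp
      have p3 : ∑ i, ∑ j, ∑ m, (β i j n m : ℂ) * (c i * c j * conj ((Pi.single n h : ι → ℂ) m))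
          = conj h * ∑ i, ∑ j, (β i j n n : ℂ) * (c i * c j) := by
        simp only [Finset.mul_sum]
        refine Finset.sum_congr rfl fun i _ => Finset.sum_congr rfl fun j _ => ?_
        rw [Finset.sum_eq_single n]
        · rw [Pi.single_eq_same]
          ring
        · intro b _ hb
          simp [hb]
        · simp
      rw [p1, p2, p3]
      push_cast
      ring
    rw [e1, e2]
  rw [trace_eq_sum]
  -- multiplication by an imaginary number and antilinear maps have zero real trace; only the
  -- derivative of the cutoff remains, and its contributions sum to zero by conservation of mass
  have hfinal : ∀ n, (fderiv ℝ (cutoffField β ε) c (Pi.single n 1) n).re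
      + (fderiv ℝ (cutoffField β ε) c (Pi.single n Complex.I) n).im
      = κ * (conj (c n) * cubicField β c n).im := by
    intro n
    rw [hterm, hterm]
    set G := cubicField β c n
    set Aₙ := ∑ i, ∑ j, (β i j n n : ℂ) * (c i * c j)
    simp only [map_one, Complex.conj_I, Complex.mul_re, Complex.mul_im, Complex.add_re,
      Complex.add_im, Complex.neg_re, Complex.neg_im, Complex.I_re, Complex.I_im,
      Complex.ofReal_re, Complex.ofReal_im, Complex.conj_re, Complex.conj_im, Complex.one_re,
      Complex.one_im]
    ring
  simp only [ContinuousLinearMap.coe_coe, hfinal]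
  rw [← Finset.mul_sum, sum_im_conj_mul_cubicField hswap, mul_zero]

/-- Conservation of mass. -/
theorem IsFlow.sum_norm_sq_eq {β : ι → ι → ι → ι → ℝ}
    (hswap : ∀ i j n m, β i j n m = β n m i j)
    {ε : ℝ} {Φ : ℝ → (ι → ℂ) → ι → ℂ} (h : IsFlow (cutoffField β ε) Φ) (t : ℝ) (c : ι → ℂ) :
    ∑ i, ‖Φ t c i‖ ^ 2 = ∑ i, ‖c i‖ ^ 2 := by
  have hd : ∀ t, HasDerivAt (fun t => ∑ i, ‖Φ t c i‖ ^ 2) 0 t := by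
    intro t
    have h1 := HasDerivAt.fun_sum (u := Finset.univ) fun i _ =>
      (hasDerivAt_pi.1 (h.hasDerivAt c t) i).norm_sq
    refine h1.congr_deriv ?_
    have h2 : ∀ i, 2 * inner ℝ (Φ t c i) (cutoffField β ε (Φ t c) i)
        = 2 * massCutoff ε (Φ t c) * (conj (Φ t c i) * cubicField β (Φ t c) i).im := by
      intro i
      rw [Complex.inner, cutoffField]
      simp only [Complex.mul_re, Complex.mul_im, Complex.neg_re, Complex.neg_im, Complex.I_re,
        Complex.I_im, Complex.ofReal_re, Complex.ofReal_im, Complex.conj_re, Complex.conj_im]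
      ring
    rw [Finset.sum_congr rfl fun i _ => h2 i, ← Finset.mul_sum,
      sum_im_conj_mul_cubicField hswap, mul_zero]
  have h3 := is_const_of_deriv_eq_zero (fun t => (hd t).differentiableAt) (fun t => (hd t).deriv)
    t 0
  simpa [h.zero] using h3

/-- The density of the Gaussian measure is a function of the mass. -/
theorem pi_stdComplexGaussian :
    Measure.pi (fun _ : ι => stdComplexGaussian) = (volume : Measure (ι → ℂ)).withDensity
      fun c => ENNReal.ofReal (Real.pi⁻¹ ^ Fintype.card ι * Real.exp (-∑ i, ‖c i‖ ^ 2)) := by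
  refine Measure.pi_eq (μ := fun _ : ι => stdComplexGaussian) fun s hs => ?_
  have hd : ∀ c : ι → ℂ, Real.pi⁻¹ ^ Fintype.card ι * Real.exp (-∑ i, ‖c i‖ ^ 2)
      = ∏ i, (Real.pi⁻¹ * Real.exp (-‖c i‖ ^ 2)) := fun c => by
    rw [Finset.prod_mul_distrib, Finset.prod_const, ← Real.exp_sum, Finset.sum_neg_distrib]
    rfl
  have hone : ∀ i, stdComplexGaussian (s i)
      = ENNReal.ofReal (∫ z : ℂ, (s i).indicator (fun z => Real.pi⁻¹ * Real.exp (-‖z‖ ^ 2)) z) := by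
    intro i
    have hint : Integrable fun z : ℂ => Real.pi⁻¹ * Real.exp (-‖z‖ ^ 2) := by
      refine ⟨by fun_prop, ?_⟩
      rw [hasFiniteIntegral_iff_ofReal (Eventually.of_forall fun z => by positivity),
        lintegral_exp_neg_norm_sq]
      exact ENNReal.one_lt_top
    rw [integral_indicator (hs i), ofReal_integral_eq_lintegral_ofReal hint.integrableOn
      (Eventually.of_forall fun z => by positivity), stdComplexGaussian, withDensity_apply _ (hs i)]
  simp only [hone]
  rw [← ENNReal.ofReal_prod_of_nonneg fun i _ => integral_nonneg fun z =>
      Set.indicator_nonneg (fun z _ => by positivity) z, ← integral_fintype_prod_volume_eq_prod,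
    withDensity_apply _ (MeasurableSet.univ_pi hs), ← lintegral_indicator (MeasurableSet.univ_pi hs)]
  have hprod : ∀ c : ι → ℂ, ∏ i, (s i).indicator (fun z => Real.pi⁻¹ * Real.exp (-‖z‖ ^ 2)) (c i)
      = (Set.univ.pi s).indicator (fun c => ∏ i, (Real.pi⁻¹ * Real.exp (-‖c i‖ ^ 2))) c := by
    intro c
    by_cases hc : c ∈ Set.univ.pi s
    · rw [Set.indicator_of_mem hc]
      exact Finset.prod_congr rfl fun i _ => Set.indicator_of_mem (hc i trivial) _
    · rw [Set.indicator_of_notMem hc]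
      have : ∃ i, c i ∉ s i := by
        by_contra! hcon
        exact hc fun i _ => hcon i
      obtain ⟨i, hi⟩ := this
      exact Finset.prod_eq_zero (Finset.mem_univ i) (Set.indicator_of_notMem hi _)
  simp only [hprod]
  have hint : Integrable fun c : ι → ℂ => ∏ i, (Real.pi⁻¹ * Real.exp (-‖c i‖ ^ 2)) := by
    refine Integrable.fintype_prod (f := fun _ : ι => fun z : ℂ => Real.pi⁻¹ * Real.exp (-‖z‖ ^ 2))
      fun i => ⟨by fun_prop, ?_⟩
    rw [hasFiniteIntegral_iff_ofReal (Eventually.of_forall fun z => by positivity),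
      lintegral_exp_neg_norm_sq]
    exact ENNReal.one_lt_top
  rw [ofReal_integral_eq_lintegral_ofReal (hint.indicator (MeasurableSet.univ_pi hs))
    (Eventually.of_forall fun c => Set.indicator_nonneg
      (fun c _ => Finset.prod_nonneg fun i _ => by positivity) c)]
  refine lintegral_congr fun c => ?_
  by_cases hc : c ∈ Set.univ.pi s
  · rw [Set.indicator_of_mem hc, Set.indicator_of_mem hc, hd]
  · rw [Set.indicator_of_notMem hc, Set.indicator_of_notMem hc, ENNReal.ofReal_zero]

/-- The flow of the truncated equation preserves the Gaussian measure, because it preserves both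
the volume and the mass. -/
theorem exists_isFlow_measurePreserving {β : ι → ι → ι → ι → ℝ}
    (hswap : ∀ i j n m, β i j n m = β n m i j) (hsymm : ∀ i j n m, β i j n m = β j i n m)
    (hres : ∀ n j m, j ≠ m → β n j n m = 0) {ε : ℝ} (hε : 0 < ε) :
    ∃ Φ, IsFlow (cutoffField β ε) Φ ∧ (Continuous fun q : ℝ × (ι → ℂ) => Φ q.1 q.2) ∧
      ∀ t, MeasurePreserving (Φ t) (Measure.pi fun _ : ι => stdComplexGaussian)
        (Measure.pi fun _ : ι => stdComplexGaussian) := by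
  have hsupp := hasCompactSupport_cutoffField β hε
  have hcd := contDiff_cutoffField β ε
  obtain ⟨K, hK⟩ := ContDiff.lipschitzWith_of_hasCompactSupport hsupp hcd one_ne_zero
  obtain ⟨C, hC⟩ := hsupp.exists_bound_of_continuous hcd.continuous
  have hC' : ∀ x, ‖cutoffField β ε x‖ ≤ C.toNNReal := fun x => (hC x).trans (Real.le_coe_toNNReal C)
  obtain ⟨Φ, hΦ⟩ := exists_isFlow hK hC'
  refine ⟨Φ, hΦ, hΦ.continuous_uncurry hK hC', fun t => ?_⟩
  have hvol := hΦ.measurePreserving volume hK hC' (hcd.differentiable one_ne_zero)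
    (trace_fderiv_cutoffField hswap hsymm hres ε) t
  refine ⟨hvol.measurable, ?_⟩
  rw [pi_stdComplexGaussian]
  refine Measure.ext fun A hA => ?_
  rw [Measure.map_apply hvol.measurable hA, withDensity_apply _ (hvol.measurable hA),
    withDensity_apply _ hA, ← lintegral_indicator hA, ← lintegral_indicator (hvol.measurable hA)]
  have hm : Measurable (A.indicator fun c : ι → ℂ =>
      ENNReal.ofReal (Real.pi⁻¹ ^ Fintype.card ι * Real.exp (-∑ i, ‖c i‖ ^ 2))) :=
    Measurable.indicator (by fun_prop) hA
  rw [← hvol.lintegral_comp hm]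
  refine lintegral_congr fun c => ?_
  by_cases hc : Φ t c ∈ A
  · rw [Set.indicator_of_mem (show c ∈ Φ t ⁻¹' A from hc), Set.indicator_of_mem hc,
      hΦ.sum_norm_sq_eq hswap]
  · rw [Set.indicator_of_notMem (show c ∉ Φ t ⁻¹' A from hc), Set.indicator_of_notMem hc]

end Hamiltonian

/-! ### Stationary solutions of the truncated equations -/

section Truncated

/-- Replaces the first `N + 1` terms of the sequence `z` by those of `y`. -/
def spliceSeq (N : ℕ) (y : Fin (N + 1) → ℂ) (z : ℕ → ℂ) (n : ℕ) : ℂ :=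
  if h : n < N + 1 then y ⟨n, h⟩ else z n

theorem measurable_spliceSeq (N : ℕ) :
    Measurable fun q : (Fin (N + 1) → ℂ) × (ℕ → ℂ) => spliceSeq N q.1 q.2 := by
  refine measurable_pi_lambda _ fun n => ?_
  unfold spliceSeq
  split_ifs
  · exact (measurable_pi_apply _).comp measurable_fst
  · exact (measurable_pi_apply _).comp measurable_snd

/-- The first `N + 1` terms of a Gaussian sequence may be resampled independently of the others. -/
theorem map_spliceSeq (N : ℕ) :
    ((Measure.pi fun _ : Fin (N + 1) => stdComplexGaussian).prod gaussianSeq).map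
      (fun q => spliceSeq N q.1 q.2) = gaussianSeq := by
  refine Measure.eq_infinitePi _ fun s t ht => ?_
  have hpre : (fun q : (Fin (N + 1) → ℂ) × (ℕ → ℂ) => spliceSeq N q.1 q.2) ⁻¹' (Set.pi s t)
      = (Set.univ.pi fun n : Fin (N + 1) => if (n : ℕ) ∈ s then t n else Set.univ) ×ˢ
        (Set.pi (s.filter fun n => ¬ n < N + 1) t) := by
    ext q
    simp only [Set.mem_preimage, Set.mem_pi, Set.mem_prod, Finset.coe_filter, Set.mem_ofPred_eq,
      Finset.mem_coe, spliceSeq, Set.mem_univ, true_imp_iff]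
    constructor
    · intro h
      refine ⟨fun n => ?_, fun n hn => ?_⟩
      · split_ifs with hs
        · simpa [n.2] using h n hs
        · trivial
      · simpa [hn.2] using h n hn.1
    · rintro ⟨h1, h2⟩ n hn
      by_cases hN : n < N + 1
      · simpa [hN, hn] using h1 ⟨n, hN⟩
      · simpa [hN] using h2 n ⟨hn, hN⟩
  rw [Measure.map_apply (measurable_spliceSeq N) (MeasurableSet.pi s.countable_toSet fun i _ => ht i),
    hpre, Measure.prod_prod, Measure.pi_pi, gaussianSeq, Measure.infinitePi_pi _ fun i _ => ht i,
    ← Finset.prod_filter_mul_prod_filter_not s (fun n => n < N + 1)]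
  congr 1
  have h1 : ∀ n : ℕ, stdComplexGaussian (if n ∈ s then t n else Set.univ)
      = if n ∈ s then stdComplexGaussian (t n) else 1 := fun n => by
    split_ifs
    · rfl
    · exact measure_univ
  simp only [h1]
  rw [Fin.prod_univ_eq_prod_range (fun n => if n ∈ s then stdComplexGaussian (t n) else 1) (N + 1),
    ← Finset.prod_filter]
  refine Finset.prod_congr ?_ fun _ _ => rfl
  ext n
  simp [and_comm]

/-- The field of the truncated equation, cut off at large mass. -/
def cutoffTruncatedField (ε : ℝ) (N n : ℕ) (c : ℕ → ℂ) : ℂ :=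
  massCutoff ε (fun i : Fin (N + 1) => c i) * truncatedField N n c

theorem continuous_cutoffTruncatedField (ε : ℝ) (N n : ℕ) :
    Continuous (cutoffTruncatedField ε N n) := by
  refine (Complex.continuous_ofReal.comp ?_).mul (continuous_truncatedField N n)
  exact (contDiff_massCutoff ε).continuous.comp (continuous_pi fun i => continuous_apply _)

theorem truncatedField_eq_cubicField (N : ℕ) (n : Fin (N + 1)) (c : ℕ → ℂ) :
    truncatedField N n c = cubicField (fun i j n m : Fin (N + 1) =>
      Real.pi * interaction i j n m) (fun i => c i) n := by
  rw [truncatedField, if_pos (Nat.lt_succ_iff.1 n.2), cubicField, Finset.mul_sum,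
    ← Fin.sum_univ_eq_sum_range]
  refine Finset.sum_congr rfl fun i _ => ?_
  rw [Finset.mul_sum, ← Fin.sum_univ_eq_sum_range]
  refine Finset.sum_congr rfl fun j _ => ?_
  rw [Finset.mul_sum, ← Fin.sum_univ_eq_sum_range]
  refine Finset.sum_congr rfl fun m _ => ?_
  push_cast
  ring

/-- The truncated equation, cut off at large mass, has a stationary solution with Gaussian
marginals: the modes up to `N` follow the Hamiltonian flow, and the modes above `N` are frozen. -/
theorem exists_stationary_truncated (N : ℕ) {ε : ℝ} (hε : 0 < ε) :
    ∃ ν : Measure PathSpace, IsProbabilityMeasure ν ∧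
      (∀ t, ν.map (fun x => pathAt x t) = gaussianSeq) ∧
      ∀ᵐ x ∂ν, ∀ n s t, x n t - x n s
        = -Complex.I * ∫ r in s..t, cutoffTruncatedField ε N n (pathAt x r) := by
  obtain ⟨Φ, hΦ, hcont, hpres⟩ := exists_isFlow_measurePreserving (ι := Fin (N + 1))
    (β := fun i j n m => Real.pi * interaction i j n m)
    (fun i j n m => by rw [interaction_swap_pairs])
    (fun i j n m => by rw [interaction_swap_left])
    (fun n j m h => by
      rw [interaction_eq_zero, mul_zero]
      exact fun h' => h (Fin.ext (by omega))) hε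
  let w : ((Fin (N + 1) → ℂ) × (ℕ → ℂ)) → ℝ → ℕ → ℂ := fun q t => spliceSeq N (Φ t q.1) q.2
  have hw : ∀ n, Continuous fun a : ((Fin (N + 1) → ℂ) × (ℕ → ℂ)) × ℝ => w a.1 a.2 n := by
    intro n
    simp only [w, spliceSeq]
    split_ifs
    · exact (continuous_apply _).comp (hcont.comp (by fun_prop :
        Continuous fun a : ((Fin (N + 1) → ℂ) × (ℕ → ℂ)) × ℝ => (a.2, a.1.1)))
    · fun_prop
  let x : ((Fin (N + 1) → ℂ) × (ℕ → ℂ)) → PathSpace := fun q n =>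
    ⟨fun t => w q t n, (hw n).comp (by fun_prop : Continuous fun t : ℝ => (q, t))⟩
  have hx : Continuous x := continuous_pi fun n =>
    ContinuousMap.continuous_of_continuous_uncurry _ (hw n)
  have hat : ∀ q t, pathAt (x q) t = spliceSeq N (Φ t q.1) q.2 := fun q t => rfl
  let Q := (Measure.pi fun _ : Fin (N + 1) => stdComplexGaussian).prod gaussianSeq
  refine ⟨Q.map x, Measure.isProbabilityMeasure_map hx.measurable.aemeasurable, fun t => ?_, ?_⟩
  · rw [Measure.map_map (continuous_pathAt t).measurable hx.measurable]
    have h1 : (fun x => pathAt x t) ∘ x = (fun q => spliceSeq N q.1 q.2) ∘ Prod.map (Φ t) id := rfl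
    have h2 : MeasurePreserving (Prod.map (Φ t) id) Q Q :=
      (hpres t).prod (MeasurePreserving.id gaussianSeq)
    rw [h1, ← Measure.map_map (measurable_spliceSeq N) h2.measurable, h2.map_eq, map_spliceSeq]
  · have hall : ∀ q n s t, x q n t - x q n s
        = -Complex.I * ∫ r in s..t, cutoffTruncatedField ε N n (pathAt (x q) r) := by
      intro q n s t
      have hc : Continuous fun r => cutoffTruncatedField ε N n (pathAt (x q) r) :=
        (continuous_cutoffTruncatedField ε N n).comp (continuous_pathAt_right _)
      have hfst : ∀ r, (fun i : Fin (N + 1) => pathAt (x q) r i) = Φ r q.1 := fun r => by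
        funext i
        rw [hat, spliceSeq, dif_pos i.2]
      have hd : ∀ r, HasDerivAt (fun r => x q n r)
          (-Complex.I * cutoffTruncatedField ε N n (pathAt (x q) r)) r := by
        intro r
        by_cases hn : n < N + 1
        · have h1 : (fun r => x q n r) = fun r => Φ r q.1 ⟨n, hn⟩ := by
            funext r
            change spliceSeq N (Φ r q.1) q.2 n = _
            simp [spliceSeq, hn]
          rw [h1]
          refine (hasDerivAt_pi.1 (hΦ.hasDerivAt q.1 r) ⟨n, hn⟩).congr_deriv ?_
          rw [cutoffField, cutoffTruncatedField, hfst,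
            truncatedField_eq_cubicField N ⟨n, hn⟩, hfst]
        · have h1 : (fun r => x q n r) = fun _ => q.2 n := by
            funext r
            change spliceSeq N (Φ r q.1) q.2 n = _
            simp [spliceSeq, hn]
          rw [h1, cutoffTruncatedField, truncatedField, if_neg (by omega), mul_zero, mul_zero]
          exact hasDerivAt_const _ _
      rw [← intervalIntegral.integral_const_mul]
      exact (intervalIntegral.integral_eq_sub_of_hasDerivAt (fun r _ => hd r)
        ((continuous_const.mul hc).intervalIntegrable _ _)).symm
    refine (ae_map_iff hx.measurable.aemeasurable ?_).2 (Eventually.of_forall fun q => hall q)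
    have hclosed : IsClosed {x : PathSpace | ∀ n s t, x n t - x n s
        = -Complex.I * ∫ r in s..t, cutoffTruncatedField ε N n (pathAt x r)} := by
      simp only [Set.ofPred_forall]
      refine isClosed_iInter fun n => isClosed_iInter fun s => isClosed_iInter fun t => ?_
      refine isClosed_eq (by fun_prop) (continuous_const.mul ?_)
      exact intervalIntegral.continuous_parametric_intervalIntegral_of_continuous'
        (f := fun (x : PathSpace) r => cutoffTruncatedField ε N n (pathAt x r))
        ((continuous_cutoffTruncatedField ε N n).comp continuous_pathAt_uncurry) s t
    exact hclosed.measurableSet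

end Truncated

/-! ### Gaussian moments -/

section Moments

open scoped NNReal ComplexConjugate

theorem map_mul_I_stdComplexGaussian :
    stdComplexGaussian.map (fun z => Complex.I * z) = stdComplexGaussian := by
  have hrot : MeasurePreserving (fun z : ℂ => Complex.I * z) volume volume := by
    have h := (rotation (⟨Complex.I, by simp [Submonoid.unitSphere]⟩ : Circle)).measurePreserving
    exact h
  refine Measure.ext fun A hA => ?_
  rw [Measure.map_apply hrot.measurable hA, stdComplexGaussian,
    withDensity_apply _ (hrot.measurable hA), withDensity_apply _ hA,
    ← lintegral_indicator (hrot.measurable hA), ← lintegral_indicator hA,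
    ← hrot.lintegral_comp (Measurable.indicator (by fun_prop) hA)]
  refine lintegral_congr fun z => ?_
  by_cases hz : Complex.I * z ∈ A
  · rw [Set.indicator_of_mem (show z ∈ (fun z : ℂ => Complex.I * z) ⁻¹' A from hz),
      Set.indicator_of_mem hz]
    simp
  · rw [Set.indicator_of_notMem (show z ∉ (fun z : ℂ => Complex.I * z) ⁻¹' A from hz),
      Set.indicator_of_notMem hz]

/-- The rotation of the `l`-th term of a sequence by a quarter turn. -/
def rotateCoord (l : ℕ) (c : ℕ → ℂ) (k : ℕ) : ℂ := (if k = l then Complex.I else 1) * c k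

theorem measurePreserving_rotateCoord (l : ℕ) :
    MeasurePreserving (rotateCoord l) gaussianSeq gaussianSeq := by
  refine ⟨by unfold rotateCoord; fun_prop, ?_⟩
  have h := Measure.infinitePi_map_pi (μ := fun _ : ℕ => stdComplexGaussian)
    (f := fun k z => (if k = l then Complex.I else 1) * z) (fun k => by fun_prop)
  have h2 : (fun k : ℕ => stdComplexGaussian.map
      (fun z => (if k = l then Complex.I else 1) * z)) = fun _ => stdComplexGaussian := by
    funext k
    split_ifs
    · exact map_mul_I_stdComplexGaussian
    · simp
  rw [h2] at h
  exact h

theorem lintegral_stdComplexGaussian_pow_six_lt_top :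
    ∫⁻ z, ‖z‖ₑ ^ 6 ∂stdComplexGaussian < ∞ := by
  have hint : Integrable fun z : ℂ => Real.exp (-(1 / 2) * ‖z‖ ^ 2) := by
    refine Integrable.of_integral_ne_zero ?_
    rw [GaussianFourier.integral_rexp_neg_mul_sq_norm (V := ℂ) (b := 1 / 2) (by norm_num)]
    simp [Real.pi_ne_zero]
  rw [stdComplexGaussian, lintegral_withDensity_eq_lintegral_mul _ (by fun_prop) (by fun_prop)]
  refine lt_of_le_of_lt (lintegral_mono (g := fun z : ℂ =>
    ENNReal.ofReal (48 * Real.pi⁻¹ * Real.exp (-(1 / 2) * ‖z‖ ^ 2))) fun z => ?_)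
    (hasFiniteIntegral_iff_ofReal (Eventually.of_forall fun z => by positivity) |>.1
      (hint.const_mul (48 * Real.pi⁻¹)).2)
  simp only [Pi.mul_apply]
  rw [← ofReal_norm, ← ENNReal.ofReal_pow (norm_nonneg _), ← ENNReal.ofReal_mul (by positivity)]
  refine ENNReal.ofReal_le_ofReal ?_
  have h1 := Real.pow_div_factorial_le_exp (‖z‖ ^ 2 / 2) (by positivity) 3
  have h2 : ‖z‖ ^ 6 ≤ 48 * Real.exp (‖z‖ ^ 2 / 2) := by
    have : ((3).factorial : ℝ) = 6 := by norm_num [Nat.factorial]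
    rw [this] at h1
    nlinarith
  calc Real.pi⁻¹ * Real.exp (-‖z‖ ^ 2) * ‖z‖ ^ 6
      ≤ Real.pi⁻¹ * Real.exp (-‖z‖ ^ 2) * (48 * Real.exp (‖z‖ ^ 2 / 2)) := by gcongr
    _ = 48 * Real.pi⁻¹ * (Real.exp (-‖z‖ ^ 2) * Real.exp (‖z‖ ^ 2 / 2)) := by ring
    _ = _ := by
      rw [← Real.exp_add]
      congr 2
      ring

/-- The sixth moment of a standard complex Gaussian variable. -/
def sixthMoment : ℝ≥0 := (∫⁻ z, ‖z‖ₑ ^ 6 ∂stdComplexGaussian).toNNReal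

theorem lintegral_pow_six_eq (n : ℕ) : ∫⁻ c, ‖c n‖ₑ ^ 6 ∂gaussianSeq = sixthMoment := by
  have h : MeasurePreserving (Function.eval n) gaussianSeq stdComplexGaussian :=
    measurePreserving_eval_infinitePi _ n
  rw [sixthMoment, ENNReal.coe_toNNReal lintegral_stdComplexGaussian_pow_six_lt_top.ne,
    ← h.lintegral_comp (by fun_prop)]

theorem lintegral_sq_le (n : ℕ) : ∫⁻ c, ‖c n‖ₑ ^ 2 ∂gaussianSeq ≤ 1 + sixthMoment := by
  rw [← lintegral_pow_six_eq n]
  have : (1 : ℝ≥0∞) = ∫⁻ c, 1 ∂gaussianSeq := by simp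
  nth_rewrite 1 [this]
  rw [← lintegral_add_left measurable_const]
  refine lintegral_mono fun c => ?_
  rcases le_total ‖c n‖ₑ 1 with h | h
  · exact (pow_le_one₀ zero_le h).trans le_self_add
  · exact (pow_le_pow_right₀ h (by norm_num)).trans le_add_self

/-- The cubic monomial `cᵢ cⱼ conj cₘ`, for `a = (i, j, m)`. -/
def cubicMonomial (a : ℕ × ℕ × ℕ) (c : ℕ → ℂ) : ℂ := c a.1 * c a.2.1 * conj (c a.2.2)

theorem continuous_cubicMonomial (a : ℕ × ℕ × ℕ) : Continuous (cubicMonomial a) := by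
  unfold cubicMonomial
  have : Continuous (conj : ℂ → ℂ) := Complex.continuous_conj
  fun_prop

/-- The square of a product of three factors is bounded by the sum of their sixth powers, so that no
independence is needed. -/
theorem lintegral_cubicMonomial_sq_le (a : ℕ × ℕ × ℕ) :
    ∫⁻ c, ‖cubicMonomial a c‖ₑ ^ 2 ∂gaussianSeq ≤ 3 * sixthMoment := by
  have h3 : (3 * sixthMoment : ℝ≥0∞) = ∫⁻ c, (‖c a.1‖ₑ ^ 6 + ‖c a.2.1‖ₑ ^ 6 + ‖c a.2.2‖ₑ ^ 6)
      ∂gaussianSeq := by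
    rw [lintegral_add_left (by fun_prop), lintegral_add_left (by fun_prop), lintegral_pow_six_eq,
      lintegral_pow_six_eq, lintegral_pow_six_eq]
    ring
  rw [h3]
  refine lintegral_mono fun c => ?_
  simp only [cubicMonomial, enorm_mul]
  have hconj : ‖conj (c a.2.2)‖ₑ = ‖c a.2.2‖ₑ := by simp [← ofReal_norm]
  rw [hconj]
  have key : ∀ x y z w : ℝ≥0∞, x ≤ w → y ≤ w → z ≤ w → (x * y * z) ^ 2 ≤ w ^ 6 :=
    fun x y z w hx hy hz => by
      calc (x * y * z) ^ 2 ≤ (w * w * w) ^ 2 := by gcongr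
        _ = w ^ 6 := by ring
  set x := ‖c a.1‖ₑ
  set y := ‖c a.2.1‖ₑ
  set z := ‖c a.2.2‖ₑ
  rcases le_total x y with h1 | h1 <;> rcases le_total y z with h2 | h2 <;>
    rcases le_total x z with h3 | h3
  · exact (key x y z z h3 h2 le_rfl).trans le_add_self
  · exact (key x y z z (h1.trans h2) h2 le_rfl).trans le_add_self
  · exact (key x y z y h1 le_rfl h2).trans (le_add_self.trans le_self_add)
  · exact (key x y z y h1 le_rfl h2).trans (le_add_self.trans le_self_add)
  · exact (key x y z z h3 h2 le_rfl).trans le_add_self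
  · exact (key x y z x le_rfl h1 h3).trans (le_self_add.trans le_self_add)
  · exact (key x y z z h3 (h1.trans h3) le_rfl).trans le_add_self
  · exact (key x y z x le_rfl h1 h3).trans (le_self_add.trans le_self_add)

theorem memLp_two_iff_lintegral_sq {α : Type*} [MeasurableSpace α] {μ : Measure α} {f : α → ℂ}
    (hf : AEStronglyMeasurable f μ) : MemLp f 2 μ ↔ ∫⁻ c, ‖f c‖ₑ ^ 2 ∂μ < ∞ := by
  rw [MemLp, eLpNorm_lt_top_iff_lintegral_rpow_enorm_lt_top (by simp) (by simp)]
  simp [hf]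

theorem eLpNorm_two_sq {α : Type*} [MeasurableSpace α] {μ : Measure α} (f : α → ℂ) :
    eLpNorm f 2 μ ^ 2 = ∫⁻ c, ‖f c‖ₑ ^ 2 ∂μ := by
  have := eLpNorm_nnreal_pow_eq_lintegral (μ := μ) (f := f) (p := 2) (by simp)
  simpa using this

theorem memLp_cubicMonomial (a : ℕ × ℕ × ℕ) : MemLp (cubicMonomial a) 2 gaussianSeq := by
  rw [memLp_two_iff_lintegral_sq (continuous_cubicMonomial a).aestronglyMeasurable]
  refine (lintegral_cubicMonomial_sq_le a).trans_lt ?_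
  exact ENNReal.mul_lt_top (by simp) ENNReal.coe_lt_top

/-- Two monomials are uncorrelated if the numbers of factors `c l` and of factors `conj (c l)` in
`cubicMonomial b c * conj (cubicMonomial a c)` differ: a quarter turn of the `l`-th variable
preserves the Gaussian measure and multiplies this product by a power of `i`, which is not `1`
because the difference is at most `3`. -/
theorem integral_conj_cubicMonomial_mul_eq_zero {a b : ℕ × ℕ × ℕ} {l : ℕ}
    (h : (if b.1 = l then 1 else 0) + (if b.2.1 = l then 1 else 0) + (if a.2.2 = l then 1 else 0)
      ≠ (if a.1 = l then 1 else 0) + (if a.2.1 = l then 1 else 0) + (if b.2.2 = l then 1 else 0)) :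
    ∫ c, cubicMonomial b c * conj (cubicMonomial a c) ∂gaussianSeq = 0 := by
  have hm := measurePreserving_rotateCoord l
  have hcont : Continuous fun c => cubicMonomial b c * conj (cubicMonomial a c) :=
    (continuous_cubicMonomial b).mul (Complex.continuous_conj.comp (continuous_cubicMonomial a))
  have h1 : ∫ c, cubicMonomial b (rotateCoord l c) * conj (cubicMonomial a (rotateCoord l c))
      ∂gaussianSeq = ∫ c, cubicMonomial b c * conj (cubicMonomial a c) ∂gaussianSeq := by
    conv_rhs => rw [← hm.map_eq]
    rw [integral_map hm.measurable.aemeasurable hcont.aestronglyMeasurable]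
  obtain ⟨ζ, hζ, h2⟩ : ∃ ζ : ℂ, ζ ≠ 1 ∧ ∀ c, cubicMonomial b (rotateCoord l c) *
      conj (cubicMonomial a (rotateCoord l c))
      = ζ * (cubicMonomial b c * conj (cubicMonomial a c)) := by
    refine ⟨(if b.1 = l then Complex.I else 1) * (if b.2.1 = l then Complex.I else 1)
      * conj (if b.2.2 = l then Complex.I else 1) * conj (if a.1 = l then Complex.I else 1)
      * conj (if a.2.1 = l then Complex.I else 1) * (if a.2.2 = l then Complex.I else 1), ?_,
      fun c => ?_⟩
    · revert h
      split_ifs <;> intro h <;> simp [Complex.ext_iff] at h ⊢ <;> norm_num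
    · simp only [cubicMonomial, rotateCoord, map_mul, Complex.conj_conj]
      ring
  simp only [h2] at h1
  rw [integral_const_mul] at h1
  have h3 : (ζ - 1) * ∫ c, cubicMonomial b c * conj (cubicMonomial a c) ∂gaussianSeq = 0 := by
    rw [sub_mul, h1, one_mul, sub_self]
  exact (mul_eq_zero.1 h3).resolve_left (sub_ne_zero.2 hζ)

/-- Distinct non-resonant monomials are uncorrelated. -/
theorem integral_conj_cubicMonomial_mul_eq_zero_of_ne {a b : ℕ × ℕ × ℕ}
    (ha : a.2.2 ≠ a.1 ∧ a.2.2 ≠ a.2.1) (hb : b.2.2 ≠ b.1 ∧ b.2.2 ≠ b.2.1)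
    (h1 : b ≠ a) (h2 : b ≠ (a.2.1, a.1, a.2.2)) :
    ∫ c, cubicMonomial b c * conj (cubicMonomial a c) ∂gaussianSeq = 0 := by
  obtain ⟨i, j, m⟩ := a
  obtain ⟨i', j', m'⟩ := b
  simp only [ne_eq, Prod.mk.injEq, not_and] at ha hb h1 h2
  by_contra hne
  have hall : ∀ l : ℕ, _ := fun l =>
    not_imp_comm.1 (integral_conj_cubicMonomial_mul_eq_zero (a := (i, j, m)) (b := (i', j', m'))
      (l := l)) hne
  have hm := hall m
  have hi := hall i
  have hj := hall j
  have hi' := hall i'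
  clear hall
  grind

end Moments

/-! ### Convergence of the nonlinearity in mean square -/

section Convergence

open scoped NNReal ComplexConjugate

/-- The sum over all `m` is equal to `2`, by the negative binomial series at `1/2`. -/
theorem sum_choose_div_le (n M : ℕ) :
    ∑ m ∈ Finset.range M, ((n + m).choose n / 2 ^ (n + m) : ℝ) ≤ 2 := by
  have h := hasSum_choose_mul_geometric_of_norm_lt_one n (r := (1 / 2 : ℝ)) (by norm_num)
  have h1 : (1 / (1 - 1 / 2) ^ (n + 1) : ℝ) = 2 ^ n * 2 := by
    rw [show (1 - 1 / 2 : ℝ) = 2⁻¹ by norm_num, inv_pow, one_div, inv_inv, pow_succ]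
  rw [h1] at h
  have h2 := sum_le_hasSum (Finset.range M) (fun m _ => by positivity) h
  have h3 : ∑ m ∈ Finset.range M, ((n + m).choose n / 2 ^ (n + m) : ℝ)
      = (∑ m ∈ Finset.range M, ((m + n).choose n : ℝ) * (1 / 2) ^ m) / 2 ^ n := by
    rw [Finset.sum_div]
    refine Finset.sum_congr rfl fun m _ => ?_
    rw [add_comm n m, pow_add, one_div, inv_pow]
    field_simp
  rw [h3, div_le_iff₀ (by positivity)]
  linarith

/-- The interaction coefficient of a triple `(i, j, m)` in the mode `n`. -/
def tripleCoeff (n : ℕ) (a : ℕ × ℕ × ℕ) : ℝ := interaction a.1 a.2.1 n a.2.2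

theorem tripleCoeff_nonneg (n : ℕ) (a : ℕ × ℕ × ℕ) : 0 ≤ tripleCoeff n a :=
  interaction_nonneg _ _ _ _

/-- The triples `(i, j, m)` of indices less than `M`. -/
def cube (M : ℕ) : Finset (ℕ × ℕ × ℕ) :=
  Finset.range M ×ˢ (Finset.range M ×ˢ Finset.range M)

theorem exists_subset_cube (A : Finset (ℕ × ℕ × ℕ)) : ∃ M, A ⊆ cube M := by
  refine ⟨A.sup (fun a => a.1 + a.2.1 + a.2.2 + 1), fun a ha => ?_⟩
  have := Finset.le_sup (f := fun a : ℕ × ℕ × ℕ => a.1 + a.2.1 + a.2.2 + 1) ha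
  simp only [cube, Finset.mem_product, Finset.mem_range]
  omega

theorem tendsto_cube : Tendsto (fun N => cube (N + 1)) atTop atTop := by
  refine tendsto_atTop_finset_of_monotone (fun M N h a ha => ?_) fun a =>
    ⟨a.1 + a.2.1 + a.2.2, ?_⟩
  · simp only [cube, Finset.mem_product, Finset.mem_range] at ha ⊢
    omega
  · simp only [cube, Finset.mem_product, Finset.mem_range]
    omega

/-- The squares of the coefficients are products of binomial probabilities: the sum over `i` is at
most `1`, and the sum over `m` at most `2`. -/
theorem sum_tripleCoeff_sq_le (n : ℕ) (A : Finset (ℕ × ℕ × ℕ)) :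
    ∑ a ∈ A, tripleCoeff n a ^ 2 ≤ 2 := by
  obtain ⟨M, hM⟩ := exists_subset_cube A
  refine (Finset.sum_le_sum_of_subset_of_nonneg hM fun _ _ _ => sq_nonneg _).trans ?_
  rw [cube, Finset.sum_product_right, Finset.sum_product_right]
  refine le_trans (Finset.sum_le_sum fun m _ => ?_) (sum_choose_div_le n M)
  have h : ∀ i j, tripleCoeff n (i, j, m) ^ 2
      = if i + j = n + m then ((n + m).choose i / 2 ^ (n + m) : ℝ) * ((n + m).choose n / 2 ^ (n + m))
        else 0 := by
    intro i j
    simp only [tripleCoeff, interaction]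
    split_ifs with h
    · rw [h, mul_pow, binomialWeight_sq, binomialWeight_sq]
    · simp
  simp only [h]
  have hin : ∀ i, ∑ j ∈ Finset.range M, (if i + j = n + m then
      ((n + m).choose i / 2 ^ (n + m) : ℝ) * ((n + m).choose n / 2 ^ (n + m)) else 0)
      ≤ ((n + m).choose i / 2 ^ (n + m) : ℝ) * ((n + m).choose n / 2 ^ (n + m)) := by
    intro i
    rw [← Finset.sum_filter, Finset.sum_const, nsmul_eq_mul]
    refine mul_le_of_le_one_left (by positivity) ?_
    have : (Finset.filter (fun j => i + j = n + m) (Finset.range M)).card ≤ 1 :=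
      Finset.card_le_one.2 fun a ha b hb => by
        simp only [Finset.mem_filter] at ha hb
        omega
    exact_mod_cast this
  rw [Finset.sum_comm]
  refine (Finset.sum_le_sum fun i _ => hin i).trans ?_
  rw [← Finset.sum_mul]
  refine mul_le_of_le_one_left (by positivity) ?_
  rw [← Finset.sum_div, div_le_one (by positivity)]
  have h1 : ∑ i ∈ Finset.range M, (n + m).choose i ≤ 2 ^ (n + m) := by
    rw [← Nat.sum_range_choose]
    refine (Finset.sum_le_sum_of_ne_zero fun i _ hi => ?_)
    rw [Finset.mem_range]
    by_contra hcon
    exact hi (Nat.choose_eq_zero_of_lt (by omega))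
  exact_mod_cast h1

/-- A triple `(i, j, m)` is resonant if `m` is equal to `i` or to `j`. -/
abbrev IsResonant (a : ℕ × ℕ × ℕ) : Prop := a.2.2 = a.1 ∨ a.2.2 = a.2.1

/-- On resonant triples the two binomial weights are equal, so that the coefficient is itself a
binomial probability. -/
theorem sum_tripleCoeff_resonant_le (n : ℕ) (A : Finset (ℕ × ℕ × ℕ)) :
    ∑ a ∈ A, (if IsResonant a then tripleCoeff n a else 0) ≤ 4 := by
  obtain ⟨M, hM⟩ := exists_subset_cube A
  refine (Finset.sum_le_sum_of_subset_of_nonneg hM fun a _ _ => ?_).trans ?_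
  · split_ifs
    exacts [tripleCoeff_nonneg n a, le_rfl]
  have hle : ∀ a : ℕ × ℕ × ℕ, (if IsResonant a then tripleCoeff n a else 0)
      ≤ (if a.2.2 = a.1 ∧ a.2.1 = n then ((n + a.2.2).choose n / 2 ^ (n + a.2.2) : ℝ) else 0)
        + (if a.2.2 = a.2.1 ∧ a.1 = n then ((n + a.2.2).choose n / 2 ^ (n + a.2.2) : ℝ) else 0) := by
    rintro ⟨i, j, m⟩
    have key : binomialWeight (n + m) m * binomialWeight (n + m) n
        = ((n + m).choose n / 2 ^ (n + m) : ℝ) := by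
      rw [← binomialWeight_add_symm, ← sq, binomialWeight_sq]
    have h0 : 0 ≤ ((n + m).choose n / 2 ^ (n + m) : ℝ) := by positivity
    simp only [IsResonant, tripleCoeff]
    by_cases hij : i + j = n + m
    · by_cases h1 : m = i
      · subst h1
        have : j = n := by omega
        subst this
        rw [if_pos (Or.inl rfl), if_pos ⟨rfl, rfl⟩, interaction, if_pos hij, add_comm m j, key]
        split_ifs <;> simp [h0]
      · by_cases h2 : m = j
        · subst h2
          have : i = n := by omega
          subst this
          rw [if_pos (Or.inr rfl), if_pos (⟨rfl, rfl⟩ : m = m ∧ i = i), interaction, if_pos hij,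
            ← sq, binomialWeight_sq]
          split_ifs <;> simp [h0]
        · rw [if_neg (by tauto)]
          split_ifs <;> simp [h0]
    · rw [interaction_eq_zero hij]
      split_ifs <;> simp [h0]
  refine (Finset.sum_le_sum fun a _ => hle a).trans ?_
  have hone : ∀ P : ℕ × ℕ × ℕ → Prop, ∀ [DecidablePred P], (∀ a b, P a → P b → a.2.2 = b.2.2 → a = b) →
      ∑ a ∈ cube M, (if P a then ((n + a.2.2).choose n / 2 ^ (n + a.2.2) : ℝ) else 0) ≤ 2 := by
    intro P _ hP
    refine le_trans ?_ (sum_choose_div_le n M)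
    rw [← Finset.sum_filter, ← Finset.sum_image (f := fun m => ((n + m).choose n / 2 ^ (n + m) : ℝ))
      (g := fun a : ℕ × ℕ × ℕ => a.2.2)]
    · refine Finset.sum_le_sum_of_subset_of_nonneg (fun m hm => ?_) fun m _ _ => by positivity
      simp only [cube, Finset.mem_image, Finset.mem_filter, Finset.mem_product] at hm
      obtain ⟨a, ha, rfl⟩ := hm
      exact ha.1.2.2
    · intro a ha b hb hab
      simp only [Finset.coe_filter, Set.mem_ofPred_eq] at ha hb
      exact hP a b ha.2 hb.2 hab
  rw [Finset.sum_add_distrib]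
  have e : (4 : ℝ) = 2 + 2 := by norm_num
  rw [e]
  refine add_le_add (hone _ ?_) (hone _ ?_)
  · rintro ⟨i, j, m⟩ ⟨i', j', m'⟩ h1 h2 h3
    simp only [Prod.mk.injEq] at h1 h2 h3 ⊢
    omega
  · rintro ⟨i, j, m⟩ ⟨i', j', m'⟩ h1 h2 h3
    simp only [Prod.mk.injEq] at h1 h2 h3 ⊢
    omega

/-- The contribution of the triple `(i, j, m)` to the mode `n`, in `L²` of the Gaussian measure. -/
def tripleTerm (n : ℕ) (a : ℕ × ℕ × ℕ) : Lp ℂ 2 gaussianSeq :=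
  (tripleCoeff n a : ℂ) • (memLp_cubicMonomial a).toLp

/-- A bound for the `L²` norm of cubic monomials. -/
def monomialBound : ℝ := Real.sqrt (3 * sixthMoment)

theorem norm_toLp_cubicMonomial_le (a : ℕ × ℕ × ℕ) :
    ‖(memLp_cubicMonomial a).toLp‖ ≤ monomialBound := by
  refine Real.le_sqrt_of_sq_le ?_
  rw [Lp.norm_toLp, ← ENNReal.toReal_pow, eLpNorm_two_sq]
  exact ENNReal.toReal_le_of_le_ofReal (by positivity)
    ((lintegral_cubicMonomial_sq_le a).trans_eq (by
      rw [ENNReal.ofReal_mul (by norm_num), ENNReal.ofReal_coe_nnreal]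
      norm_num))

theorem norm_tripleTerm_le (n : ℕ) (a : ℕ × ℕ × ℕ) :
    ‖tripleTerm n a‖ ≤ tripleCoeff n a * monomialBound := by
  rw [tripleTerm, norm_smul, Complex.norm_real, Real.norm_of_nonneg (tripleCoeff_nonneg n a)]
  exact mul_le_mul_of_nonneg_left (norm_toLp_cubicMonomial_le a) (tripleCoeff_nonneg n a)

theorem inner_tripleTerm_eq_zero {n : ℕ} {a b : ℕ × ℕ × ℕ} (ha : ¬ IsResonant a)
    (hb : ¬ IsResonant b) (h1 : b ≠ a) (h2 : b ≠ (a.2.1, a.1, a.2.2)) :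
    inner ℂ (tripleTerm n a) (tripleTerm n b) = 0 := by
  rw [tripleTerm, tripleTerm, inner_smul_left, inner_smul_right, L2.inner_def]
  have h : ∫ c, inner ℂ ((memLp_cubicMonomial a).toLp (cubicMonomial a) c)
      ((memLp_cubicMonomial b).toLp (cubicMonomial b) c) ∂gaussianSeq
      = ∫ c, cubicMonomial b c * conj (cubicMonomial a c) ∂gaussianSeq := by
    refine integral_congr_ae ?_
    filter_upwards [(memLp_cubicMonomial a).coeFn_toLp, (memLp_cubicMonomial b).coeFn_toLp]
      with c hac hbc
    rw [hac, hbc]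
    rfl
  rw [h, integral_conj_cubicMonomial_mul_eq_zero_of_ne (not_or.1 ha) (not_or.1 hb) h1 h2,
    mul_zero, mul_zero]

/-- Almost orthogonality: if each vector of a family is orthogonal to all the others but one, of
the same size, then the norm of a sum is controlled by the sum of the squares of the norms. -/
theorem norm_sum_sq_le_of_almost_orthogonal {κ E : Type*} [DecidableEq κ] [NormedAddCommGroup E]
    [InnerProductSpace ℂ E] {v : κ → E} {w : κ → ℝ} (s : κ → κ) (A : Finset κ)
    (hv : ∀ a, ‖v a‖ ≤ w a) (hw : ∀ a, w (s a) = w a)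
    (h : ∀ a ∈ A, ∀ b ∈ A, b ≠ a → b ≠ s a → inner ℂ (v a) (v b) = 0) :
    ‖∑ a ∈ A, v a‖ ^ 2 ≤ 2 * ∑ a ∈ A, w a ^ 2 := by
  have hw0 : ∀ a, 0 ≤ w a := fun a => (norm_nonneg _).trans (hv a)
  have h1 : ‖∑ a ∈ A, v a‖ ^ 2 = ‖∑ a ∈ A, ∑ b ∈ A, inner ℂ (v a) (v b)‖ := by
    have : ∑ a ∈ A, ∑ b ∈ A, inner ℂ (v a) (v b) = inner ℂ (∑ a ∈ A, v a) (∑ a ∈ A, v a) := by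
      rw [sum_inner]
      exact Finset.sum_congr rfl fun a _ => (inner_sum _ _ _).symm
    rw [this, inner_self_eq_norm_sq_to_K]
    simp
  rw [h1, Finset.mul_sum]
  refine (norm_sum_le _ _).trans (Finset.sum_le_sum fun a ha => ?_)
  have h2 : ∑ b ∈ A, inner ℂ (v a) (v b)
      = ∑ b ∈ A.filter (fun b => b = a ∨ b = s a), inner ℂ (v a) (v b) := by
    rw [Finset.sum_filter]
    refine Finset.sum_congr rfl fun b hb => ?_
    split_ifs with hc
    · rfl
    · exact h a ha b hb (fun e => hc (Or.inl e)) fun e => hc (Or.inr e)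
  rw [h2]
  have h3 : ∀ b ∈ A.filter (fun b => b = a ∨ b = s a), ‖inner ℂ (v a) (v b)‖ ≤ w a ^ 2 := by
    intro b hb
    have hwb : w b = w a := by
      rcases (Finset.mem_filter.1 hb).2 with rfl | rfl
      exacts [rfl, hw a]
    calc ‖inner ℂ (v a) (v b)‖ ≤ ‖v a‖ * ‖v b‖ := norm_inner_le_norm _ _
      _ ≤ w a * w b := mul_le_mul (hv a) (hv b) (norm_nonneg _) (hw0 a)
      _ = w a ^ 2 := by rw [hwb, sq]
  refine (norm_sum_le_of_le _ h3).trans ?_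
  rw [Finset.sum_const, nsmul_eq_mul]
  refine mul_le_mul_of_nonneg_right ?_ (sq_nonneg _)
  have : (A.filter (fun b => b = a ∨ b = s a)).card ≤ ({a, s a} : Finset κ).card := by
    refine Finset.card_le_card fun b hb => ?_
    simpa using (Finset.mem_filter.1 hb).2
  exact_mod_cast this.trans Finset.card_le_two

/-- The resonant terms are summed absolutely. The others are pairwise orthogonal, except for the
exchange of `i` and `j`. -/
theorem norm_sum_tripleTerm_le (n : ℕ) (A : Finset (ℕ × ℕ × ℕ)) :
    ‖∑ a ∈ A, tripleTerm n a‖ ≤ monomialBound *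
      (∑ a ∈ A, (if IsResonant a then tripleCoeff n a else 0)
        + Real.sqrt (2 * ∑ a ∈ A, tripleCoeff n a ^ 2)) := by
  rw [← Finset.sum_filter_add_sum_filter_not A IsResonant, mul_add]
  refine (norm_add_le _ _).trans (add_le_add ?_ ?_)
  · rw [← Finset.sum_filter, Finset.mul_sum]
    refine norm_sum_le_of_le _ fun a _ => (norm_tripleTerm_le n a).trans_eq (mul_comm _ _)
  · have h := norm_sum_sq_le_of_almost_orthogonal (v := tripleTerm n)
      (w := fun a => tripleCoeff n a * monomialBound) (fun a => (a.2.1, a.1, a.2.2))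
      (A.filter fun a => ¬ IsResonant a) (norm_tripleTerm_le n)
      (fun a => by simp only [tripleCoeff, interaction_swap_left])
      fun a ha b hb => inner_tripleTerm_eq_zero (Finset.mem_filter.1 ha).2 (Finset.mem_filter.1 hb).2
    have hle : 2 * ∑ a ∈ A.filter (fun a => ¬ IsResonant a), (tripleCoeff n a * monomialBound) ^ 2
        ≤ monomialBound ^ 2 * (2 * ∑ a ∈ A, tripleCoeff n a ^ 2) := by
      have : ∑ a ∈ A.filter (fun a => ¬ IsResonant a), (tripleCoeff n a * monomialBound) ^ 2
          ≤ ∑ a ∈ A, (tripleCoeff n a * monomialBound) ^ 2 :=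
        Finset.sum_le_sum_of_subset_of_nonneg (Finset.filter_subset _ _) fun _ _ _ => sq_nonneg _
      simp only [mul_pow] at this ⊢
      rw [← Finset.sum_mul] at this
      rw [← Finset.sum_mul] at this ⊢
      linarith
    have hb : 0 ≤ monomialBound := Real.sqrt_nonneg _
    rw [← Real.sqrt_sq hb, ← Real.sqrt_mul (sq_nonneg _)]
    exact Real.le_sqrt_of_sq_le (h.trans hle)

theorem summable_tripleTerm (n : ℕ) : Summable (tripleTerm n) := by
  have hb : 0 ≤ monomialBound := Real.sqrt_nonneg _
  have h1 : Summable fun a => if IsResonant a then tripleCoeff n a else 0 :=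
    summable_of_sum_le (fun a => by
      split_ifs
      exacts [tripleCoeff_nonneg n a, le_rfl]) (sum_tripleCoeff_resonant_le n)
  have h2 : Summable fun a => tripleCoeff n a ^ 2 :=
    summable_of_sum_le (fun a => sq_nonneg _) (sum_tripleCoeff_sq_le n)
  rw [summable_iff_vanishing_norm] at h1 h2 ⊢
  intro ε hε
  -- both parts of the bound of the norm will be at most `monomialBound * δ`; the summand `1` makes
  -- the denominator positive and the final inequality strict
  set δ := ε / (2 * (monomialBound + 1)) with hδ
  have hδ0 : 0 < δ := by positivity
  obtain ⟨s, hs⟩ := h1 δ hδ0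
  obtain ⟨t, ht⟩ := h2 (δ ^ 2 / 2) (by positivity)
  refine ⟨s ∪ t, fun A hA => ?_⟩
  rw [Finset.disjoint_union_right] at hA
  have e1 := (le_abs_self _).trans_lt (hs A hA.1)
  have e2 := (le_abs_self _).trans_lt (ht A hA.2)
  have e3 : Real.sqrt (2 * ∑ a ∈ A, tripleCoeff n a ^ 2) ≤ δ :=
    Real.sqrt_le_iff.2 ⟨hδ0.le, by linarith⟩
  refine (norm_sum_tripleTerm_le n A).trans_lt ?_
  calc _ ≤ monomialBound * (δ + δ) := by gcongr
    _ < (monomialBound + 1) * (δ + δ) := by nlinarith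
    _ = ε := by
      rw [hδ]
      field_simp
      ring

theorem norm_sum_tripleTerm_le_const (n : ℕ) (A : Finset (ℕ × ℕ × ℕ)) :
    ‖∑ a ∈ A, tripleTerm n a‖ ≤ monomialBound * 6 := by
  have hb : 0 ≤ monomialBound := Real.sqrt_nonneg _
  refine (norm_sum_tripleTerm_le n A).trans (mul_le_mul_of_nonneg_left ?_ hb)
  have h1 := sum_tripleCoeff_resonant_le n A
  have h2 : Real.sqrt (2 * ∑ a ∈ A, tripleCoeff n a ^ 2) ≤ 2 :=
    Real.sqrt_le_iff.2 ⟨by norm_num, by linarith [sum_tripleCoeff_sq_le n A]⟩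
  linarith

theorem truncatedField_eq_sum {N n : ℕ} (h : n ≤ N) (c : ℕ → ℂ) :
    truncatedField N n c
      = Real.pi * ∑ a ∈ cube (N + 1), (tripleCoeff n a : ℂ) * cubicMonomial a c := by
  rw [truncatedField, if_pos h, cube, Finset.sum_product]
  simp only [Finset.sum_product]
  rfl

theorem memLp_truncatedField (N n : ℕ) : MemLp (truncatedField N n) 2 gaussianSeq := by
  by_cases h : n ≤ N
  · have : truncatedField N n
        = fun c => (Real.pi : ℂ) * ∑ a ∈ cube (N + 1), (tripleCoeff n a : ℂ) * cubicMonomial a c :=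
      funext fun c => truncatedField_eq_sum h c
    rw [this]
    exact (memLp_finsetSum _ fun a _ => (memLp_cubicMonomial a).const_mul _).const_mul _
  · have : truncatedField N n = fun _ => 0 := by
      funext c
      rw [truncatedField, if_neg h]
    rw [this]
    exact MemLp.zero'

theorem toLp_truncatedField {N n : ℕ} (h : n ≤ N) :
    (memLp_truncatedField N n).toLp = (Real.pi : ℂ) • ∑ a ∈ cube (N + 1), tripleTerm n a := by
  refine Lp.ext ?_
  have h1 : ∀ a, tripleTerm n a =ᵐ[gaussianSeq] fun c => (tripleCoeff n a : ℂ) * cubicMonomial a c := by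
    intro a
    filter_upwards [Lp.coeFn_smul (tripleCoeff n a : ℂ) (memLp_cubicMonomial a).toLp,
      (memLp_cubicMonomial a).coeFn_toLp] with c h2 h3
    rw [tripleTerm, h2, Pi.smul_apply, h3, smul_eq_mul]
  filter_upwards [(memLp_truncatedField N n).coeFn_toLp,
    Lp.coeFn_smul (Real.pi : ℂ) (∑ a ∈ cube (N + 1), tripleTerm n a),
    Lp.coeFn_finsetSum (cube (N + 1)) (tripleTerm n), ae_all_iff.2 h1] with c h2 h3 h4 h5
  rw [h2, h3, Pi.smul_apply, h4, truncatedField_eq_sum h, smul_eq_mul, Finset.sum_apply]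
  simp only [h5]

theorem norm_toLp_truncatedField_le (N n : ℕ) :
    ‖(memLp_truncatedField N n).toLp‖ ≤ Real.pi * (monomialBound * 6) := by
  by_cases h : n ≤ N
  · rw [toLp_truncatedField h, norm_smul, Complex.norm_real, Real.norm_of_nonneg Real.pi_pos.le]
    exact mul_le_mul_of_nonneg_left (norm_sum_tripleTerm_le_const n _) Real.pi_pos.le
  · have : truncatedField N n = fun _ => 0 := by
      funext c
      rw [truncatedField, if_neg h]
    rw [Lp.norm_toLp, this, eLpNorm_zero', ENNReal.toReal_zero]
    exact mul_nonneg Real.pi_pos.le (mul_nonneg (Real.sqrt_nonneg _) (by norm_num))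

/-- The modes of the nonlinearity converge in mean square, with bounds uniform in the mode. -/
theorem exists_tendsto_truncatedField : ∃ τ : ℕ → (ℕ → ℂ) → ℂ, (∀ n, Measurable (τ n)) ∧
    (∃ C : ℝ≥0, (∀ N n, ∫⁻ c, ‖truncatedField N n c‖ₑ ^ 2 ∂gaussianSeq ≤ C) ∧
      ∀ n, ∫⁻ c, ‖τ n c‖ₑ ^ 2 ∂gaussianSeq ≤ C) ∧
    ∀ n, Tendsto (fun N => ∫⁻ c, ‖truncatedField N n c - τ n c‖ₑ ^ 2 ∂gaussianSeq) atTop (𝓝 0) := by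
  let L : ℕ → Lp ℂ 2 gaussianSeq := fun n => (Real.pi : ℂ) • ∑' a, tripleTerm n a
  have hL : ∀ n, Tendsto (fun N => (memLp_truncatedField N n).toLp) atTop (𝓝 (L n)) := by
    intro n
    have h1 : Tendsto (fun N => (Real.pi : ℂ) • ∑ a ∈ cube (N + 1), tripleTerm n a) atTop
        (𝓝 (L n)) := ((summable_tripleTerm n).hasSum.comp tendsto_cube).const_smul _
    refine h1.congr' ?_
    filter_upwards [eventually_ge_atTop n] with N hN
    exact (toLp_truncatedField hN).symm
  have hb : 0 ≤ Real.pi * (monomialBound * 6) :=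
    mul_nonneg Real.pi_pos.le (mul_nonneg (Real.sqrt_nonneg _) (by norm_num))
  have hsq : ∀ f : Lp ℂ 2 gaussianSeq, ∫⁻ c, ‖f c‖ₑ ^ 2 ∂gaussianSeq = ‖f‖ₑ ^ 2 := fun f => by
    rw [Lp.enorm_def, eLpNorm_two_sq]
  have hbd : ∀ f : Lp ℂ 2 gaussianSeq, ‖f‖ ≤ Real.pi * (monomialBound * 6) →
      ∫⁻ c, ‖f c‖ₑ ^ 2 ∂gaussianSeq ≤ ((Real.toNNReal (Real.pi * (monomialBound * 6)) ^ 2 : ℝ≥0) : ℝ≥0∞) := by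
    intro f hf
    rw [hsq, ENNReal.coe_pow]
    gcongr
    rw [← ofReal_norm]
    exact ENNReal.ofReal_le_ofReal hf
  refine ⟨fun n => L n, fun n => (Lp.stronglyMeasurable (L n)).measurable,
    ⟨Real.toNNReal (Real.pi * (monomialBound * 6)) ^ 2, fun N n => ?_, fun n => ?_⟩, fun n => ?_⟩
  · refine le_trans (le_of_eq ?_) (hbd _ (norm_toLp_truncatedField_le N n))
    refine lintegral_congr_ae ?_
    filter_upwards [(memLp_truncatedField N n).coeFn_toLp] with c hc
    rw [hc]
  · exact hbd _ (le_of_tendsto (hL n).norm (Eventually.of_forall fun N =>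
      norm_toLp_truncatedField_le N n))
  · have h1 : Tendsto (fun N => ‖(memLp_truncatedField N n).toLp - L n‖ₑ ^ 2) atTop (𝓝 0) := by
      have h2 := (tendsto_iff_norm_sub_tendsto_zero.1 (hL n))
      have h3 := (ENNReal.tendsto_ofReal h2)
      simp only [ofReal_norm, ENNReal.ofReal_zero] at h3
      simpa [Function.comp_def] using ((ENNReal.continuous_pow 2).tendsto 0).comp h3
    refine h1.congr fun N => ?_
    rw [← hsq]
    refine lintegral_congr_ae ?_
    filter_upwards [(memLp_truncatedField N n).coeFn_toLp,
      Lp.coeFn_sub (memLp_truncatedField N n).toLp (L n)] with c h2 h3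
    rw [h3, Pi.sub_apply, h2]

end Convergence

/-! ### Stationary solutions of the limiting system -/

section Limit

open scoped NNReal

theorem massCutoff_nonneg {ι : Type*} [Fintype ι] (ε : ℝ) (c : ι → ℂ) : 0 ≤ massCutoff ε c :=
  Real.smoothTransition.nonneg _

theorem massCutoff_le_one {ι : Type*} [Fintype ι] (ε : ℝ) (c : ι → ℂ) : massCutoff ε c ≤ 1 :=
  Real.smoothTransition.le_one _

theorem enorm_cutoffTruncatedField_le (ε : ℝ) (N n : ℕ) (c : ℕ → ℂ) :
    ‖cutoffTruncatedField ε N n c‖ₑ ≤ ‖truncatedField N n c‖ₑ := by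
  rw [cutoffTruncatedField, enorm_mul]
  refine mul_le_of_le_one_left zero_le ?_
  rw [← ofReal_norm, Complex.norm_real, Real.norm_of_nonneg (massCutoff_nonneg _ _)]
  exact ENNReal.ofReal_le_one.2 (massCutoff_le_one _ _)

theorem tendsto_cutoffTruncatedField (N n : ℕ) :
    Tendsto (fun k : ℕ => ∫⁻ c, ‖cutoffTruncatedField (1 / ((k : ℝ) + 1)) N n c
      - truncatedField N n c‖ₑ ∂gaussianSeq) atTop (𝓝 0) := by
  have hint : ∫⁻ c, ‖truncatedField N n c‖ₑ ∂gaussianSeq ≠ ∞ :=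
    (memLp_one_iff_integrable.1 ((memLp_truncatedField N n).mono_exponent
      (by norm_num : (1 : ℝ≥0∞) ≤ 2))).2.ne
  have hz : ∫⁻ _ : ℕ → ℂ, (0 : ℝ≥0∞) ∂gaussianSeq = 0 := by simp
  rw [← hz]
  refine tendsto_lintegral_of_dominated_convergence (fun c => 2 * ‖truncatedField N n c‖ₑ)
    (fun k => ((continuous_cutoffTruncatedField _ N n).sub
      (continuous_truncatedField N n)).measurable.enorm) (fun k => Eventually.of_forall fun c => ?_)
    ?_ (Eventually.of_forall fun c => ?_)
  · simp only [two_mul]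
    exact enorm_sub_le.trans (add_le_add_left (enorm_cutoffTruncatedField_le _ _ _ _) _)
  · rw [lintegral_const_mul' _ _ (by simp)]
    exact ENNReal.mul_ne_top (by simp) hint
  · obtain ⟨K, hK⟩ := exists_nat_ge (∑ i : Fin (N + 1), ‖c i‖ ^ 2)
    refine tendsto_const_nhds.congr' ?_
    filter_upwards [eventually_ge_atTop K] with k hk
    have h1 : massCutoff (1 / ((k : ℝ) + 1)) (fun i : Fin (N + 1) => c i) = 1 := by
      refine Real.smoothTransition.one_of_one_le ?_
      have h2 : 1 / ((k : ℝ) + 1) * ∑ i : Fin (N + 1), ‖c i‖ ^ 2 ≤ 1 := by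
        rw [one_div, inv_mul_le_iff₀ (by positivity)]
        have : (K : ℝ) ≤ k := by exact_mod_cast hk
        linarith
      linarith
    rw [cutoffTruncatedField, h1]
    simp

/-- The mass cutoff may be chosen to have an arbitrarily small effect on average. -/
theorem exists_cutoff (N : ℕ) : ∃ ε : ℝ, 0 < ε ∧ ∀ n, ∫⁻ c, ‖cutoffTruncatedField ε N n c
    - truncatedField N n c‖ₑ ∂gaussianSeq ≤ ENNReal.ofReal (1 / ((N : ℝ) + 1)) := by
  have hpos : 0 < ENNReal.ofReal (1 / ((N : ℝ) + 1)) := ENNReal.ofReal_pos.2 (by positivity)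
  have h : ∀ᶠ k : ℕ in atTop, ∀ n ∈ Finset.range (N + 1),
      ∫⁻ c, ‖cutoffTruncatedField (1 / ((k : ℝ) + 1)) N n c - truncatedField N n c‖ₑ ∂gaussianSeq
        ≤ ENNReal.ofReal (1 / ((N : ℝ) + 1)) :=
    (Finset.eventually_all _).2 fun n _ =>
      (tendsto_cutoffTruncatedField N n).eventually (ge_mem_nhds hpos)
  obtain ⟨k, hk⟩ := h.exists
  refine ⟨1 / ((k : ℝ) + 1), by positivity, fun n => ?_⟩
  by_cases hn : n ∈ Finset.range (N + 1)
  · exact hk n hn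
  · have : ∀ c, truncatedField N n c = 0 := fun c => by
      rw [truncatedField, if_neg (by simpa using hn)]
    simp [cutoffTruncatedField, this]

/-- The limiting system of the Hermite coefficients has a stationary solution, obtained as a limit
in law of stationary solutions of the truncated systems. -/
theorem exists_stationary_solution {τ : ℕ → (ℕ → ℂ) → ℂ} (hτ : ∀ n, Measurable (τ n))
    {C : ℝ≥0} (hC : ∀ N n, ∫⁻ c, ‖truncatedField N n c‖ₑ ^ 2 ∂gaussianSeq ≤ C)
    (hCτ : ∀ n, ∫⁻ c, ‖τ n c‖ₑ ^ 2 ∂gaussianSeq ≤ C)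
    (hlim : ∀ n, Tendsto (fun N => ∫⁻ c, ‖truncatedField N n c - τ n c‖ₑ ^ 2 ∂gaussianSeq)
      atTop (𝓝 0)) :
    ∃ ν : Measure PathSpace, IsProbabilityMeasure ν ∧
      (∀ t, ν.map (fun x => pathAt x t) = gaussianSeq) ∧
      ∀ n t, ∀ᵐ x ∂ν, defect (τ n) n t x = 0 := by
  choose ε hε hcut using exists_cutoff
  choose ν hprob hmarg heq using fun N => exists_stationary_truncated N (hε N)
  have hL1 : ∀ f : (ℕ → ℂ) → ℂ, AEStronglyMeasurable f gaussianSeq →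
      ∫⁻ c, ‖f c‖ₑ ∂gaussianSeq ≤ (∫⁻ c, ‖f c‖ₑ ^ 2 ∂gaussianSeq) ^ (1 / 2 : ℝ) := by
    intro f hf
    have h := eLpNorm_le_eLpNorm_of_exponent_le (μ := gaussianSeq) (f := f)
      (by norm_num : (1 : ℝ≥0∞) ≤ 2) hf
    rw [eLpNorm_one_eq_lintegral_enorm] at h
    rw [← eLpNorm_two_sq, ← ENNReal.rpow_natCast, ← ENNReal.rpow_mul]
    simpa using h
  refine exists_stationary_limit (fun N n => cutoffTruncatedField (ε N) N n)
    (fun N n => continuous_cutoffTruncatedField _ _ _) (fun n => ⟨C, fun N => ?_⟩) τ hτ (fun n => ?_)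
    (fun n => ?_) ν hmarg heq
  · refine (lintegral_mono fun c => ?_).trans (hC N n)
    gcongr
    exact enorm_cutoffTruncatedField_le _ _ _ _
  · refine ne_top_of_le_ne_top ?_ (hL1 _ (hτ n).aestronglyMeasurable)
    exact ENNReal.rpow_ne_top_of_nonneg (by norm_num) (ne_top_of_le_ne_top ENNReal.coe_ne_top (hCτ n))
  · have h1 : Tendsto (fun N : ℕ => ENNReal.ofReal (1 / ((N : ℝ) + 1))
        + (∫⁻ c, ‖truncatedField N n c - τ n c‖ₑ ^ 2 ∂gaussianSeq) ^ (1 / 2 : ℝ)) atTop (𝓝 0) := by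
      have h2 := ENNReal.tendsto_ofReal tendsto_one_div_add_atTop_nhds_zero_nat
      have h3 := (ENNReal.continuous_rpow_const (y := (1 / 2 : ℝ))).tendsto 0 |>.comp (hlim n)
      have h4 := h2.add h3
      simpa [Function.comp_def] using h4
    refine tendsto_of_tendsto_of_tendsto_of_le_of_le tendsto_const_nhds h1 (fun _ => zero_le)
      fun N => ?_
    have hm : Measurable fun c => truncatedField N n c - τ n c :=
      (continuous_truncatedField N n).measurable.sub (hτ n)
    refine le_trans ?_ (add_le_add (hcut N n) (hL1 _ hm.aestronglyMeasurable))
    rw [← lintegral_add_right _ hm.enorm]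
    refine lintegral_mono fun c => ?_
    refine le_trans (le_of_eq ?_) (enorm_add_le _ _)
    rw [sub_add_sub_cancel]

end Limit

/-! ### Ladder relations of the special Hermite functions -/

section Ladder

open scoped ComplexConjugate

/-- The terms with `m > min j k` vanish, so the sum may be extended. -/
theorem complexHermite_eq_sum (j k M : ℕ) (hM : min j k ≤ M) (z : ℂ) :
    complexHermite j k z = ∑ m ∈ Finset.range (M + 1),
      ((-1) ^ m * (m.factorial * j.choose m * k.choose m : ℂ)) * (z ^ (j - m) * conj z ^ (k - m)) := by
  refine Finset.sum_subset (Finset.range_subset_range.2 (by omega)) fun m _ hm => ?_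
  simp only [Finset.mem_range, not_lt] at hm
  rcases le_total j k with h | h
  · rw [Nat.choose_eq_zero_of_lt (show j < m by omega)]
    simp
  · rw [Nat.choose_eq_zero_of_lt (show k < m by omega)]
    simp

theorem complexHermite_zero_left (k : ℕ) (z : ℂ) : complexHermite 0 k z = conj z ^ k := by
  simp [complexHermite]

theorem conj_complexHermite (j k : ℕ) (z : ℂ) :
    conj (complexHermite j k z) = complexHermite k j z := by
  rw [complexHermite, complexHermite, min_comm, map_sum]
  refine Finset.sum_congr rfl fun m _ => ?_
  simp only [map_mul, map_pow, map_neg, map_one, map_natCast, Complex.conj_conj]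
  ring

theorem complexHermite_succ_left (j k : ℕ) (z : ℂ) :
    complexHermite (j + 1) k z = z * complexHermite j k z - k * complexHermite j (k - 1) z := by
  rw [complexHermite_eq_sum (j + 1) k (j + 1) (by omega), complexHermite_eq_sum j k (j + 1) (by omega),
    complexHermite_eq_sum j (k - 1) j (by omega), Finset.mul_sum, Finset.mul_sum,
    Finset.sum_range_succ' _ (j + 1), Finset.sum_range_succ' _ (j + 1), add_sub_right_comm,
    ← Finset.sum_sub_distrib]
  congr 1
  · refine Finset.sum_congr rfl fun m hm => ?_
    have hmj : m ≤ j := Nat.lt_succ_iff.1 (Finset.mem_range.1 hm)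
    rw [Nat.choose_succ_succ, show j + 1 - (m + 1) = j - m by omega,
      show k - 1 - m = k - (m + 1) by omega]
    have hk : ((m + 1 : ℕ) : ℂ) * (k.choose (m + 1) : ℂ) = k * ((k - 1).choose m : ℂ) := by
      cases k with
      | zero => simp
      | succ k =>
        have := Nat.add_one_mul_choose_eq k m
        simp only [Nat.add_sub_cancel]
        rw [mul_comm ((m + 1 : ℕ) : ℂ)]
        exact_mod_cast this.symm
    have hf : ((m + 1).factorial : ℂ) = (m + 1 : ℕ) * (m.factorial : ℂ) := by
      exact_mod_cast Nat.factorial_succ m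
    have hz : (j.choose (m + 1) : ℂ) * z ^ (j - m) = j.choose (m + 1) * (z * z ^ (j - (m + 1))) := by
      rcases Nat.lt_or_ge j (m + 1) with h | h
      · rw [Nat.choose_eq_zero_of_lt h]
        simp
      · rw [← pow_succ', show j - (m + 1) + 1 = j - m by omega]
    rw [hf]
    push_cast at hk ⊢
    linear_combination ((-1) ^ (m + 1) * ((m + 1) * (m.factorial : ℂ)) * k.choose (m + 1)
      * conj z ^ (k - (m + 1))) * hz + ((-1) ^ (m + 1) * (m.factorial : ℂ) * j.choose m
      * z ^ (j - m) * conj z ^ (k - (m + 1))) * hk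
  · simp [pow_succ]
    ring

theorem hasFDerivAt_complexHermite (j k : ℕ) (z : ℂ) :
    HasFDerivAt (complexHermite j k) ((j * complexHermite (j - 1) k z) • (1 : ℂ →L[ℝ] ℂ)
      + (k * complexHermite j (k - 1) z) • (Complex.conjCLE : ℂ →L[ℝ] ℂ)) z := by
  induction j generalizing k with
  | zero =>
    have h0 : complexHermite 0 k = fun z => conj z ^ k := funext fun z => complexHermite_zero_left k z
    have hc : HasFDerivAt (fun z : ℂ => conj z) (Complex.conjCLE : ℂ →L[ℝ] ℂ) z :=
      (Complex.conjCLE : ℂ →L[ℝ] ℂ).hasFDerivAt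
    have h := hc.pow k
    rw [h0]
    refine h.congr_fderiv ?_
    ext v
    simp [complexHermite_zero_left]
  | succ j ih =>
    have h0 : complexHermite (j + 1) k
        = fun z => z * complexHermite j k z - k * complexHermite j (k - 1) z :=
      funext fun z => complexHermite_succ_left j k z
    rw [h0]
    have h := ((hasFDerivAt_id (𝕜 := ℝ) z).mul (ih k)).sub ((ih (k - 1)).const_mul (k : ℂ))
    refine h.congr_fderiv ?_
    have e1 : (j : ℂ) * complexHermite j k z
        = j * (z * complexHermite (j - 1) k z - k * complexHermite (j - 1) (k - 1) z) := by
      cases j with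
      | zero => simp
      | succ j => rw [complexHermite_succ_left]; simp
    have e2 := complexHermite_succ_left j (k - 1) z
    ext v
    simp [e2]
    linear_combination (-v) * e1

theorem hasFDerivAt_gaussian (z : ℂ) :
    HasFDerivAt gaussian ((-(gaussian z * conj z / 2)) • (1 : ℂ →L[ℝ] ℂ)
      + (-(gaussian z * z / 2)) • (Complex.conjCLE : ℂ →L[ℝ] ℂ)) z := by
  have h1 : HasFDerivAt (fun z : ℂ => -‖z‖ ^ 2 / 2) (-(innerSL ℝ z)) z := by
    have h := ((hasStrictFDerivAt_norm_sq z).hasFDerivAt.const_mul (-(1 / 2) : ℝ))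
    refine (h.congr_of_eventuallyEq (Eventually.of_forall fun w => ?_)).congr_fderiv ?_
    · simp only []
      ring
    · ext v
      simp
      ring
  have h2 := h1.exp
  have h3 : HasFDerivAt gaussian _ z := Complex.ofRealCLM.hasFDerivAt.comp z h2
  refine h3.congr_fderiv ?_
  refine ContinuousLinearMap.ext fun v => ?_
  have hin : ((inner ℝ z v : ℝ) : ℂ) = (conj z * v + z * conj v) / 2 := by
    rw [Complex.inner]
    apply Complex.ext <;> simp <;> ring
  have hv : (Complex.ofRealCLM ∘L (Real.exp (-‖z‖ ^ 2 / 2) • -(innerSL ℝ) z)) v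
      = gaussian z * -((inner ℝ z v : ℝ) : ℂ) := by
    simp only [ContinuousLinearMap.comp_apply, smul_apply,
      neg_apply, innerSL_apply_apply, Complex.ofRealCLM_apply, smul_eq_mul,
      Complex.ofReal_mul, Complex.ofReal_neg]
    rfl
  rw [hv, hin]
  simp
  ring

/-- The normalization constant of the special Hermite functions. -/
def hermiteNorm (j k : ℕ) : ℂ := (((Real.sqrt (Real.pi * j.factorial * k.factorial))⁻¹ : ℝ) : ℂ)

theorem hermiteNorm_comm (j k : ℕ) : hermiteNorm j k = hermiteNorm k j := by
  rw [hermiteNorm, hermiteNorm, mul_right_comm]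

theorem hermiteNorm_succ_left (j k : ℕ) :
    hermiteNorm j k = (Real.sqrt (j + 1) : ℂ) * hermiteNorm (j + 1) k := by
  rw [hermiteNorm, hermiteNorm, ← Complex.ofReal_mul]
  congr 1
  have h : Real.pi * ((j + 1).factorial : ℝ) * k.factorial
      = (j + 1) * (Real.pi * j.factorial * k.factorial) := by
    rw [Nat.factorial_succ]
    push_cast
    ring
  rw [h, Real.sqrt_mul (show (0 : ℝ) ≤ j + 1 by positivity)]
  have h1 : Real.sqrt (j + 1) ≠ 0 := (Real.sqrt_pos.2 (by positivity)).ne'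
  rw [mul_inv, ← mul_assoc, mul_inv_cancel₀ h1, one_mul]

theorem hermiteNorm_pred_left (j k : ℕ) :
    j * hermiteNorm j k = (Real.sqrt j : ℂ) * hermiteNorm (j - 1) k := by
  cases j with
  | zero => simp
  | succ j =>
    rw [Nat.add_sub_cancel, hermiteNorm_succ_left j k, ← mul_assoc, ← Complex.ofReal_mul,
      show ((j + 1 : ℕ) : ℝ) = (j : ℝ) + 1 by push_cast; ring,
      Real.mul_self_sqrt (by positivity)]
    push_cast
    ring

theorem hermiteFun_eq (j k : ℕ) (z : ℂ) :
    hermiteFun j k z = hermiteNorm j k * (complexHermite j k z * gaussian z) :=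
  hermiteFun_apply j k z

theorem conj_hermiteFun (j k : ℕ) (z : ℂ) : conj (hermiteFun j k z) = hermiteFun k j z := by
  rw [hermiteFun_eq, hermiteFun_eq, map_mul, map_mul, conj_complexHermite, hermiteNorm_comm,
    hermiteNorm, gaussian, Complex.conj_ofReal, Complex.conj_ofReal]

theorem mul_hermiteFun (j k : ℕ) (z : ℂ) : z * hermiteFun j k z
    = Real.sqrt (j + 1) * hermiteFun (j + 1) k z + Real.sqrt k * hermiteFun j (k - 1) z := by
  simp only [hermiteFun_eq]
  have h1 := complexHermite_succ_left j k z
  have h2 := hermiteNorm_succ_left j k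
  have h3 := hermiteNorm_pred_left k j
  rw [hermiteNorm_comm k, hermiteNorm_comm (k - 1)] at h3
  linear_combination (-hermiteNorm j k * gaussian z) * h1
    + (complexHermite (j + 1) k z * gaussian z) * h2 + (complexHermite j (k - 1) z * gaussian z) * h3

theorem conj_mul_hermiteFun (j k : ℕ) (z : ℂ) : conj z * hermiteFun j k z
    = Real.sqrt (k + 1) * hermiteFun j (k + 1) z + Real.sqrt j * hermiteFun (j - 1) k z := by
  have h := congrArg conj (mul_hermiteFun k j z)
  simpa only [map_mul, map_add, conj_hermiteFun, Complex.conj_ofReal] using h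

theorem fderiv_hermiteFun (j k : ℕ) (z v : ℂ) : fderiv ℝ (hermiteFun j k) z v
    = v / 2 * (Real.sqrt j * hermiteFun (j - 1) k z - Real.sqrt (k + 1) * hermiteFun j (k + 1) z)
      + conj v / 2 *
        (Real.sqrt k * hermiteFun j (k - 1) z - Real.sqrt (j + 1) * hermiteFun (j + 1) k z) := by
  have h0 : (hermiteFun j k : ℂ → ℂ)
      = fun z => hermiteNorm j k * (complexHermite j k z * gaussian z) :=
    funext fun z => hermiteFun_eq j k z
  have h : HasFDerivAt (fun z => hermiteNorm j k * (complexHermite j k z * gaussian z)) _ z :=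
    ((hasFDerivAt_complexHermite j k z).mul (hasFDerivAt_gaussian z)).const_mul (hermiteNorm j k)
  rw [h0, h.fderiv]
  have c1 := mul_hermiteFun j k z
  have c2 := conj_mul_hermiteFun j k z
  have h3 := hermiteNorm_pred_left k j
  have h4 := hermiteNorm_pred_left j k
  rw [hermiteNorm_comm k, hermiteNorm_comm (k - 1)] at h3
  simp only [hermiteFun_eq] at c1 c2 ⊢
  simp
  linear_combination (-v / 2) * c2 - (conj v / 2) * c1
    + (v * complexHermite (j - 1) k z * gaussian z) * h4
    + (conj v * complexHermite j (k - 1) z * gaussian z) * h3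

end Ladder

/-! ### Ladder operators and orthonormality -/

section Operators

open scoped ComplexConjugate LineDeriv

/-- Multiplication by `z` on Schwartz functions. -/
def mulZ : 𝓢(ℂ, ℂ) →L[ℂ] 𝓢(ℂ, ℂ) := SchwartzMap.smulLeftCLM ℂ fun z : ℂ => z

/-- Multiplication by `conj z` on Schwartz functions. -/
def mulConjZ : 𝓢(ℂ, ℂ) →L[ℂ] 𝓢(ℂ, ℂ) := SchwartzMap.smulLeftCLM ℂ fun z : ℂ => conj z

/-- The operator `2 ∂_z = ∂₁ - i ∂₂` on Schwartz functions. -/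
def twoDz : 𝓢(ℂ, ℂ) →L[ℂ] 𝓢(ℂ, ℂ) :=
  LineDeriv.lineDerivOpCLM ℂ 𝓢(ℂ, ℂ) (1 : ℂ) - Complex.I • LineDeriv.lineDerivOpCLM ℂ 𝓢(ℂ, ℂ) Complex.I

/-- The operator `2 ∂_{conj z} = ∂₁ + i ∂₂` on Schwartz functions. -/
def twoDzBar : 𝓢(ℂ, ℂ) →L[ℂ] 𝓢(ℂ, ℂ) :=
  LineDeriv.lineDerivOpCLM ℂ 𝓢(ℂ, ℂ) (1 : ℂ) + Complex.I • LineDeriv.lineDerivOpCLM ℂ 𝓢(ℂ, ℂ) Complex.I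

/-- The harmonic oscillator `H = -Δ + |z|²` on Schwartz functions. -/
def harmonicOsc : 𝓢(ℂ, ℂ) →L[ℂ] 𝓢(ℂ, ℂ) := mulConjZ ∘L mulZ - twoDz ∘L twoDzBar

theorem mulZ_apply (f : 𝓢(ℂ, ℂ)) (z : ℂ) : mulZ f z = z * f z :=
  SchwartzMap.smulLeftCLM_apply_apply Function.HasTemperateGrowth.id' f z

theorem mulConjZ_apply (f : 𝓢(ℂ, ℂ)) (z : ℂ) : mulConjZ f z = conj z * f z :=
  SchwartzMap.smulLeftCLM_apply_apply
    (Complex.conjCLE.toContinuousLinearMap).hasTemperateGrowth f z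

theorem twoDz_apply (f : 𝓢(ℂ, ℂ)) (z : ℂ) :
    twoDz f z = fderiv ℝ f z 1 - Complex.I * fderiv ℝ f z Complex.I := by
  simp [twoDz, SchwartzMap.lineDerivOp_apply_eq_fderiv]

theorem twoDzBar_apply (f : 𝓢(ℂ, ℂ)) (z : ℂ) :
    twoDzBar f z = fderiv ℝ f z 1 + Complex.I * fderiv ℝ f z Complex.I := by
  simp [twoDzBar, SchwartzMap.lineDerivOp_apply_eq_fderiv]

theorem mulZ_hermiteFun (j k : ℕ) : mulZ (hermiteFun j k)
    = (Real.sqrt (j + 1) : ℂ) • hermiteFun (j + 1) k + (Real.sqrt k : ℂ) • hermiteFun j (k - 1) :=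
  SchwartzMap.ext fun z => by
    rw [mulZ_apply, mul_hermiteFun]
    rfl

theorem mulConjZ_hermiteFun (j k : ℕ) : mulConjZ (hermiteFun j k)
    = (Real.sqrt (k + 1) : ℂ) • hermiteFun j (k + 1) + (Real.sqrt j : ℂ) • hermiteFun (j - 1) k :=
  SchwartzMap.ext fun z => by
    rw [mulConjZ_apply, conj_mul_hermiteFun]
    rfl

theorem twoDz_hermiteFun (j k : ℕ) : twoDz (hermiteFun j k)
    = (Real.sqrt j : ℂ) • hermiteFun (j - 1) k - (Real.sqrt (k + 1) : ℂ) • hermiteFun j (k + 1) :=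
  SchwartzMap.ext fun z => by
    rw [twoDz_apply, fderiv_hermiteFun, fderiv_hermiteFun]
    simp
    linear_combination (-(1 / 2) * (Real.sqrt j * hermiteFun (j - 1) k z
      - Real.sqrt (k + 1) * hermiteFun j (k + 1) z) + 1 / 2 * (Real.sqrt k * hermiteFun j (k - 1) z
      - Real.sqrt (j + 1) * hermiteFun (j + 1) k z)) * Complex.I_sq

theorem twoDzBar_hermiteFun (j k : ℕ) : twoDzBar (hermiteFun j k)
    = (Real.sqrt k : ℂ) • hermiteFun j (k - 1) - (Real.sqrt (j + 1) : ℂ) • hermiteFun (j + 1) k :=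
  SchwartzMap.ext fun z => by
    rw [twoDzBar_apply, fderiv_hermiteFun, fderiv_hermiteFun]
    simp
    linear_combination (1 / 2 * (Real.sqrt j * hermiteFun (j - 1) k z
      - Real.sqrt (k + 1) * hermiteFun j (k + 1) z) - 1 / 2 * (Real.sqrt k * hermiteFun j (k - 1) z
      - Real.sqrt (j + 1) * hermiteFun (j + 1) k z)) * Complex.I_sq

theorem ofReal_sqrt_mul_self (n : ℕ) : (Real.sqrt n : ℂ) * Real.sqrt n = n := by
  rw [← Complex.ofReal_mul, Real.mul_self_sqrt (by positivity), Complex.ofReal_natCast]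

/-- The bilinear pairing `∫ f g` of Schwartz functions. -/
def pair (f g : 𝓢(ℂ, ℂ)) : ℂ := SchwartzMap.toTemperedDistributionCLM ℂ ℂ volume g f

theorem pair_eq_integral (f g : 𝓢(ℂ, ℂ)) : pair f g = ∫ z, f z * g z := by
  simp [pair, SchwartzMap.toTemperedDistributionCLM_apply_apply]

theorem pair_comm (f g : 𝓢(ℂ, ℂ)) : pair f g = pair g f := by
  simp only [pair_eq_integral, mul_comm]

theorem pair_smul_left (c : ℂ) (f g : 𝓢(ℂ, ℂ)) : pair (c • f) g = c * pair f g := by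
  simp [pair]

theorem pair_add_left (f₁ f₂ g : 𝓢(ℂ, ℂ)) : pair (f₁ + f₂) g = pair f₁ g + pair f₂ g :=
  map_add _ _ _

theorem pair_sub_left (f₁ f₂ g : 𝓢(ℂ, ℂ)) : pair (f₁ - f₂) g = pair f₁ g - pair f₂ g :=
  map_sub _ _ _

theorem pair_smul_right (c : ℂ) (f g : 𝓢(ℂ, ℂ)) : pair f (c • g) = c * pair f g := by
  rw [pair_comm, pair_smul_left, pair_comm]

theorem pair_add_right (f g₁ g₂ : 𝓢(ℂ, ℂ)) : pair f (g₁ + g₂) = pair f g₁ + pair f g₂ := by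
  rw [pair_comm, pair_add_left, pair_comm, pair_comm g₂]

theorem pair_sub_right (f g₁ g₂ : 𝓢(ℂ, ℂ)) : pair f (g₁ - g₂) = pair f g₁ - pair f g₂ := by
  rw [pair_comm, pair_sub_left, pair_comm, pair_comm g₂]

theorem pair_mulZ (f g : 𝓢(ℂ, ℂ)) : pair (mulZ f) g = pair f (mulZ g) := by
  simp only [pair_eq_integral, mulZ_apply]
  exact integral_congr_ae (Eventually.of_forall fun z => by ring)

theorem pair_mulConjZ (f g : 𝓢(ℂ, ℂ)) : pair (mulConjZ f) g = pair f (mulConjZ g) := by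
  simp only [pair_eq_integral, mulConjZ_apply]
  exact integral_congr_ae (Eventually.of_forall fun z => by ring)

theorem pair_lineDeriv (v : ℂ) (f g : 𝓢(ℂ, ℂ)) :
    pair (LineDeriv.lineDerivOpCLM ℂ 𝓢(ℂ, ℂ) v f) g
      = -pair f (LineDeriv.lineDerivOpCLM ℂ 𝓢(ℂ, ℂ) v g) := by
  have h := SchwartzMap.integral_mul_lineDerivOp_right_eq_neg_left (μ := volume) g f v
  simp only [pair_eq_integral, LineDeriv.lineDerivOpCLM_apply]
  simp only [mul_comm (g _)] at h
  rw [h]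
  simp only [mul_comm (f _)]

theorem pair_twoDz (f g : 𝓢(ℂ, ℂ)) : pair (twoDz f) g = -pair f (twoDz g) := by
  simp only [twoDz, sub_apply, smul_apply, pair_sub_left, pair_sub_right, pair_smul_left,
    pair_smul_right, pair_lineDeriv]
  ring

theorem pair_twoDzBar (f g : 𝓢(ℂ, ℂ)) : pair (twoDzBar f) g = -pair f (twoDzBar g) := by
  simp only [twoDzBar, add_apply, smul_apply, pair_add_left, pair_add_right, pair_smul_left,
    pair_smul_right, pair_lineDeriv]
  ring

/-- The special Hermite functions are eigenfunctions of the harmonic oscillator. -/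
theorem mulZ_mulConjZ_sub_hermiteFun (j k : ℕ) :
    mulZ (mulConjZ (hermiteFun j k)) - twoDzBar (twoDz (hermiteFun j k))
      = (2 * (j + k : ℂ) + 2) • hermiteFun j k := by
  have hk := ofReal_sqrt_mul_self (k + 1)
  push_cast at hk
  ext z
  cases j with
  | zero =>
    simp only [mulConjZ_hermiteFun, twoDz_hermiteFun, map_add, map_sub, map_smul, mulZ_hermiteFun,
      twoDzBar_hermiteFun, sub_apply, add_apply, smul_apply, smul_eq_mul, Nat.add_sub_cancel]
    push_cast
    simp only [Real.sqrt_zero, Complex.ofReal_zero]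
    linear_combination 2 * hermiteFun 0 k z * hk
  | succ j =>
    have hj := ofReal_sqrt_mul_self (j + 1)
    push_cast at hj
    simp only [mulConjZ_hermiteFun, twoDz_hermiteFun, map_add, map_sub, map_smul, mulZ_hermiteFun,
      twoDzBar_hermiteFun, sub_apply, add_apply, smul_apply, smul_eq_mul, Nat.add_sub_cancel]
    push_cast
    linear_combination 2 * hermiteFun (j + 1) k z * hk + 2 * hermiteFun (j + 1) k z * hj

theorem pair_harmonicOsc (f : 𝓢(ℂ, ℂ)) (j k : ℕ) :
    pair (harmonicOsc f) (hermiteFun j k) = (2 * (j + k : ℂ) + 2) * pair f (hermiteFun j k) := by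
  rw [← pair_smul_right, ← mulZ_mulConjZ_sub_hermiteFun]
  simp only [harmonicOsc, sub_apply, ContinuousLinearMap.comp_apply, pair_sub_left, pair_sub_right,
    pair_mulConjZ, pair_mulZ, pair_twoDz, pair_twoDzBar, neg_neg]

/-- `z - 2 ∂_{conj z}` raises the first index, and its transpose `z + 2 ∂_{conj z}` lowers the
second one. -/
theorem pair_hermiteFun_succ_left (j k k' j' : ℕ) :
    (Real.sqrt (j + 1) : ℂ) * pair (hermiteFun (j + 1) k) (hermiteFun k' j')
      = (Real.sqrt j' : ℂ) * pair (hermiteFun j k) (hermiteFun k' (j' - 1)) := by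
  have h : pair (mulZ (hermiteFun j k) - twoDzBar (hermiteFun j k)) (hermiteFun k' j')
      = pair (hermiteFun j k) (mulZ (hermiteFun k' j') + twoDzBar (hermiteFun k' j')) := by
    rw [pair_sub_left, pair_add_right, pair_mulZ, pair_twoDzBar, sub_neg_eq_add]
  simp only [mulZ_hermiteFun, twoDzBar_hermiteFun, pair_sub_left, pair_add_left, pair_add_right,
    pair_sub_right, pair_smul_left, pair_smul_right] at h
  linear_combination h / 2

theorem pair_hermiteFun_succ_right (j k k' j' : ℕ) :
    (Real.sqrt (k + 1) : ℂ) * pair (hermiteFun j (k + 1)) (hermiteFun k' j')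
      = (Real.sqrt k' : ℂ) * pair (hermiteFun j k) (hermiteFun (k' - 1) j') := by
  have h : pair (mulConjZ (hermiteFun j k) - twoDz (hermiteFun j k)) (hermiteFun k' j')
      = pair (hermiteFun j k) (mulConjZ (hermiteFun k' j') + twoDz (hermiteFun k' j')) := by
    rw [pair_sub_left, pair_add_right, pair_mulConjZ, pair_twoDz, sub_neg_eq_add]
  simp only [mulConjZ_hermiteFun, twoDz_hermiteFun, pair_sub_left, pair_add_left, pair_add_right,
    pair_sub_right, pair_smul_left, pair_smul_right] at h
  linear_combination h / 2

theorem ofReal_sqrt_succ_ne_zero (n : ℕ) : (Real.sqrt (n + 1) : ℂ) ≠ 0 := by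
  rw [Complex.ofReal_ne_zero]
  exact (Real.sqrt_pos.2 (by positivity)).ne'

theorem pair_hermiteFun_zero : pair (hermiteFun 0 0) (hermiteFun 0 0) = 1 := by
  have h : ∀ z, hermiteFun 0 0 z * hermiteFun 0 0 z
      = ((Real.pi⁻¹ * Real.exp (-1 * ‖z‖ ^ 2) : ℝ) : ℂ) := by
    intro z
    rw [hermiteFun_eq, complexHermite_zero_left, hermiteNorm, gaussian]
    have h1 : Real.exp (-1 * ‖z‖ ^ 2) = Real.exp (-‖z‖ ^ 2 / 2) * Real.exp (-‖z‖ ^ 2 / 2) := by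
      rw [← Real.exp_add]
      congr 1
      ring
    have h2 : Real.pi⁻¹ = (Real.sqrt (Real.pi * (0).factorial * (0).factorial))⁻¹
        * (Real.sqrt (Real.pi * (0).factorial * (0).factorial))⁻¹ := by
      rw [← mul_inv, Real.mul_self_sqrt (by positivity)]
      simp
    rw [h1, h2]
    push_cast
    ring
  rw [pair_eq_integral]
  simp only [h]
  rw [integral_complex_ofReal, integral_const_mul,
    GaussianFourier.integral_rexp_neg_mul_sq_norm (V := ℂ) (b := 1) one_pos]
  simp [Real.pi_ne_zero]

/-- The special Hermite functions are orthonormal, since `conj φ_{j,k} = φ_{k,j}`. -/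
theorem pair_hermiteFun (j k j' k' : ℕ) :
    pair (hermiteFun j k) (hermiteFun k' j') = if j = j' ∧ k = k' then 1 else 0 := by
  induction j generalizing j' with
  | succ j ih =>
    have h := pair_hermiteFun_succ_left j k k' j'
    cases j' with
    | zero =>
      simp only [Nat.cast_zero, Real.sqrt_zero, Complex.ofReal_zero, zero_mul] at h
      rw [(mul_eq_zero.1 h).resolve_left (ofReal_sqrt_succ_ne_zero j), if_neg (by omega)]
    | succ j' =>
      rw [Nat.add_sub_cancel, ih] at h
      by_cases hc : j = j' ∧ k = k'
      · rw [if_pos hc, mul_one] at h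
        rw [if_pos ⟨by omega, hc.2⟩]
        obtain ⟨rfl, -⟩ := hc
        push_cast at h
        exact mul_left_cancel₀ (ofReal_sqrt_succ_ne_zero j) (by rw [h, mul_one])
      · rw [if_neg hc, mul_zero] at h
        rw [(mul_eq_zero.1 h).resolve_left (ofReal_sqrt_succ_ne_zero j), if_neg (by omega)]
  | zero =>
    cases j' with
    | succ j' =>
      have h := pair_hermiteFun_succ_right k' j' 0 k
      simp only [Nat.cast_zero, Real.sqrt_zero, Complex.ofReal_zero, zero_mul] at h
      rw [pair_comm, (mul_eq_zero.1 h).resolve_left (ofReal_sqrt_succ_ne_zero j'),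
        if_neg (by omega)]
    | zero =>
      induction k generalizing k' with
      | succ k ih =>
        have h := pair_hermiteFun_succ_right 0 k k' 0
        cases k' with
        | zero =>
          simp only [Nat.cast_zero, Real.sqrt_zero, Complex.ofReal_zero, zero_mul] at h
          rw [(mul_eq_zero.1 h).resolve_left (ofReal_sqrt_succ_ne_zero k), if_neg (by omega)]
        | succ k' =>
          rw [Nat.add_sub_cancel, ih] at h
          by_cases hc : k = k'
          · subst hc
            simp only [and_self, if_true, mul_one] at h ⊢
            push_cast at h
            exact mul_left_cancel₀ (ofReal_sqrt_succ_ne_zero k) (by rw [h, mul_one])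
          · rw [if_neg (by omega), mul_zero] at h
            rw [(mul_eq_zero.1 h).resolve_left (ofReal_sqrt_succ_ne_zero k), if_neg (by omega)]
      | zero =>
        cases k' with
        | zero => simpa using pair_hermiteFun_zero
        | succ k' =>
          have h := pair_hermiteFun_succ_left k' 0 0 0
          simp only [Nat.cast_zero, Real.sqrt_zero, Complex.ofReal_zero, zero_mul] at h
          rw [pair_comm, (mul_eq_zero.1 h).resolve_left (ofReal_sqrt_succ_ne_zero k'),
            if_neg (by omega)]

end Operators

/-! ### Polynomial bounds of the special Hermite functions -/

section Bounds

open scoped ComplexConjugate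

theorem deriv_hermiteGenerating (k : ℕ) (z : ℂ) :
    deriv (fun s : ℂ => Complex.exp (s * z) * (conj z - s) ^ k)
      = fun s => z * (Complex.exp (s * z) * (conj z - s) ^ k)
        - k * (Complex.exp (s * z) * (conj z - s) ^ (k - 1)) := by
  funext s
  have h1 : HasDerivAt (fun s : ℂ => Complex.exp (s * z)) (Complex.exp (s * z) * z) s := by
    simpa using ((hasDerivAt_id s).mul_const z).cexp
  have h2 : HasDerivAt (fun s : ℂ => (conj z - s) ^ k) (k * (conj z - s) ^ (k - 1) * (-1)) s := by
    simpa using ((hasDerivAt_id s).const_sub (conj z)).fun_pow k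
  have h : HasDerivAt (fun s : ℂ => Complex.exp (s * z) * (conj z - s) ^ k) _ s := h1.mul h2
  rw [h.deriv]
  ring

/-- The complex Hermite polynomials have the generating function `exp (s z) (conj z - s) ^ k`. -/
theorem iteratedDeriv_hermiteGenerating (j k : ℕ) (z : ℂ) :
    iteratedDeriv j (fun s : ℂ => Complex.exp (s * z) * (conj z - s) ^ k) 0
      = complexHermite j k z := by
  induction j generalizing k with
  | zero => simp [complexHermite_zero_left]
  | succ j ih =>
    have hcd : ∀ k : ℕ, ContDiff ℂ j fun s : ℂ => Complex.exp (s * z) * (conj z - s) ^ k := fun k => by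
      fun_prop
    rw [iteratedDeriv_succ', deriv_hermiteGenerating,
      iteratedDeriv_fun_sub (contDiff_const.mul (hcd k)).contDiffAt
        (contDiff_const.mul (hcd (k - 1))).contDiffAt,
      iteratedDeriv_const_mul_field, iteratedDeriv_const_mul_field, ih, ih, complexHermite_succ_left]

/-- A weak form of Stirling's formula. -/
theorem factorial_mul_exp_le (j : ℕ) :
    (j.factorial : ℝ) * Real.exp (j + 1) ≤ Real.exp 1 * (j + 1) ^ (j + 1) := by
  induction j with
  | zero => simp
  | succ j ih =>
    have h1 : Real.exp 1 * (j + 1 : ℝ) ^ (j + 2) ≤ (j + 2 : ℝ) ^ (j + 2) := by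
      have h2 := Real.add_one_le_exp (-(1 / (j + 2 : ℝ)))
      have h3 : (-(1 / (j + 2 : ℝ))) + 1 = (j + 1) / (j + 2) := by
        field_simp
        ring
      rw [h3] at h2
      have h4 : ((j + 1) / (j + 2) : ℝ) ^ (j + 2) ≤ Real.exp (-1) := by
        calc ((j + 1) / (j + 2) : ℝ) ^ (j + 2) ≤ Real.exp (-(1 / (j + 2 : ℝ))) ^ (j + 2) := by gcongr
          _ = Real.exp (-1) := by
            rw [← Real.exp_nat_mul]
            congr 1
            push_cast
            field_simp
      rw [div_pow, div_le_iff₀ (by positivity)] at h4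
      calc Real.exp 1 * (j + 1 : ℝ) ^ (j + 2) ≤ Real.exp 1 * (Real.exp (-1) * (j + 2 : ℝ) ^ (j + 2)) := by
            gcongr
        _ = (j + 2 : ℝ) ^ (j + 2) := by
          rw [← mul_assoc, ← Real.exp_add]
          simp
    rw [Nat.factorial_succ]
    push_cast
    rw [Real.exp_add ((j : ℝ) + 1) 1]
    calc ((j : ℝ) + 1) * j.factorial * (Real.exp (j + 1) * Real.exp 1)
        = ((j : ℝ) + 1) * Real.exp 1 * (j.factorial * Real.exp (j + 1)) := by ring
      _ ≤ ((j : ℝ) + 1) * Real.exp 1 * (Real.exp 1 * (j + 1) ^ (j + 1)) := by gcongr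
      _ = Real.exp 1 * (Real.exp 1 * (j + 1 : ℝ) ^ (j + 2)) := by ring
      _ ≤ Real.exp 1 * (j + 2 : ℝ) ^ (j + 2) := by gcongr
      _ = _ := by
        rw [show (j : ℝ) + 1 + 1 = j + 2 by ring]

/-- Cauchy's estimate for the generating function on the circle of radius `√(j + 1)`. -/
theorem norm_complexHermite_sq_le (j k : ℕ) (z : ℂ) :
    ‖complexHermite j k z‖ ^ 2 * Real.exp (-‖z‖ ^ 2)
      ≤ (j.factorial : ℝ) ^ 2 / (j + 1) ^ j * (Real.exp (j + 1) * k.factorial) := by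
  set R := Real.sqrt (j + 1) with hR
  have hR0 : 0 < R := Real.sqrt_pos.2 (by positivity)
  have hR2 : R ^ 2 = j + 1 := Real.sq_sqrt (by positivity)
  set C := Real.sqrt (Real.exp (‖z‖ ^ 2 + R ^ 2) * k.factorial) with hC
  have hsph : ∀ s ∈ Metric.sphere (0 : ℂ) R, ‖Complex.exp (s * z) * (conj z - s) ^ k‖ ≤ C := by
    intro s hs
    have hs' : ‖s‖ = R := by simpa using hs
    refine Real.le_sqrt_of_sq_le ?_
    have hw : ‖conj z - s‖ ^ 2 = ‖z‖ ^ 2 + R ^ 2 - 2 * (s * z).re := by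
      rw [← hs', ← Complex.normSq_eq_norm_sq, ← Complex.normSq_eq_norm_sq, ← Complex.normSq_eq_norm_sq,
        Complex.normSq_apply, Complex.normSq_apply, Complex.normSq_apply]
      simp
      ring
    have hfac : (‖conj z - s‖ ^ 2) ^ k ≤ k.factorial * Real.exp (‖conj z - s‖ ^ 2) := by
      have := Real.pow_div_factorial_le_exp (‖conj z - s‖ ^ 2) (by positivity) k
      rwa [div_le_iff₀' (by positivity)] at this
    calc ‖Complex.exp (s * z) * (conj z - s) ^ k‖ ^ 2
        = Real.exp (2 * (s * z).re) * (‖conj z - s‖ ^ 2) ^ k := by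
          rw [norm_mul, norm_pow, Complex.norm_exp, mul_pow, ← Real.exp_nat_mul]
          push_cast
          ring
      _ ≤ Real.exp (2 * (s * z).re) * (k.factorial * Real.exp (‖conj z - s‖ ^ 2)) := by gcongr
      _ = Real.exp (2 * (s * z).re + ‖conj z - s‖ ^ 2) * k.factorial := by
          rw [Real.exp_add]
          ring
      _ = _ := by
          rw [hw]
          congr 2
          ring
  have hcauchy := Complex.norm_iteratedDeriv_le_of_forall_mem_sphere_norm_le j hR0
    (f := fun s : ℂ => Complex.exp (s * z) * (conj z - s) ^ k) (c := 0)
    (Differentiable.diffContOnCl (by fun_prop)) hsph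
  rw [iteratedDeriv_hermiteGenerating] at hcauchy
  have h1 : ‖complexHermite j k z‖ ^ 2 ≤ (j.factorial * C / R ^ j) ^ 2 := by gcongr
  have hC2 : C ^ 2 = Real.exp (‖z‖ ^ 2 + R ^ 2) * k.factorial := Real.sq_sqrt (by positivity)
  calc ‖complexHermite j k z‖ ^ 2 * Real.exp (-‖z‖ ^ 2)
      ≤ (j.factorial * C / R ^ j) ^ 2 * Real.exp (-‖z‖ ^ 2) := by gcongr
    _ = (j.factorial : ℝ) ^ 2 / (R ^ 2) ^ j * (Real.exp (‖z‖ ^ 2 + R ^ 2) * Real.exp (-‖z‖ ^ 2)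
          * k.factorial) := by
        rw [div_pow, mul_pow, hC2, ← pow_mul, ← pow_mul, mul_comm j 2]
        ring
    _ = _ := by
        rw [← Real.exp_add, hR2]
        congr 3
        ring_nf

/-- A crude bound for the special Hermite functions, uniform in `k`. -/
theorem norm_hermiteFun_le (j k : ℕ) (z : ℂ) : ‖hermiteFun j k z‖ ≤ 3 * (j + 1) := by
  have h0 := norm_complexHermite_sq_le j k z
  have hn : ‖hermiteNorm j k‖ ^ 2 = (Real.pi * j.factorial * k.factorial)⁻¹ := by
    rw [hermiteNorm, Complex.norm_real, Real.norm_of_nonneg (by positivity), inv_pow,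
      Real.sq_sqrt (by positivity)]
  have hg : ‖gaussian z‖ ^ 2 = Real.exp (-‖z‖ ^ 2) := by
    rw [gaussian, Complex.norm_real, Real.norm_of_nonneg (by positivity), ← Real.exp_nat_mul]
    congr 1
    push_cast
    ring
  have hsq : ‖hermiteFun j k z‖ ^ 2 ≤ 3 * (j + 1) := by
    calc ‖hermiteFun j k z‖ ^ 2
        = (Real.pi * j.factorial * k.factorial)⁻¹ *
          (‖complexHermite j k z‖ ^ 2 * Real.exp (-‖z‖ ^ 2)) := by
          rw [hermiteFun_eq, norm_mul, norm_mul, mul_pow, mul_pow, hn, hg]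
      _ ≤ (Real.pi * j.factorial * k.factorial)⁻¹ *
          ((j.factorial : ℝ) ^ 2 / (j + 1) ^ j * (Real.exp (j + 1) * k.factorial)) := by gcongr
      _ = Real.pi⁻¹ * ((j.factorial * Real.exp (j + 1)) / (j + 1) ^ j) := by
          field_simp
      _ ≤ Real.pi⁻¹ * ((Real.exp 1 * (j + 1) ^ (j + 1)) / (j + 1) ^ j) := by
          exact mul_le_mul_of_nonneg_left (div_le_div_of_nonneg_right (factorial_mul_exp_le j)
            (by positivity)) (by positivity)
      _ = Real.pi⁻¹ * Real.exp 1 * (j + 1) := by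
          rw [pow_succ]
          field_simp
      _ ≤ 1 * 3 * (j + 1) := by
          gcongr
          · exact inv_le_one_of_one_le₀ (by linarith [Real.pi_gt_three])
          · exact Real.exp_one_lt_three.le
      _ = 3 * (j + 1) := by ring
  have h1 : (1 : ℝ) ≤ 3 * (j + 1) := by
    have : (0 : ℝ) ≤ j := by positivity
    linarith
  nlinarith [norm_nonneg (hermiteFun j k z)]

/-- A derivative is a combination of `2 ∂_z` and `2 ∂_{conj z}`, whose action on the special Hermite
functions is known. -/
theorem seminorm_succ_right_le (k l : ℕ) (f : 𝓢(ℂ, ℂ)) :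
    SchwartzMap.seminorm ℂ k (l + 1) f
      ≤ SchwartzMap.seminorm ℂ k l (twoDz f) + SchwartzMap.seminorm ℂ k l (twoDzBar f) := by
  refine SchwartzMap.seminorm_le_bound ℂ k (l + 1) f
    (add_nonneg (apply_nonneg _ _) (apply_nonneg _ _)) fun x => ?_
  let L₁ : ℂ →L[ℝ] ℂ →L[ℝ] ℂ := (1 / 2 : ℝ) • ContinuousLinearMap.mul ℝ ℂ
  let L₂ : ℂ →L[ℝ] ℂ →L[ℝ] ℂ := (1 / 2 : ℝ) •
    (ContinuousLinearMap.mul ℝ ℂ).bilinearComp (ContinuousLinearMap.id ℝ ℂ)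
      (Complex.conjCLE : ℂ →L[ℝ] ℂ)
  have hL₁ : ‖L₁‖ ≤ 1 := ContinuousLinearMap.opNorm_le_bound₂ _ zero_le_one fun a b => by
    simp only [L₁, smul_apply, ContinuousLinearMap.mul_apply', norm_smul, norm_mul]
    norm_num
    nlinarith [mul_nonneg (norm_nonneg a) (norm_nonneg b)]
  have hL₂ : ‖L₂‖ ≤ 1 := ContinuousLinearMap.opNorm_le_bound₂ _ zero_le_one fun a b => by
    simp only [L₂, smul_apply, ContinuousLinearMap.bilinearComp_apply, ContinuousLinearMap.mul_apply',
      norm_smul, norm_mul]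
    norm_num
    nlinarith [mul_nonneg (norm_nonneg a) (norm_nonneg b)]
  have hf : fderiv ℝ f = (L₁ ∘ twoDz f) + (L₂ ∘ twoDzBar f) := by
    funext y
    refine ContinuousLinearMap.ext fun v => ?_
    have hv : v = v.re • (1 : ℂ) + v.im • Complex.I := by
      simp
    have hlin : fderiv ℝ f y v = v.re * fderiv ℝ f y 1 + v.im * fderiv ℝ f y Complex.I := by
      conv_lhs => rw [hv]
      rw [map_add, map_smul, map_smul]
      rfl
    have hvc : conj v = v.re - v.im * Complex.I := by
      apply Complex.ext <;> simp
    have hvv : v = v.re + v.im * Complex.I := (Complex.re_add_im v).symm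
    simp only [Pi.add_apply, Function.comp_apply, L₁, L₂, add_apply, smul_apply,
      ContinuousLinearMap.mul_apply', ContinuousLinearMap.bilinearComp_apply, twoDz_apply,
      twoDzBar_apply, ContinuousLinearMap.id_apply, hlin, Complex.real_smul]
    change _ = _ + _ * (_ * conj v)
    rw [hvc]
    nth_rewrite 3 [hvv]
    push_cast
    linear_combination ((v.im : ℂ) * fderiv ℝ f y Complex.I) * Complex.I_sq
  have hsm : ∀ g : 𝓢(ℂ, ℂ), ContDiffAt ℝ l g x := fun g => (g.smooth l).contDiffAt
  rw [← norm_iteratedFDeriv_fderiv, hf, iteratedFDeriv_add_apply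
    (L₁.contDiff.contDiffAt.comp x (hsm _)) (L₂.contDiff.contDiffAt.comp x (hsm _))]
  have e1 := L₁.norm_iteratedFDeriv_comp_left (hsm (twoDz f)) le_rfl
  have e2 := L₂.norm_iteratedFDeriv_comp_left (hsm (twoDzBar f)) le_rfl
  calc ‖x‖ ^ k * ‖iteratedFDeriv ℝ l (L₁ ∘ twoDz f) x + iteratedFDeriv ℝ l (L₂ ∘ twoDzBar f) x‖
      ≤ ‖x‖ ^ k * (1 * ‖iteratedFDeriv ℝ l (twoDz f) x‖ + 1 * ‖iteratedFDeriv ℝ l (twoDzBar f) x‖) := by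
        gcongr
        refine (norm_add_le _ _).trans (add_le_add (e1.trans ?_) (e2.trans ?_)) <;> gcongr
    _ = ‖x‖ ^ k * ‖iteratedFDeriv ℝ l (twoDz f) x‖
        + ‖x‖ ^ k * ‖iteratedFDeriv ℝ l (twoDzBar f) x‖ := by ring
    _ ≤ _ := add_le_add (SchwartzMap.le_seminorm ℂ k l _ x) (SchwartzMap.le_seminorm ℂ k l _ x)

theorem seminorm_succ_left_le (k : ℕ) (f : 𝓢(ℂ, ℂ)) :
    SchwartzMap.seminorm ℂ (k + 1) 0 f ≤ SchwartzMap.seminorm ℂ k 0 (mulZ f) := by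
  refine SchwartzMap.seminorm_le_bound ℂ (k + 1) 0 f (apply_nonneg _ _) fun x => ?_
  have h := SchwartzMap.le_seminorm ℂ k 0 (mulZ f) x
  rw [norm_iteratedFDeriv_zero, mulZ_apply, norm_mul] at h
  rw [norm_iteratedFDeriv_zero, pow_succ, mul_assoc]
  exact h

/-- The norm of a combination of two neighbours of the Hermite function of index `(i, j)`, with
coefficients as in the ladder relations, is polynomially bounded. -/
theorem seminorm_ladder_le {p : Seminorm ℂ 𝓢(ℂ, ℂ)} {C : ℝ} {M : ℕ} (hC : 0 ≤ C)
    (h : ∀ i j : ℕ, p (hermiteFun i j) ≤ C * ((i : ℝ) + j + 1) ^ M) {i j i₁ j₁ i₂ j₂ : ℕ} {a b : ℝ}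
    (ha : |a| ≤ (i : ℝ) + j + 1) (hb : |b| ≤ (i : ℝ) + j + 1) (h₁ : i₁ + j₁ ≤ i + j + 1)
    (h₂ : i₂ + j₂ ≤ i + j + 1) :
    p ((a : ℂ) • hermiteFun i₁ j₁ + (b : ℂ) • hermiteFun i₂ j₂)
      ≤ 2 ^ (M + 1) * C * ((i : ℝ) + j + 1) ^ (M + 1) := by
  have key : ∀ i₁ j₁ : ℕ, ∀ a : ℝ, i₁ + j₁ ≤ i + j + 1 → |a| ≤ (i : ℝ) + j + 1 →
      p ((a : ℂ) • hermiteFun i₁ j₁) ≤ 2 ^ M * C * ((i : ℝ) + j + 1) ^ (M + 1) := by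
    intro i₁ j₁ a h₁ ha
    have h₁' : (i₁ : ℝ) + j₁ ≤ i + j + 1 := by exact_mod_cast h₁
    have h0 : (0 : ℝ) ≤ i + j := by positivity
    rw [map_smul_eq_mul, Complex.norm_real, Real.norm_eq_abs]
    calc |a| * p (hermiteFun i₁ j₁) ≤ ((i : ℝ) + j + 1) * (C * ((i₁ : ℝ) + j₁ + 1) ^ M) :=
          mul_le_mul ha (h i₁ j₁) (apply_nonneg _ _) (by positivity)
      _ ≤ ((i : ℝ) + j + 1) * (C * (2 * ((i : ℝ) + j + 1)) ^ M) := by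
          gcongr
          linarith
      _ = _ := by
          rw [mul_pow]
          ring
  calc _ ≤ p ((a : ℂ) • hermiteFun i₁ j₁) + p ((b : ℂ) • hermiteFun i₂ j₂) := map_add_le_add _ _ _
    _ ≤ _ := add_le_add (key i₁ j₁ a h₁ ha) (key i₂ j₂ b h₂ hb)
    _ = _ := by ring

theorem abs_sqrt_le_add_one {x y : ℝ} (hx : 0 ≤ x) (h : x ≤ y) (hy : 1 ≤ y) : |Real.sqrt x| ≤ y := by
  rw [abs_of_nonneg (Real.sqrt_nonneg x)]
  exact Real.sqrt_le_iff.2 ⟨by linarith, by nlinarith⟩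

/-- The Schwartz seminorms of the special Hermite functions are polynomially bounded. -/
theorem exists_seminorm_hermiteFun_le (k l : ℕ) : ∃ (C : ℝ) (M : ℕ), 0 ≤ C ∧ ∀ i j : ℕ,
    SchwartzMap.seminorm ℂ k l (hermiteFun i j) ≤ C * ((i : ℝ) + j + 1) ^ M := by
  have hb : ∀ i j : ℕ, (1 : ℝ) ≤ (i : ℝ) + j + 1 := fun i j => by
    have : (0 : ℝ) ≤ i + j := by positivity
    linarith
  have s1 : ∀ i j : ℕ, |Real.sqrt ((i : ℝ) + 1)| ≤ (i : ℝ) + j + 1 := fun i j =>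
    abs_sqrt_le_add_one (by positivity) (by linarith [(Nat.cast_nonneg j : (0 : ℝ) ≤ j)]) (hb i j)
  have s2 : ∀ i j : ℕ, |Real.sqrt ((j : ℝ) + 1)| ≤ (i : ℝ) + j + 1 := fun i j =>
    abs_sqrt_le_add_one (by positivity) (by linarith [(Nat.cast_nonneg i : (0 : ℝ) ≤ i)]) (hb i j)
  have s3 : ∀ i j : ℕ, |Real.sqrt (i : ℝ)| ≤ (i : ℝ) + j + 1 := fun i j =>
    abs_sqrt_le_add_one (by positivity) (by linarith [(Nat.cast_nonneg j : (0 : ℝ) ≤ j)]) (hb i j)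
  have s4 : ∀ i j : ℕ, |Real.sqrt (j : ℝ)| ≤ (i : ℝ) + j + 1 := fun i j =>
    abs_sqrt_le_add_one (by positivity) (by linarith [(Nat.cast_nonneg i : (0 : ℝ) ≤ i)]) (hb i j)
  induction l generalizing k with
  | zero =>
    induction k with
    | zero =>
      refine ⟨3, 1, by norm_num, fun i j => ?_⟩
      refine SchwartzMap.seminorm_le_bound ℂ 0 0 _ (by positivity) fun x => ?_
      rw [norm_iteratedFDeriv_zero, pow_zero, one_mul, pow_one]
      refine (norm_hermiteFun_le i j x).trans ?_
      have : (0 : ℝ) ≤ j := by positivity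
      linarith
    | succ k ih =>
      obtain ⟨C, M, hC, h⟩ := ih
      refine ⟨2 ^ (M + 1) * C, M + 1, by positivity, fun i j => ?_⟩
      refine (seminorm_succ_left_le k _).trans ?_
      rw [mulZ_hermiteFun]
      exact seminorm_ladder_le hC h (s1 i j) (s4 i j) (by omega) (by omega)
  | succ l ih =>
    obtain ⟨C, M, hC, h⟩ := ih k
    refine ⟨2 * (2 ^ (M + 1) * C), M + 1, by positivity, fun i j => ?_⟩
    refine (seminorm_succ_right_le k l _).trans ?_
    rw [two_mul, add_mul]
    refine add_le_add ?_ ?_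
    · rw [twoDz_hermiteFun, sub_eq_add_neg, ← neg_smul, ← Complex.ofReal_neg]
      exact seminorm_ladder_le hC h (s3 i j) (by rw [abs_neg]; exact s2 i j) (by omega) (by omega)
    · rw [twoDzBar_hermiteFun, sub_eq_add_neg, ← neg_smul, ← Complex.ofReal_neg]
      exact seminorm_ladder_le hC h (s4 i j) (by rw [abs_neg]; exact s1 i j) (by omega) (by omega)

/-- The Hermite coefficients of a Schwartz function decay rapidly. -/
theorem exists_norm_pair_hermiteFun_le (f : 𝓢(ℂ, ℂ)) (M : ℕ) : ∃ C : ℝ, 0 ≤ C ∧ ∀ i j : ℕ,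
    ((i : ℝ) + j + 1) ^ M * ‖pair f (hermiteFun i j)‖ ≤ C := by
  have hpow : ∀ M i j, pair (harmonicOsc^[M] f) (hermiteFun i j)
      = (2 * (i + j : ℂ) + 2) ^ M * pair f (hermiteFun i j) := by
    intro M i j
    induction M with
    | zero => simp
    | succ M ih =>
      rw [Function.iterate_succ_apply', pair_harmonicOsc, ih]
      ring
  -- one more power of `H` than needed compensates the factor `i + 1` in the bound of `φ_{i,j}`
  set g := harmonicOsc^[M + 1] f with hg
  refine ⟨3 * ∫ z, ‖g z‖, by positivity, fun i j => ?_⟩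
  have h1 : ‖pair g (hermiteFun i j)‖ ≤ (3 * (i + 1)) * ∫ z, ‖g z‖ := by
    rw [pair_eq_integral, ← integral_const_mul]
    refine norm_integral_le_of_norm_le (g.integrable.norm.const_mul _)
      (Eventually.of_forall fun z => ?_)
    rw [norm_mul, mul_comm]
    exact mul_le_mul_of_nonneg_right (norm_hermiteFun_le i j z) (norm_nonneg _)
  have hB : (0 : ℝ) < (i : ℝ) + j + 1 := by positivity
  have hn : ‖(2 * (i + j : ℂ) + 2)‖ = 2 * ((i : ℝ) + j + 1) := by
    have : (2 * (i + j : ℂ) + 2) = ((2 * ((i : ℝ) + j + 1) : ℝ) : ℂ) := by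
      push_cast
      ring
    rw [this, Complex.norm_real, Real.norm_of_nonneg (by positivity)]
  rw [hg, hpow, norm_mul, norm_pow, hn] at h1
  have h2 : ((i : ℝ) + j + 1) * (((i : ℝ) + j + 1) ^ M * ‖pair f (hermiteFun i j)‖)
      ≤ ((i : ℝ) + j + 1) * (3 * ∫ z, ‖g z‖) := by
    have hI : (0 : ℝ) ≤ ∫ z, ‖g z‖ := by positivity
    calc ((i : ℝ) + j + 1) * (((i : ℝ) + j + 1) ^ M * ‖pair f (hermiteFun i j)‖)
        = ((i : ℝ) + j + 1) ^ (M + 1) * ‖pair f (hermiteFun i j)‖ := by ring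
      _ ≤ (2 * ((i : ℝ) + j + 1)) ^ (M + 1) * ‖pair f (hermiteFun i j)‖ := by
          gcongr
          linarith
      _ ≤ (3 * (i + 1)) * ∫ z, ‖g z‖ := h1
      _ ≤ (3 * ((i : ℝ) + j + 1)) * ∫ z, ‖g z‖ := by
          gcongr
          linarith [(Nat.cast_nonneg j : (0 : ℝ) ≤ j)]
      _ = _ := by ring
  exact le_of_mul_le_mul_left h2 hB

end Bounds

/-! ### Completeness of the special Hermite functions -/

section Completeness

open scoped ComplexConjugate FourierTransform

theorem integrable_mul_schwartz {f : ℂ → ℂ} (hf : Continuous f) {C : ℝ} (hC : ∀ z, ‖f z‖ ≤ C)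
    (g : 𝓢(ℂ, ℂ)) : Integrable fun z => f z * g z :=
  g.integrable.bdd_mul hf.aestronglyMeasurable (Eventually.of_forall hC)

theorem mulZ_mem_span {g : 𝓢(ℂ, ℂ)}
    (hg : g ∈ Submodule.span ℂ (Set.range fun q : ℕ × ℕ => hermiteFun q.1 q.2)) :
    mulZ g ∈ Submodule.span ℂ (Set.range fun q : ℕ × ℕ => hermiteFun q.1 q.2) := by
  have hφ : ∀ i j, hermiteFun i j ∈ Submodule.span ℂ (Set.range fun q : ℕ × ℕ => hermiteFun q.1 q.2) :=
    fun i j => Submodule.subset_span ⟨(i, j), rfl⟩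
  induction hg using Submodule.span_induction with
  | mem x hx =>
    obtain ⟨q, rfl⟩ := hx
    rw [mulZ_hermiteFun]
    exact Submodule.add_mem _ (Submodule.smul_mem _ _ (hφ _ _)) (Submodule.smul_mem _ _ (hφ _ _))
  | zero => simp
  | add x y _ _ hx hy =>
    rw [map_add]
    exact Submodule.add_mem _ hx hy
  | smul a x _ hx =>
    rw [map_smul]
    exact Submodule.smul_mem _ _ hx

theorem mulConjZ_mem_span {g : 𝓢(ℂ, ℂ)}
    (hg : g ∈ Submodule.span ℂ (Set.range fun q : ℕ × ℕ => hermiteFun q.1 q.2)) :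
    mulConjZ g ∈ Submodule.span ℂ (Set.range fun q : ℕ × ℕ => hermiteFun q.1 q.2) := by
  have hφ : ∀ i j, hermiteFun i j ∈ Submodule.span ℂ (Set.range fun q : ℕ × ℕ => hermiteFun q.1 q.2) :=
    fun i j => Submodule.subset_span ⟨(i, j), rfl⟩
  induction hg using Submodule.span_induction with
  | mem x hx =>
    obtain ⟨q, rfl⟩ := hx
    rw [mulConjZ_hermiteFun]
    exact Submodule.add_mem _ (Submodule.smul_mem _ _ (hφ _ _)) (Submodule.smul_mem _ _ (hφ _ _))
  | zero => simp
  | add x y _ _ hx hy =>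
    rw [map_add]
    exact Submodule.add_mem _ hx hy
  | smul a x _ hx =>
    rw [map_smul]
    exact Submodule.smul_mem _ _ hx

/-- Polynomials times the Gaussian belong to the span of the special Hermite functions; only powers
of real linear forms are needed. -/
theorem exists_mem_span_inner_pow (ξ : ℂ) (n : ℕ) :
    ∃ g ∈ Submodule.span ℂ (Set.range fun q : ℕ × ℕ => hermiteFun q.1 q.2),
      ∀ z, g z = (inner ℝ z ξ : ℝ) ^ n * hermiteFun 0 0 z := by
  induction n with
  | zero => exact ⟨hermiteFun 0 0, Submodule.subset_span ⟨(0, 0), rfl⟩, fun z => by simp⟩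
  | succ n ih =>
    obtain ⟨g, hg, hgz⟩ := ih
    refine ⟨(conj ξ / 2) • mulZ g + (ξ / 2) • mulConjZ g, Submodule.add_mem _
      (Submodule.smul_mem _ _ (mulZ_mem_span hg)) (Submodule.smul_mem _ _ (mulConjZ_mem_span hg)),
      fun z => ?_⟩
    have hin : ((inner ℝ z ξ : ℝ) : ℂ) = (conj ξ * z + ξ * conj z) / 2 := by
      rw [Complex.inner]
      apply Complex.ext <;> simp
      ring
    rw [add_apply, smul_apply, smul_apply, mulZ_apply, mulConjZ_apply, hgz, pow_succ]
    nth_rewrite 4 [hin]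
    simp only [smul_eq_mul]
    ring

theorem hermiteFun_zero_zero (z : ℂ) :
    hermiteFun 0 0 z = hermiteNorm 0 0 * gaussian z := by
  rw [hermiteFun_eq, complexHermite_zero_left, pow_zero, one_mul]

theorem norm_gaussian (z : ℂ) : ‖gaussian z‖ = Real.exp (-‖z‖ ^ 2 / 2) := by
  rw [gaussian, Complex.norm_real, Real.norm_of_nonneg (by positivity)]

theorem integrable_exp_mul_gaussian (K : ℝ) :
    Integrable fun z : ℂ => Real.exp (K * ‖z‖) * ‖gaussian z‖ := by
  have hint : Integrable fun z : ℂ => Real.exp (-(1 / 4) * ‖z‖ ^ 2) := by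
    refine Integrable.of_integral_ne_zero ?_
    rw [GaussianFourier.integral_rexp_neg_mul_sq_norm (V := ℂ) (b := 1 / 4) (by norm_num)]
    simp [Real.pi_ne_zero]
  refine (hint.const_mul (Real.exp (K ^ 2))).mono' ?_ (Eventually.of_forall fun z => ?_)
  · have : Continuous gaussian := gaussianSchwartz.continuous
    fun_prop
  · rw [norm_gaussian, Real.norm_of_nonneg (by positivity), ← Real.exp_add, ← Real.exp_add]
    refine Real.exp_le_exp.2 ?_
    nlinarith [sq_nonneg (K - ‖z‖ / 2)]

/-- A bounded continuous function orthogonal to all the special Hermite functions vanishes: the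
Fourier transform of its product with the Gaussian has vanishing Taylor coefficients. -/
theorem eq_zero_of_integral_mul_hermiteFun_eq_zero {f : ℂ → ℂ} (hf : Continuous f) {C : ℝ}
    (hC : ∀ z, ‖f z‖ ≤ C) (h : ∀ j k, ∫ z, f z * hermiteFun j k z = 0) (z : ℂ) : f z = 0 := by
  have hspan : ∀ g ∈ Submodule.span ℂ (Set.range fun q : ℕ × ℕ => hermiteFun q.1 q.2),
      ∫ z, f z * g z = 0 := by
    intro g hg
    induction hg using Submodule.span_induction with
    | mem x hx =>
      obtain ⟨q, rfl⟩ := hx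
      exact h _ _
    | zero => simp
    | add x y _ _ hx hy =>
      simp only [add_apply, mul_add]
      rw [integral_add (integrable_mul_schwartz hf hC x) (integrable_mul_schwartz hf hC y), hx, hy,
        add_zero]
    | smul a x _ hx =>
      simp only [smul_apply, smul_eq_mul, mul_left_comm _ a]
      rw [integral_const_mul, hx, mul_zero]
  set F : ℂ → ℂ := fun z => f z * hermiteFun 0 0 z with hF
  have hFc : Continuous F := hf.mul (hermiteFun 0 0).continuous
  have hFi : Integrable F := integrable_mul_schwartz hf hC _
  have hC0 : 0 ≤ C := (norm_nonneg _).trans (hC 0)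
  -- expand the exponential: all the moments of `F` vanish
  have hfour : 𝓕 F = 0 := by
    funext ξ
    rw [Real.fourier_eq']
    have hsum : HasSum (fun n : ℕ => ∫ v, ((-2 * Real.pi * Complex.I) ^ n / n.factorial)
        * (f v * ((inner ℝ v ξ : ℝ) ^ n * hermiteFun 0 0 v)))
        (∫ v, Complex.exp (((-2 * Real.pi * inner ℝ v ξ : ℝ) : ℂ) * Complex.I) • F v) := by
      refine hasSum_integral_of_dominated_convergence
        (fun n v => (C * ‖hermiteNorm 0 0‖ * ‖gaussian v‖) *
          ((2 * Real.pi * ‖ξ‖ * ‖v‖) ^ n / n.factorial)) (fun n => ?_)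
        (fun n => Eventually.of_forall fun v => ?_) (Eventually.of_forall fun v => ?_) ?_
        (Eventually.of_forall fun v => ?_)
      · refine Continuous.aestronglyMeasurable ?_
        have := (hermiteFun 0 0).continuous
        fun_prop
      · rw [hermiteFun_zero_zero, norm_mul, norm_mul, norm_mul, norm_mul, norm_pow, norm_div, norm_pow,
          Complex.norm_real, Real.norm_eq_abs, Complex.norm_natCast]
        have e1 : ‖(-2 * Real.pi * Complex.I : ℂ)‖ = 2 * Real.pi := by
          simp [abs_of_pos Real.pi_pos]
        rw [e1]
        have e2 : |inner ℝ v ξ| ≤ ‖v‖ * ‖ξ‖ := abs_real_inner_le_norm v ξ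
        calc (2 * Real.pi) ^ n / n.factorial * (‖f v‖ * (|inner ℝ v ξ| ^ n
              * (‖hermiteNorm 0 0‖ * ‖gaussian v‖)))
            ≤ (2 * Real.pi) ^ n / n.factorial * (C * ((‖v‖ * ‖ξ‖) ^ n
              * (‖hermiteNorm 0 0‖ * ‖gaussian v‖))) := by
              gcongr
              exact hC v
          _ = _ := by
              rw [mul_pow, mul_pow, mul_pow]
              ring
      · exact (Real.summable_pow_div_factorial _).mul_left _
      · simp only [tsum_mul_left]
        have e : ∀ v : ℂ, ∑' n : ℕ, (2 * Real.pi * ‖ξ‖ * ‖v‖) ^ n / n.factorial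
            = Real.exp (2 * Real.pi * ‖ξ‖ * ‖v‖) := fun v => by
          rw [Real.exp_eq_exp_ℝ, NormedSpace.exp_eq_tsum_div]
        simp only [e]
        refine ((integrable_exp_mul_gaussian (2 * Real.pi * ‖ξ‖)).const_mul
          (C * ‖hermiteNorm 0 0‖)).congr (Eventually.of_forall fun v => ?_)
        simp only []
        ring
      · have e := NormedSpace.expSeries_div_hasSum_exp
          (((-2 * Real.pi * inner ℝ v ξ : ℝ) : ℂ) * Complex.I)
        rw [← Complex.exp_eq_exp_ℂ] at e
        refine (e.mul_right (F v)).congr_fun ?_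
        intro n
        simp only [hF]
        push_cast
        ring
    have hzero : ∀ n : ℕ, ∫ v, ((-2 * Real.pi * Complex.I) ^ n / n.factorial)
        * (f v * ((inner ℝ v ξ : ℝ) ^ n * hermiteFun 0 0 v)) = 0 := by
      intro n
      obtain ⟨g, hg, hgz⟩ := exists_mem_span_inner_pow ξ n
      rw [integral_const_mul]
      have := hspan g hg
      simp only [hgz] at this
      rw [this, mul_zero]
    simp only [hzero] at hsum
    exact hsum.unique hasSum_zero
  have hinv := hFc.fourierInv_fourier_eq hFi (by rw [hfour]; exact integrable_zero _ _ _)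
  have hFz : F z = 0 := by
    rw [← hinv, hfour, Real.fourierInv_eq']
    simp
  rw [hF] at hFz
  refine (mul_eq_zero.1 hFz).resolve_right ?_
  rw [hermiteFun_zero_zero]
  refine mul_ne_zero ?_ ?_
  · rw [hermiteNorm, Complex.ofReal_ne_zero]
    exact inv_ne_zero (Real.sqrt_pos.2 (by positivity)).ne'
  · rw [gaussian, Complex.ofReal_ne_zero]
    exact (Real.exp_pos _).ne'

theorem summable_inv_pow_four : Summable fun q : ℕ × ℕ => (1 : ℝ) / ((q.1 : ℝ) + q.2 + 1) ^ 4 := by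
  have h1 : Summable fun n : ℕ => (1 : ℝ) / ((n : ℝ) + 1) ^ 2 := by
    have := (summable_nat_add_iff 1).2 (Real.summable_one_div_nat_pow.2 (one_lt_two))
    simpa using this
  refine Summable.of_nonneg_of_le (fun q => by positivity) (fun q => ?_)
    (h1.mul_of_nonneg h1 (fun n => by positivity) fun n => by positivity)
  rw [div_mul_div_comm, one_mul]
  refine one_div_le_one_div_of_le (by positivity) ?_
  have a : (0 : ℝ) ≤ q.1 := by positivity
  have b : (0 : ℝ) ≤ q.2 := by positivity
  calc ((q.1 : ℝ) + 1) ^ 2 * ((q.2 : ℝ) + 1) ^ 2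
      ≤ ((q.1 : ℝ) + q.2 + 1) ^ 2 * ((q.1 : ℝ) + q.2 + 1) ^ 2 := by
        gcongr <;> linarith
    _ = _ := by ring

theorem summable_norm_pair_mul_seminorm (f : 𝓢(ℂ, ℂ)) (k l : ℕ) : Summable fun q : ℕ × ℕ =>
    ‖pair f (hermiteFun q.2 q.1)‖ * SchwartzMap.seminorm ℂ k l (hermiteFun q.1 q.2) := by
  obtain ⟨C, M, hC, h⟩ := exists_seminorm_hermiteFun_le k l
  obtain ⟨C', hC', h'⟩ := exists_norm_pair_hermiteFun_le f (M + 4)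
  refine Summable.of_nonneg_of_le (fun q => mul_nonneg (norm_nonneg _) (apply_nonneg _ _))
    (fun q => ?_) (summable_inv_pow_four.mul_left (C * C'))
  have hB : (0 : ℝ) < (q.1 : ℝ) + q.2 + 1 := by positivity
  have h1 := h' q.2 q.1
  rw [add_comm (q.2 : ℝ)] at h1
  rw [mul_one_div, le_div_iff₀ (by positivity)]
  calc ‖pair f (hermiteFun q.2 q.1)‖ * SchwartzMap.seminorm ℂ k l (hermiteFun q.1 q.2)
        * ((q.1 : ℝ) + q.2 + 1) ^ 4
      ≤ ‖pair f (hermiteFun q.2 q.1)‖ * (C * ((q.1 : ℝ) + q.2 + 1) ^ M)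
        * ((q.1 : ℝ) + q.2 + 1) ^ 4 := by
        gcongr
        exact h q.1 q.2
    _ = C * (((q.1 : ℝ) + q.2 + 1) ^ (M + 4) * ‖pair f (hermiteFun q.2 q.1)‖) := by
        rw [pow_add]
        ring
    _ ≤ C * C' := by gcongr

/-- The expansion of a Schwartz function in special Hermite functions. -/
theorem hasSum_pair_smul_hermiteFun (f : 𝓢(ℂ, ℂ)) :
    HasSum (fun q : ℕ × ℕ => pair f (hermiteFun q.2 q.1) • hermiteFun q.1 q.2) f := by
  set F : ℕ × ℕ → 𝓢(ℂ, ℂ) := fun q => pair f (hermiteFun q.2 q.1) • hermiteFun q.1 q.2 with hF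
  set v : ℕ → ℕ → ℕ × ℕ → ℝ := fun k l q =>
    ‖pair f (hermiteFun q.2 q.1)‖ * SchwartzMap.seminorm ℂ k l (hermiteFun q.1 q.2) with hv
  have hsv : ∀ k l, Summable (v k l) := summable_norm_pair_mul_seminorm f
  have hFv : ∀ k l q x, ‖x‖ ^ k * ‖iteratedFDeriv ℝ l (F q) x‖ ≤ v k l q := fun k l q x => by
    refine (SchwartzMap.le_seminorm ℂ k l (F q) x).trans_eq ?_
    rw [hF, map_smul_eq_mul]
  have hF0 : ∀ q x, ‖F q x‖ ≤ v 0 0 q := fun q x => by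
    simpa using hFv 0 0 q x
  have hcont : Continuous fun x => ∑' q, F q x :=
    continuous_tsum (fun q => (F q).continuous) (hsv 0 0) hF0
  have hbdd : ∀ x, ‖f x - ∑' q, F q x‖ ≤ SchwartzMap.seminorm ℂ 0 0 f + ∑' q, v 0 0 q := fun x =>
    (norm_sub_le _ _).trans (add_le_add (SchwartzMap.norm_le_seminorm ℂ f x)
      (tsum_of_norm_bounded (hsv 0 0).hasSum fun q => hF0 q x))
  -- `f - ∑ F q` is bounded, continuous and orthogonal to all the special Hermite functions
  have hpoint : ∀ x, f x = ∑' q, F q x := by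
    intro x
    refine sub_eq_zero.1 (eq_zero_of_integral_mul_hermiteFun_eq_zero
      (f := fun x => f x - ∑' q, F q x) (f.continuous.sub hcont) hbdd (fun j k => ?_) x)
    have hfi : Integrable fun z => f z * hermiteFun j k z :=
      integrable_mul_schwartz f.continuous (SchwartzMap.norm_le_seminorm ℂ f) _
    have hSi : Integrable fun z => (∑' q, F q z) * hermiteFun j k z :=
      integrable_mul_schwartz hcont
        (fun z => tsum_of_norm_bounded (hsv 0 0).hasSum fun q => hF0 q z) _
    have hFi : ∀ q, Integrable fun z => F q z * hermiteFun j k z := fun q =>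
      integrable_mul_schwartz (F q).continuous (SchwartzMap.norm_le_seminorm ℂ (F q)) _
    simp only [sub_mul]
    rw [integral_sub hfi hSi, ← pair_eq_integral]
    have hsum : HasSum (fun q => ∫ z, F q z * hermiteFun j k z)
        (∫ z, ∑' q, F q z * hermiteFun j k z) := by
      refine hasSum_integral_of_summable_integral_norm hFi ?_
      refine Summable.of_nonneg_of_le (fun q => by positivity) (fun q => ?_)
        ((hsv 0 0).mul_right (∫ z, ‖hermiteFun j k z‖))
      rw [← integral_const_mul]
      refine integral_mono (hFi q).norm ((hermiteFun j k).integrable.norm.const_mul _) fun z => ?_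
      simp only [norm_mul]
      exact mul_le_mul_of_nonneg_right (hF0 q z) (norm_nonneg _)
    simp only [tsum_mul_right] at hsum
    have hval : ∀ q : ℕ × ℕ, ∫ z, F q z * hermiteFun j k z
        = if q = (k, j) then pair f (hermiteFun j k) else 0 := by
      intro q
      rw [← pair_eq_integral, hF]
      rw [pair_smul_left, pair_hermiteFun]
      by_cases hq : q = (k, j)
      · rw [hq]
        simp
      · rw [if_neg hq, if_neg fun e => hq (Prod.ext e.1 e.2), mul_zero]
    simp only [hval] at hsum
    rw [hsum.unique (hasSum_ite_eq _ _), sub_self]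
  have hsumm : ∀ x, Summable fun q => F q x := fun x =>
    Summable.of_norm_bounded (hsv 0 0) fun q => hF0 q x
  refine ((schwartz_withSeminorms ℂ ℂ ℂ).tendsto_nhds _ f).2 fun kl ε hε => ?_
  obtain ⟨k, l⟩ := kl
  have htail := tendsto_tsum_compl_atTop_zero (v k l)
  filter_upwards [htail.eventually (gt_mem_nhds hε)] with A hA
  refine lt_of_le_of_lt ?_ hA
  rw [← map_neg_eq_map, neg_sub]
  refine SchwartzMap.seminorm_le_bound ℂ k l _ (tsum_nonneg fun q =>
    mul_nonneg (norm_nonneg _) (apply_nonneg _ _)) fun x => ?_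
  have hdiff : (⇑(f - ∑ q ∈ A, F q) : ℂ → ℂ) = fun y => ∑' q : {q // q ∉ A}, F q y := by
    funext y
    have hA' : (∑ q ∈ A, F q) y = ∑ q ∈ A, F q y := by
      simp [sum_apply]
    rw [sub_apply, hA', hpoint y, ← (hsumm y).sum_add_tsum_subtype_compl A, add_sub_cancel_left]
  rw [hdiff, iteratedFDeriv_tsum_apply (N := ⊤) (v := fun l (q : {q // q ∉ A}) => v 0 l q)
    (fun q => (F q).smooth ⊤) (fun l _ => (hsv 0 l).subtype _)
    (fun l q y _ => by simpa using hFv 0 l q y) le_top]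
  have hsub : Summable fun q : {q // q ∉ A} => v k l q := (hsv k l).subtype _
  have hnorm : Summable fun q : {q // q ∉ A} => iteratedFDeriv ℝ l (F q) x :=
    Summable.of_norm_bounded ((hsv 0 l).subtype _) fun q => by simpa using hFv 0 l q x
  calc ‖x‖ ^ k * ‖∑' q : {q // q ∉ A}, iteratedFDeriv ℝ l (F q) x‖
      = ‖∑' q : {q // q ∉ A}, (‖x‖ ^ k) • iteratedFDeriv ℝ l (F q) x‖ := by
        rw [tsum_const_smul'', norm_smul, norm_pow, norm_norm]
    _ ≤ ∑' q : {q // q ∉ A}, v k l q := tsum_of_norm_bounded hsub.hasSum fun q => by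
        rw [norm_smul, norm_pow, norm_norm]
        exact hFv k l q x

/-- A tempered distribution is determined by its Hermite coefficients. -/
theorem ext_of_coeff {u v : 𝓢'(ℂ, ℂ)} (h : ∀ j k, coeff u j k = coeff v j k) : u = v := by
  ext f
  have hs := hasSum_pair_smul_hermiteFun f
  have hu := hs.map u u.continuous
  have hv := hs.map v v.continuous
  have he : (v ∘ fun q : ℕ × ℕ => pair f (hermiteFun q.2 q.1) • hermiteFun q.1 q.2)
      = u ∘ fun q : ℕ × ℕ => pair f (hermiteFun q.2 q.1) • hermiteFun q.1 q.2 := by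
    funext q
    simp only [Function.comp_apply, map_smul]
    rw [show u (hermiteFun q.1 q.2) = v (hermiteFun q.1 q.2) from h q.2 q.1]
  rw [he] at hv
  exact hu.unique hv

end Completeness

/-! ### Distributions with holomorphic Hermite expansions -/

section HolomorphicSeries

open scoped ComplexConjugate

theorem norm_holFun_sq (n : ℕ) (z : ℂ) : ‖holFun n z‖ ^ 2
    = (Real.pi⁻¹ * Real.exp (-‖z‖ ^ 2)) * ((‖z‖ ^ 2) ^ n / n.factorial) := by
  rw [holFun_apply, norm_mul, norm_mul, norm_pow, norm_gaussian, Complex.norm_real,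
    Real.norm_of_nonneg (by positivity), mul_pow, mul_pow, inv_pow, Real.sq_sqrt (by positivity),
    ← Real.exp_nat_mul]
  have : ((2 : ℕ) : ℝ) * (-‖z‖ ^ 2 / 2) = -‖z‖ ^ 2 := by
    push_cast
    ring
  rw [this, ← pow_mul, ← pow_mul, mul_comm n 2]
  field_simp

theorem norm_holFun_sq_succ (n : ℕ) (z : ℂ) :
    (n + 1) * ‖holFun (n + 1) z‖ ^ 2 = ‖z‖ ^ 2 * ‖holFun n z‖ ^ 2 := by
  rw [norm_holFun_sq, norm_holFun_sq, Nat.factorial_succ, pow_succ]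
  push_cast
  field_simp
  ring

/-- `|φₙ(z)|²` is a Poisson probability of parameter `|z|²`, up to the factor `π⁻¹`, so that these
sums are moments of a Poisson variable. -/
theorem summable_pow_mul_norm_holFun_sq (k : ℕ) (z : ℂ) :
    Summable (fun n : ℕ => ((n : ℝ) + 1) ^ k * ‖holFun n z‖ ^ 2) ∧
      ∑' n : ℕ, ((n : ℝ) + 1) ^ k * ‖holFun n z‖ ^ 2 ≤ 2 ^ (k * k) * (1 + ‖z‖ ^ 2) ^ k := by
  induction k with
  | zero =>
    have h : HasSum (fun n : ℕ => ‖holFun n z‖ ^ 2)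
        ((Real.pi⁻¹ * Real.exp (-‖z‖ ^ 2)) * Real.exp (‖z‖ ^ 2)) := by
      have e := NormedSpace.expSeries_div_hasSum_exp (‖z‖ ^ 2 : ℝ)
      rw [← Real.exp_eq_exp_ℝ] at e
      exact (e.mul_left _).congr_fun fun n => norm_holFun_sq n z
    simp only [pow_zero, one_mul, mul_zero, mul_one]
    refine ⟨h.summable, ?_⟩
    rw [h.tsum_eq, mul_assoc, ← Real.exp_add, neg_add_cancel, Real.exp_zero, mul_one]
    exact inv_le_one_of_one_le₀ (by linarith [Real.pi_gt_three])
  | succ k ih =>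
    obtain ⟨hs, hle⟩ := ih
    -- the moments of order `k + 1` and `k` are related by the recursion of the Poisson weights
    let h : ℕ → ℝ := fun n => n * ((n : ℝ) + 1) ^ k * ‖holFun n z‖ ^ 2
    have hstep : ∀ n, h (n + 1) ≤ (2 ^ k * ‖z‖ ^ 2) * (((n : ℝ) + 1) ^ k * ‖holFun n z‖ ^ 2) := by
      intro n
      have h1 : ((n : ℝ) + 1 + 1) ^ k ≤ 2 ^ k * ((n : ℝ) + 1) ^ k := by
        rw [← mul_pow]
        gcongr
        have : (0 : ℝ) ≤ n := by positivity
        linarith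
      calc h (n + 1) = ((n : ℝ) + 1 + 1) ^ k * ((n + 1) * ‖holFun (n + 1) z‖ ^ 2) := by
            simp only [h]
            push_cast
            ring
        _ ≤ (2 ^ k * ((n : ℝ) + 1) ^ k) * ((n + 1) * ‖holFun (n + 1) z‖ ^ 2) := by gcongr
        _ = _ := by
            rw [norm_holFun_sq_succ]
            ring
    have hsh1 : Summable fun n => h (n + 1) :=
      Summable.of_nonneg_of_le (fun n => by positivity) hstep (hs.mul_left _)
    have hsh : Summable h := (summable_nat_add_iff 1).1 hsh1
    have hth : ∑' n, h n ≤ (2 ^ k * ‖z‖ ^ 2) * ∑' n : ℕ, ((n : ℝ) + 1) ^ k * ‖holFun n z‖ ^ 2 := by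
      rw [hsh.tsum_eq_zero_add, ← tsum_mul_left]
      have h0 : h 0 = 0 := by simp [h]
      rw [h0, zero_add]
      exact hsh1.tsum_le_tsum hstep (hs.mul_left _)
    have hdec : (fun n : ℕ => ((n : ℝ) + 1) ^ (k + 1) * ‖holFun n z‖ ^ 2)
        = fun n : ℕ => h n + ((n : ℝ) + 1) ^ k * ‖holFun n z‖ ^ 2 := by
      funext n
      simp only [h]
      ring
    rw [hdec]
    refine ⟨hsh.add hs, ?_⟩
    rw [hsh.tsum_add hs]
    have hz : (1 : ℝ) ≤ 2 ^ k := one_le_pow₀ (by norm_num)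
    calc _ ≤ (2 ^ k * ‖z‖ ^ 2) * (∑' n : ℕ, ((n : ℝ) + 1) ^ k * ‖holFun n z‖ ^ 2)
          + 2 ^ k * ∑' n : ℕ, ((n : ℝ) + 1) ^ k * ‖holFun n z‖ ^ 2 :=
          add_le_add hth (le_mul_of_one_le_left (tsum_nonneg fun n => by positivity) hz)
      _ = (2 ^ k * (1 + ‖z‖ ^ 2)) * ∑' n : ℕ, ((n : ℝ) + 1) ^ k * ‖holFun n z‖ ^ 2 := by ring
      _ ≤ (2 ^ k * (1 + ‖z‖ ^ 2)) * (2 ^ (k * k) * (1 + ‖z‖ ^ 2) ^ k) := by gcongr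
      _ = 2 ^ (k + k * k) * (1 + ‖z‖ ^ 2) ^ (k + 1) := by
          rw [pow_add, pow_succ (1 + ‖z‖ ^ 2)]
          ring
      _ ≤ 2 ^ ((k + 1) * (k + 1)) * (1 + ‖z‖ ^ 2) ^ (k + 1) := by
          gcongr
          · norm_num
          · nlinarith

/-- A polynomial bound for `∑ (n + 1) |φₙ(z)|`. -/
theorem exists_tsum_norm_holFun_le : ∃ C : ℝ, 0 ≤ C ∧ ∀ z : ℂ,
    Summable (fun n : ℕ => ((n : ℝ) + 1) * ‖holFun n z‖) ∧
      ∑' n : ℕ, ((n : ℝ) + 1) * ‖holFun n z‖ ≤ C * (1 + ‖z‖ ^ 2) ^ 4 := by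
  have h1 : Summable fun n : ℕ => (1 : ℝ) / ((n : ℝ) + 1) ^ 2 := by
    have := (summable_nat_add_iff 1).2 (Real.summable_one_div_nat_pow.2 (one_lt_two))
    simpa using this
  refine ⟨∑' n : ℕ, (1 : ℝ) / ((n : ℝ) + 1) ^ 2 + 2 ^ (4 * 4), by positivity, fun z => ?_⟩
  obtain ⟨hs, hle⟩ := summable_pow_mul_norm_holFun_sq 4 z
  have hterm : ∀ n : ℕ, ((n : ℝ) + 1) * ‖holFun n z‖
      ≤ 1 / ((n : ℝ) + 1) ^ 2 + ((n : ℝ) + 1) ^ 4 * ‖holFun n z‖ ^ 2 := by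
    intro n
    set a := 1 / ((n : ℝ) + 1) with ha
    set b := ((n : ℝ) + 1) ^ 2 * ‖holFun n z‖ with hb
    have e1 : ((n : ℝ) + 1) * ‖holFun n z‖ = a * b := by
      rw [ha, hb]
      field_simp
    have e2 : 1 / ((n : ℝ) + 1) ^ 2 = a ^ 2 := by
      rw [ha, div_pow, one_pow]
    have e3 : ((n : ℝ) + 1) ^ 4 * ‖holFun n z‖ ^ 2 = b ^ 2 := by
      rw [hb]
      ring
    rw [e1, e2, e3]
    nlinarith [sq_nonneg (a - b), sq_nonneg a, sq_nonneg b]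
  have hsum := Summable.of_nonneg_of_le (fun n => by positivity) hterm (h1.add hs)
  refine ⟨hsum, (hsum.tsum_le_tsum hterm (h1.add hs)).trans ?_⟩
  rw [h1.tsum_add hs, add_mul]
  refine add_le_add ?_ hle
  refine le_mul_of_one_le_right (tsum_nonneg fun n => by positivity) (one_le_pow₀ ?_)
  nlinarith [norm_nonneg z]

/-- At most linear growth of a sequence of coefficients. -/
def LinearGrowth (c : ℕ → ℂ) : Prop := ∃ K : ℕ, ∀ n : ℕ, ‖c n‖ ≤ K * ((n : ℝ) + 1)

/-- The function `∑ cₙ φₙ`. -/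
def seriesFun (c : ℕ → ℂ) (z : ℂ) : ℂ := ∑' n, c n * holFun n z

theorem LinearGrowth.summable {c : ℕ → ℂ} (hc : LinearGrowth c) (z : ℂ) :
    Summable fun n => ‖c n * holFun n z‖ := by
  obtain ⟨K, hK⟩ := hc
  obtain ⟨C, -, h⟩ := exists_tsum_norm_holFun_le
  refine Summable.of_nonneg_of_le (fun n => norm_nonneg _) (fun n => ?_) ((h z).1.mul_left (K : ℝ))
  rw [norm_mul, ← mul_assoc]
  exact mul_le_mul_of_nonneg_right (hK n) (norm_nonneg _)

theorem LinearGrowth.exists_tsum_le {c : ℕ → ℂ} (hc : LinearGrowth c) : ∃ C : ℝ, 0 ≤ C ∧ ∀ z : ℂ,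
    ∑' n, ‖c n * holFun n z‖ ≤ C * (1 + ‖z‖ ^ 2) ^ 4 := by
  have hsum := hc.summable
  obtain ⟨K, hK⟩ := hc
  obtain ⟨C, hC, h⟩ := exists_tsum_norm_holFun_le
  refine ⟨K * C, by positivity, fun z => ?_⟩
  calc ∑' n, ‖c n * holFun n z‖ ≤ ∑' n : ℕ, K * (((n : ℝ) + 1) * ‖holFun n z‖) := by
        refine (hsum z).tsum_le_tsum (fun n => ?_) ((h z).1.mul_left (K : ℝ))
        rw [norm_mul, ← mul_assoc]
        exact mul_le_mul_of_nonneg_right (hK n) (norm_nonneg _)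
    _ = K * ∑' n : ℕ, ((n : ℝ) + 1) * ‖holFun n z‖ := tsum_mul_left
    _ ≤ K * (C * (1 + ‖z‖ ^ 2) ^ 4) := by
        gcongr
        exact (h z).2
    _ = _ := by ring

/-- The sum of such a series is the product of an entire function with the Gaussian. -/
theorem LinearGrowth.exists_entire {c : ℕ → ℂ} (hc : LinearGrowth c) :
    ∃ F : ℂ → ℂ, Differentiable ℂ F ∧ ∀ z, seriesFun c z = F z * gaussian z := by
  let a : ℕ → ℂ := fun n => c n * (((Real.sqrt (Real.pi * n.factorial))⁻¹ : ℝ) : ℂ)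
  have hg : ∀ z, gaussian z ≠ 0 := fun z => by
    rw [gaussian, Complex.ofReal_ne_zero]
    exact (Real.exp_pos _).ne'
  have hterm : ∀ n z, c n * holFun n z = (a n * z ^ n) * gaussian z := fun n z => by
    rw [holFun_apply]
    ring
  refine ⟨fun z => ∑' n, a n * z ^ n, fun z => ?_, fun z => ?_⟩
  · have hR : Summable fun n => ‖a n‖ * (‖z‖ + 1) ^ n := by
      have h := hc.summable ((‖z‖ + 1 : ℝ) : ℂ)
      simp only [hterm, norm_mul, norm_pow, Complex.norm_real] at h
      have h2 := (summable_mul_right_iff (norm_ne_zero_iff.2 (hg _))).1 h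
      simpa [abs_of_pos (show 0 < ‖z‖ + 1 by positivity)] using h2
    have hd := Complex.differentiableOn_tsum_of_summable_norm hR
      (F := fun n w => a n * w ^ n) (U := Metric.ball 0 (‖z‖ + 1))
      (fun n => by fun_prop) Metric.isOpen_ball fun n w hw => by
        rw [norm_mul, norm_pow]
        gcongr
        exact (mem_ball_zero_iff.1 hw).le
    exact hd.differentiableAt (Metric.isOpen_ball.mem_nhds (by simp))
  · rw [seriesFun]
    simp only [hterm]
    rw [tsum_mul_right]

theorem LinearGrowth.continuous_seriesFun {c : ℕ → ℂ} (hc : LinearGrowth c) :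
    Continuous (seriesFun c) := by
  obtain ⟨F, hF, h⟩ := hc.exists_entire
  have : seriesFun c = fun z => F z * gaussian z := funext h
  rw [this]
  exact hF.continuous.mul gaussianSchwartz.continuous

/-- The weight `(1 + |z|²)⁴`. -/
def growthWeight (z : ℂ) : ℂ := (((1 + ‖z‖ ^ 2) ^ 4 : ℝ) : ℂ)

theorem growthWeight_hasTemperateGrowth : growthWeight.HasTemperateGrowth := by
  have h1 : (fun z : ℂ => (1 + ‖z‖ ^ 2 : ℝ)).HasTemperateGrowth :=
    (Function.HasTemperateGrowth.const _).add (Function.hasTemperateGrowth_norm_sq ℂ)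
  have h2 := (h1.pow 4)
  exact (Complex.ofRealCLM.hasTemperateGrowth).comp h2

theorem LinearGrowth.memLp_top {c : ℕ → ℂ} (hc : LinearGrowth c) :
    MemLp (fun z => seriesFun c z / growthWeight z) ∞ (volume : Measure ℂ) := by
  obtain ⟨C, hC, h⟩ := hc.exists_tsum_le
  refine memLp_top_of_bound ?_ C (Eventually.of_forall fun z => ?_)
  · exact (hc.continuous_seriesFun.div growthWeight_hasTemperateGrowth.1.continuous fun z => by
      rw [growthWeight, Complex.ofReal_ne_zero]
      positivity).aestronglyMeasurable
  · rw [norm_div, growthWeight, Complex.norm_real, Real.norm_of_nonneg (by positivity),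
      div_le_iff₀ (by positivity)]
    exact (norm_tsum_le_tsum_norm (hc.summable z)).trans (h z)

open Classical in
/-- The tempered distribution `∑ cₙ φₙ`, for coefficients of linear growth, and `0` otherwise. -/
def holSeries (c : ℕ → ℂ) : 𝓢'(ℂ, ℂ) :=
  if hc : LinearGrowth c then
    TemperedDistribution.smulLeftCLM ℂ growthWeight (Lp.toTemperedDistribution hc.memLp_top.toLp)
  else 0

theorem holSeries_apply {c : ℕ → ℂ} (hc : LinearGrowth c) (ψ : 𝓢(ℂ, ℂ)) :
    holSeries c ψ = ∫ z, seriesFun c z * ψ z := by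
  rw [holSeries, dif_pos hc, TemperedDistribution.smulLeftCLM_apply_apply,
    Lp.toTemperedDistribution_apply]
  refine integral_congr_ae ?_
  filter_upwards [hc.memLp_top.coeFn_toLp] with z hz
  rw [hz, SchwartzMap.smulLeftCLM_apply_apply growthWeight_hasTemperateGrowth, smul_eq_mul,
    smul_eq_mul]
  have : growthWeight z ≠ 0 := by
    rw [growthWeight, Complex.ofReal_ne_zero]
    positivity
  field_simp

theorem holSeries_of_not {c : ℕ → ℂ} (hc : ¬ LinearGrowth c) : holSeries c = 0 := dif_neg hc

theorem integrable_growthWeight_mul (ψ : 𝓢(ℂ, ℂ)) :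
    Integrable fun z => (1 + ‖z‖ ^ 2) ^ 4 * ‖ψ z‖ := by
  have h := (SchwartzMap.smulLeftCLM ℂ growthWeight ψ).integrable (μ := volume)
  refine h.norm.congr (Eventually.of_forall fun z => ?_)
  simp only []
  rw [SchwartzMap.smulLeftCLM_apply_apply growthWeight_hasTemperateGrowth, norm_smul, growthWeight,
    Complex.norm_real, Real.norm_of_nonneg (by positivity)]

theorem LinearGrowth.integrable {c : ℕ → ℂ} (hc : LinearGrowth c) (ψ : 𝓢(ℂ, ℂ)) :
    Integrable fun z => seriesFun c z * ψ z := by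
  obtain ⟨C, hC, h⟩ := hc.exists_tsum_le
  refine ((integrable_growthWeight_mul ψ).const_mul C).mono'
    (hc.continuous_seriesFun.mul ψ.continuous).aestronglyMeasurable
    (Eventually.of_forall fun z => ?_)
  rw [norm_mul, ← mul_assoc]
  exact mul_le_mul_of_nonneg_right ((norm_tsum_le_tsum_norm (hc.summable z)).trans (h z))
    (norm_nonneg _)

/-- The series converges in the sense of distributions. -/
theorem hasSum_holSeries {c : ℕ → ℂ} (hc : LinearGrowth c) (ψ : 𝓢(ℂ, ℂ)) :
    HasSum (fun n => c n * pair (holFun n) ψ) (holSeries c ψ) := by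
  obtain ⟨C, hC, h⟩ := hc.exists_tsum_le
  rw [holSeries_apply hc]
  have hsum : HasSum (fun n => ∫ z, (c n * holFun n z) * ψ z) (∫ z, seriesFun c z * ψ z) := by
    refine hasSum_integral_of_dominated_convergence (fun n z => ‖c n * holFun n z‖ * ‖ψ z‖)
      (fun n => ?_) (fun n => Eventually.of_forall fun z => (norm_mul _ _).le)
      (Eventually.of_forall fun z => (hc.summable z).mul_right _) ?_
      (Eventually.of_forall fun z => (hc.summable z).of_norm.hasSum.mul_right _)
    · exact ((continuous_const.mul (holFun n).continuous).mul ψ.continuous).aestronglyMeasurable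
    · simp only [tsum_mul_right]
      refine ((integrable_growthWeight_mul ψ).const_mul C).mono' ?_ (Eventually.of_forall fun z => ?_)
      · have hm : Measurable fun z => ∑' n, ‖c n * holFun n z‖ :=
          Measurable.tsum fun n => (continuous_const.mul (holFun n).continuous).norm.measurable
        exact (hm.mul ψ.continuous.norm.measurable).aestronglyMeasurable
      · rw [Real.norm_of_nonneg (mul_nonneg (tsum_nonneg fun n => norm_nonneg _) (norm_nonneg _)),
          ← mul_assoc]
        exact mul_le_mul_of_nonneg_right (h z) (norm_nonneg _)
  refine hsum.congr_fun fun n => ?_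
  rw [pair_eq_integral, ← integral_const_mul]
  simp only [mul_assoc]

theorem coeff_holSeries {c : ℕ → ℂ} (hc : LinearGrowth c) (j k : ℕ) :
    coeff (holSeries c) j k = if k = 0 then c j else 0 := by
  have h := hasSum_holSeries hc (hermiteFun k j)
  have hval : ∀ n, c n * pair (holFun n) (hermiteFun k j)
      = if n = j then (if k = 0 then c j else 0) else 0 := by
    intro n
    rw [holFun, pair_hermiteFun]
    by_cases hn : n = j
    · subst hn
      by_cases hk : k = 0
      · simp [hk]
      · simp [hk, Ne.symm hk]
    · simp [hn]
  simp only [hval] at h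
  exact h.unique (hasSum_ite_eq _ _)

theorem eq_holSeries {c : ℕ → ℂ} (hc : LinearGrowth c) {u : 𝓢'(ℂ, ℂ)}
    (hu : ∀ j k, coeff u j k = if k = 0 then c j else 0) : u = holSeries c :=
  ext_of_coeff fun j k => by rw [hu, coeff_holSeries hc]

theorem measurableSet_linearGrowth : MeasurableSet {c : ℕ → ℂ | LinearGrowth c} := by
  simp only [LinearGrowth, Set.ofPred_exists, Set.ofPred_forall]
  refine MeasurableSet.iUnion fun K => MeasurableSet.iInter fun n => ?_
  exact measurableSet_le (by fun_prop) (by fun_prop)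

/-- The `σ`-algebra on distributions is generated by the evaluations. -/
theorem measurable_iff_eval {α : Type*} [MeasurableSpace α] {f : α → 𝓢'(ℂ, ℂ)} :
    Measurable f ↔ ∀ ψ : 𝓢(ℂ, ℂ), Measurable fun a => f a ψ := by
  constructor
  · intro h ψ
    have h1 : Measurable fun u : 𝓢'(ℂ, ℂ) => u ψ :=
      (comap_measurable _).mono (le_iSup (fun ψ : 𝓢(ℂ, ℂ) => MeasurableSpace.comap
        (fun u : 𝓢'(ℂ, ℂ) => u ψ) inferInstance) ψ) le_rfl
    exact h1.comp h
  · intro h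
    rw [measurable_iff_comap_le, instMeasurableSpaceTempered, MeasurableSpace.comap_iSup]
    refine iSup_le fun ψ => ?_
    rw [MeasurableSpace.comap_comp]
    exact (h ψ).comap_le

theorem measurable_eval (ψ : 𝓢(ℂ, ℂ)) : Measurable fun u : 𝓢'(ℂ, ℂ) => u ψ :=
  measurable_iff_eval.1 measurable_id ψ

theorem measurable_coeff (j k : ℕ) : Measurable fun u : 𝓢'(ℂ, ℂ) => coeff u j k :=
  measurable_eval _

theorem measurable_holSeries : Measurable holSeries := by
  classical
  refine measurable_iff_eval.2 fun ψ => ?_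
  refine measurable_of_tendsto_metrizable (f := fun (N : ℕ) (c : ℕ → ℂ) =>
    if LinearGrowth c then ∑ n ∈ Finset.range N, c n * pair (holFun n) ψ else 0) (fun N => ?_) ?_
  · exact Measurable.ite measurableSet_linearGrowth (by fun_prop) measurable_const
  · rw [tendsto_pi_nhds]
    intro c
    by_cases hc : LinearGrowth c
    · simp only [if_pos hc]
      exact (hasSum_holSeries hc ψ).tendsto_sum_nat
    · simp only [if_neg hc, holSeries_of_not hc]
      exact tendsto_const_nhds

theorem holSeries_eq_tsum {c : ℕ → ℂ} (hc : LinearGrowth c) :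
    ∑' n, c n • SchwartzMap.toTemperedDistributionCLM ℂ ℂ volume (holFun n) = holSeries c := by
  refine HasSum.tsum_eq ?_
  refine PointwiseConvergenceCLM.tendsto_iff_forall_tendsto.2 fun ψ => ?_
  refine (hasSum_holSeries hc ψ).congr fun A => ?_
  have : (∑ n ∈ A, c n • SchwartzMap.toTemperedDistributionCLM ℂ ℂ volume (holFun n)) ψ
      = ∑ n ∈ A, c n * pair ψ (holFun n) := by
    simp only [sum_apply, smul_apply, smul_eq_mul]
    rfl
  rw [this]
  simp only [pair_comm ψ]

end HolomorphicSeries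

/-! ### Weighted norms of coefficient sequences -/

section WeightedSequences

/-- The weight `(2n + 2)^s` of the `n`-th mode in `ℋ^s`. -/
def sobolevWeight (s : ℝ) (n : ℕ) : ℝ≥0∞ := ENNReal.ofReal ((2 * (n : ℝ) + 2) ^ s)

/-- The squared norm in `ℋ^s` of `∑ cₙ φₙ`. -/
def seqNormSq (s : ℝ) (c : ℕ → ℂ) : ℝ≥0∞ := ∑' n, sobolevWeight s n * ‖c n‖ₑ ^ 2

theorem sobolevNormSq_eq_seqNormSq {s : ℝ} {u : 𝓢'(ℂ, ℂ)} {c : ℕ → ℂ}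
    (h : ∀ j k, coeff u j k = if k = 0 then c j else 0) : sobolevNormSq s u = seqNormSq s c := by
  rw [sobolevNormSq, ENNReal.tsum_prod', seqNormSq]
  refine tsum_congr fun j => ?_
  rw [tsum_eq_single 0 fun k hk => by simp [h, hk], h, if_pos rfl, sobolevWeight,
    ENNReal.ofReal_mul (by positivity), ENNReal.ofReal_pow (norm_nonneg _), ofReal_norm]
  simp

theorem sobolevNormSq_holSeries {c : ℕ → ℂ} (hc : LinearGrowth c) (s : ℝ) :
    sobolevNormSq s (holSeries c) = seqNormSq s c :=
  sobolevNormSq_eq_seqNormSq (coeff_holSeries hc)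

theorem sobolevWeight_ne_zero (s : ℝ) (n : ℕ) : sobolevWeight s n ≠ 0 := by
  rw [sobolevWeight, Ne, ENNReal.ofReal_eq_zero, not_le]
  positivity

theorem sobolevWeight_mono {s s' : ℝ} (h : s ≤ s') (n : ℕ) :
    sobolevWeight s n ≤ sobolevWeight s' n := by
  refine ENNReal.ofReal_le_ofReal (Real.rpow_le_rpow_of_exponent_le ?_ h)
  have : (0 : ℝ) ≤ n := by positivity
  linarith

theorem seqNormSq_mono {s s' : ℝ} (h : s ≤ s') (c : ℕ → ℂ) : seqNormSq s c ≤ seqNormSq s' c :=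
  ENNReal.tsum_le_tsum fun n => mul_le_mul_left (sobolevWeight_mono h n) _

theorem tsum_sobolevWeight_lt_top {σ : ℝ} (hσ : 1 < σ) : ∑' n, sobolevWeight (-σ) n < ∞ := by
  have h : Summable fun n : ℕ => (2 * (n : ℝ) + 2) ^ (-σ) := by
    have h1 : Summable fun n : ℕ => ((n + 1 : ℕ) : ℝ) ^ (-σ) :=
      (summable_nat_add_iff 1).2 (Real.summable_nat_rpow.2 (by linarith))
    refine (h1.mul_left ((2 : ℝ) ^ (-σ))).congr fun n => ?_
    rw [← Real.mul_rpow (by positivity) (by positivity)]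
    push_cast
    ring_nf
  exact h.tsum_ofReal_lt_top

theorem measurable_seqNormSq (s : ℝ) : Measurable (seqNormSq s) := by
  unfold seqNormSq
  fun_prop

theorem lintegral_seqNormSq {α : Type*} [MeasurableSpace α] {μ : Measure α} (s : ℝ)
    {h : ℕ → α → ℂ} (hh : ∀ n, Measurable (h n)) :
    ∫⁻ a, seqNormSq s (fun n => h n a) ∂μ
      = ∑' n, sobolevWeight s n * ∫⁻ a, ‖h n a‖ₑ ^ 2 ∂μ := by
  unfold seqNormSq
  rw [lintegral_tsum fun n => by fun_prop]
  exact tsum_congr fun n => lintegral_const_mul _ (by fun_prop)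

theorem lintegral_seqNormSq_lt_top {α : Type*} [MeasurableSpace α] {μ : Measure α} {σ : ℝ}
    (hσ : 1 < σ) {h : ℕ → α → ℂ} (hh : ∀ n, Measurable (h n)) {C : ℝ≥0∞} (hC : C ≠ ∞)
    (hb : ∀ n, ∫⁻ a, ‖h n a‖ₑ ^ 2 ∂μ ≤ C) :
    ∫⁻ a, seqNormSq (-σ) (fun n => h n a) ∂μ < ∞ := by
  rw [lintegral_seqNormSq _ hh]
  calc _ ≤ ∑' n, sobolevWeight (-σ) n * C := ENNReal.tsum_le_tsum fun n => by gcongr; exact hb n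
    _ = (∑' n, sobolevWeight (-σ) n) * C := ENNReal.tsum_mul_right
    _ < ∞ := ENNReal.mul_lt_top (tsum_sobolevWeight_lt_top hσ) hC.lt_top

/-- The sequences `c` for which `∑ cₙ φₙ` belongs to `ℋ^{-σ}` for all `σ > 1`. -/
def NegSobolev (c : ℕ → ℂ) : Prop := ∀ σ : ℝ, 1 < σ → seqNormSq (-σ) c < ∞

theorem exists_one_add_inv_le {σ : ℝ} (hσ : 1 < σ) : ∃ m : ℕ, -σ ≤ -(1 + 1 / ((m : ℝ) + 1)) := by
  obtain ⟨m, hm⟩ := exists_nat_one_div_lt (sub_pos.2 hσ)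
  exact ⟨m, by linarith⟩

theorem one_lt_one_add_inv (m : ℕ) : (1 : ℝ) < 1 + 1 / ((m : ℝ) + 1) := by
  have : (0 : ℝ) < 1 / ((m : ℝ) + 1) := by positivity
  linarith

theorem negSobolev_iff {c : ℕ → ℂ} :
    NegSobolev c ↔ ∀ m : ℕ, seqNormSq (-(1 + 1 / ((m : ℝ) + 1))) c < ∞ := by
  refine ⟨fun h m => h _ (one_lt_one_add_inv m), fun h σ hσ => ?_⟩
  obtain ⟨m, hm⟩ := exists_one_add_inv_le hσ
  exact (seqNormSq_mono hm c).trans_lt (h m)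

theorem linearGrowth_of_seqNormSq {c : ℕ → ℂ} (h : seqNormSq (-2) c < ∞) : LinearGrowth c := by
  obtain ⟨K, hK⟩ := exists_nat_gt (2 * Real.sqrt (seqNormSq (-2) c).toReal)
  refine ⟨K, fun n => ?_⟩
  have h1 : sobolevWeight (-2) n * ‖c n‖ₑ ^ 2 ≤ seqNormSq (-2) c := ENNReal.le_tsum n
  have h2 := ENNReal.toReal_mono h.ne h1
  have hpos : (0 : ℝ) < 2 * n + 2 := by positivity
  rw [sobolevWeight, ENNReal.toReal_mul, ENNReal.toReal_ofReal (by positivity),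
    ENNReal.toReal_pow, toReal_enorm, Real.rpow_neg hpos.le, Real.rpow_two] at h2
  have h3 : ‖c n‖ ^ 2 ≤ (seqNormSq (-2) c).toReal * (2 * n + 2) ^ 2 := by
    rwa [inv_mul_le_iff₀ (by positivity), mul_comm] at h2
  calc ‖c n‖ ≤ Real.sqrt ((seqNormSq (-2) c).toReal * (2 * n + 2) ^ 2) := Real.le_sqrt_of_sq_le h3
    _ = (2 * Real.sqrt (seqNormSq (-2) c).toReal) * (n + 1) := by
        rw [Real.sqrt_mul ENNReal.toReal_nonneg, Real.sqrt_sq hpos.le]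
        ring
    _ ≤ K * (n + 1) := by gcongr

theorem NegSobolev.linearGrowth {c : ℕ → ℂ} (hc : NegSobolev c) : LinearGrowth c :=
  linearGrowth_of_seqNormSq (hc 2 one_lt_two)

theorem NegSobolev.holSeries_mem {c : ℕ → ℂ} (hc : NegSobolev c) : holSeries c ∈ Xhol := by
  refine ⟨fun σ hσ => ?_, ?_⟩
  · rw [MemSobolev, sobolevNormSq_holSeries hc.linearGrowth]
    exact hc σ hσ
  · obtain ⟨F, hF, h⟩ := hc.linearGrowth.exists_entire
    refine ⟨F, hF, fun ψ => ?_⟩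
    simp only [← h]
    exact ⟨hc.linearGrowth.integrable ψ, holSeries_apply hc.linearGrowth ψ⟩

theorem ae_negSobolev {α : Type*} [MeasurableSpace α] {μ : Measure α}
    {h : ℕ → α → ℂ} (hh : ∀ n, Measurable (h n)) {C : ℝ≥0∞} (hC : C ≠ ∞)
    (hb : ∀ n, ∫⁻ a, ‖h n a‖ₑ ^ 2 ∂μ ≤ C) : ∀ᵐ a ∂μ, NegSobolev fun n => h n a := by
  simp only [negSobolev_iff]
  refine ae_all_iff.2 fun m => ?_
  refine ae_lt_top ?_ (lintegral_seqNormSq_lt_top (one_lt_one_add_inv m) hh hC hb).ne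
  exact (measurable_seqNormSq _).comp (measurable_pi_lambda _ hh)

theorem ae_negSobolev_gaussianSeq : ∀ᵐ c ∂gaussianSeq, NegSobolev c :=
  ae_negSobolev (fun n => measurable_pi_apply n) (by finiteness) lintegral_sq_le

theorem sq_enorm_add_le (a b : ℂ) : ‖a + b‖ₑ ^ 2 ≤ 2 * ‖a‖ₑ ^ 2 + 2 * ‖b‖ₑ ^ 2 := by
  refine (pow_le_pow_left' (enorm_add_le a b) 2).trans ?_
  have := ENNReal.rpow_add_le_mul_rpow_add_rpow ‖a‖ₑ ‖b‖ₑ (p := 2) one_le_two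
  have e : (2 : ℝ≥0∞) ^ ((2 : ℝ) - 1) = 2 := by norm_num
  rw [e, mul_add] at this
  exact_mod_cast this

theorem seqNormSq_add_le (s : ℝ) (c d : ℕ → ℂ) :
    seqNormSq s (fun n => c n + d n) ≤ 2 * seqNormSq s c + 2 * seqNormSq s d := by
  unfold seqNormSq
  rw [← ENNReal.tsum_mul_left, ← ENNReal.tsum_mul_left, ← ENNReal.tsum_add]
  refine ENNReal.tsum_le_tsum fun n => ?_
  calc _ ≤ sobolevWeight s n * (2 * ‖c n‖ₑ ^ 2 + 2 * ‖d n‖ₑ ^ 2) := by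
        gcongr
        exact sq_enorm_add_le _ _
    _ = _ := by ring

end WeightedSequences

/-! ### The white noise measure in coefficients -/

/-- The law of `∑ gₙ φₙ` depends on the law of the sequence `g` only. The series converges almost
surely, because its coefficients grow at most linearly. -/
theorem whiteNoise_eq {Ω : Type*} [MeasurableSpace Ω] (p : Measure Ω) [IsProbabilityMeasure p]
    (g : ℕ → Ω → ℂ) (hmeas : ∀ n, Measurable (g n)) (hindep : iIndepFun g p)
    (hlaw : ∀ n, p.map (g n) = stdComplexGaussian) :
    whiteNoise p g = gaussianSeq.map holSeries := by
  have hmap : p.map (fun ω n => g n ω) = gaussianSeq := by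
    rw [hindep.map_fun_eq_infinitePi_map (fun n => hmeas n), gaussianSeq]
    simp only [hlaw]
  have hg : Measurable fun ω n => g n ω := measurable_pi_lambda _ hmeas
  have hae : ∀ᵐ ω ∂p, LinearGrowth fun n => g n ω := by
    have h : ∀ᵐ c ∂p.map (fun ω n => g n ω), LinearGrowth c := by
      rw [hmap]
      exact ae_negSobolev_gaussianSeq.mono fun c hc => hc.linearGrowth
    exact ae_of_ae_map hg.aemeasurable h
  rw [whiteNoise, ← hmap, Measure.map_map measurable_holSeries hg]
  exact Measure.map_congr (hae.mono fun ω hω => holSeries_eq_tsum hω)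

/-! ### The trilinear operator on holomorphic Hermite functions -/

section Trilinear

open scoped ComplexConjugate
open Polynomial (C X)

/-- The point `1 / (1 + i r)`, which runs through the circle with diameter `[0, 1]`. -/
def circlePoint (r : ℝ) : ℂ := (1 + r * Complex.I)⁻¹

theorem one_add_mul_I_ne_zero (r : ℝ) : (1 + r * Complex.I : ℂ) ≠ 0 := by
  intro h
  have := congrArg Complex.re h
  simp at this

theorem one_sub_mul_I_ne_zero (r : ℝ) : (1 - r * Complex.I : ℂ) ≠ 0 := by
  intro h
  have := congrArg Complex.re h
  simp at this

theorem normSq_one_add_mul_I (r : ℝ) : Complex.normSq (1 + r * Complex.I) = 1 + r ^ 2 := by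
  rw [Complex.normSq_apply]
  simp
  ring

theorem norm_circlePoint_sq (r : ℝ) : ‖circlePoint r‖ ^ 2 = (1 + r ^ 2)⁻¹ := by
  rw [circlePoint, norm_inv, inv_pow, Complex.sq_norm, normSq_one_add_mul_I]

theorem norm_circlePoint_le (r : ℝ) : ‖circlePoint r‖ ≤ 1 := by
  have h : ‖circlePoint r‖ ^ 2 ≤ 1 := by
    rw [norm_circlePoint_sq]
    exact inv_le_one_of_one_le₀ (by nlinarith [sq_nonneg r])
  exact (sq_le_one_iff₀ (norm_nonneg _)).1 h

theorem hasDerivAt_circlePoint (r : ℝ) :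
    HasDerivAt circlePoint (-Complex.I * circlePoint r ^ 2) r := by
  have h1 : HasDerivAt (fun r : ℝ => (1 + r * Complex.I : ℂ)) Complex.I r := by
    simpa using ((Complex.ofRealCLM.hasDerivAt (x := r)).mul_const Complex.I).const_add 1
  have h2 := h1.inv (one_add_mul_I_ne_zero r)
  have e : -Complex.I * circlePoint r ^ 2 = -Complex.I / (1 + r * Complex.I : ℂ) ^ 2 := by
    rw [circlePoint, inv_pow]
    rfl
  rw [e]
  exact h2

theorem continuous_circlePoint : Continuous circlePoint :=
  continuous_iff_continuousAt.2 fun r => (hasDerivAt_circlePoint r).continuousAt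

theorem integrable_circlePoint_pow (l : ℕ) : Integrable fun r => circlePoint r ^ (l + 2) := by
  refine integrable_inv_one_add_sq.mono' (continuous_circlePoint.pow _).aestronglyMeasurable
    (Eventually.of_forall fun r => ?_)
  rw [norm_pow, pow_add, norm_circlePoint_sq]
  exact mul_le_of_le_one_left (by positivity) (pow_le_one₀ (norm_nonneg _) (norm_circlePoint_le r))

theorem tendsto_circlePoint : Tendsto circlePoint (cocompact ℝ) (𝓝 0) := by
  refine tendsto_zero_iff_norm_tendsto_zero.2 ?_
  have h : Tendsto (fun r : ℝ => ‖r‖⁻¹) (cocompact ℝ) (𝓝 0) :=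
    tendsto_inv_atTop_zero.comp tendsto_norm_cocompact_atTop
  refine squeeze_zero' (Eventually.of_forall fun r => norm_nonneg _) ?_ h
  have hne : ∀ᶠ r : ℝ in cocompact ℝ, r ≠ 0 := by
    have := (isCompact_singleton (x := (0 : ℝ))).compl_mem_cocompact
    filter_upwards [this] with r hr
    exact hr
  filter_upwards [hne] with r hr
  refine le_of_sq_le_sq ?_ (by positivity)
  rw [norm_circlePoint_sq, inv_pow, Real.norm_eq_abs, sq_abs]
  have : 0 < r ^ 2 := by positivity
  gcongr
  linarith

/-- The integrand has the primitive `i (1 + i r)^{-(l + 1)} / (l + 1)`, which vanishes at infinity.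
-/
theorem integral_circlePoint_pow (l : ℕ) : ∫ r, circlePoint r ^ (l + 2) = 0 := by
  let F : ℝ → ℂ := fun r => Complex.I / (l + 1) * circlePoint r ^ (l + 1)
  have hl : (l + 1 : ℂ) ≠ 0 := by exact_mod_cast l.succ_ne_zero
  have hF : ∀ r, HasDerivAt F (circlePoint r ^ (l + 2)) r := by
    intro r
    have h := ((hasDerivAt_circlePoint r).pow (l + 1)).const_mul (Complex.I / (l + 1))
    refine h.congr_deriv ?_
    push_cast
    field_simp
    rw [pow_add]
    linear_combination (-circlePoint r ^ l * circlePoint r ^ 2) * Complex.I_sq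
  have hlim : Tendsto F (cocompact ℝ) (𝓝 0) := by
    have h := (tendsto_circlePoint.pow (l + 1)).const_mul (Complex.I / (l + 1))
    simpa using h
  rw [cocompact_eq_atBot_atTop] at hlim
  rw [integral_of_hasDerivAt_of_tendsto hF (integrable_circlePoint_pow l)
    (hlim.mono_left le_sup_left) (hlim.mono_left le_sup_right), sub_zero]

/-- Mean value property on the circle with diameter `[0, 1]`: `dr / (1 + r²)` is the arc length
in the parametrization by `1 / (1 + i r)`. -/
theorem integral_circlePoint_pow_mul (l : ℕ) :
    Integrable (fun r : ℝ => (((1 + r ^ 2)⁻¹ : ℝ) : ℂ) * circlePoint r ^ l) ∧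
    ∫ r : ℝ, (((1 + r ^ 2)⁻¹ : ℝ) : ℂ) * circlePoint r ^ l = Real.pi * (1 / 2) ^ l := by
  have hint : ∀ l : ℕ, Integrable fun r : ℝ => (((1 + r ^ 2)⁻¹ : ℝ) : ℂ) * circlePoint r ^ l := by
    intro l
    refine integrable_inv_one_add_sq.ofReal.mul_bdd (c := 1)
      (continuous_circlePoint.pow _).aestronglyMeasurable (Eventually.of_forall fun r => ?_)
    rw [norm_pow]
    exact pow_le_one₀ (norm_nonneg _) (norm_circlePoint_le r)
  refine ⟨hint l, ?_⟩
  induction l with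
  | zero =>
    simp only [pow_zero, mul_one]
    rw [← integral_univ_inv_one_add_sq]
    exact integral_ofReal
  | succ l ih =>
    have hid : ∀ r : ℝ, (((1 + r ^ 2)⁻¹ : ℝ) : ℂ) * circlePoint r ^ (l + 1)
        = 1 / 2 * ((((1 + r ^ 2)⁻¹ : ℝ) : ℂ) * circlePoint r ^ l)
          + 1 / 2 * circlePoint r ^ (l + 2) := by
      intro r
      have h1 := one_add_mul_I_ne_zero r
      have h2 := one_sub_mul_I_ne_zero r
      have h3 : (((1 + r ^ 2)⁻¹ : ℝ) : ℂ) = ((1 + r * Complex.I) * (1 - r * Complex.I))⁻¹ := by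
        push_cast
        congr 1
        linear_combination (r ^ 2 : ℂ) * Complex.I_sq
      rw [h3, pow_add, pow_add]
      have h4 : circlePoint r ^ 1 = (1 + r * Complex.I)⁻¹ := pow_one _
      have h5 : circlePoint r ^ 2 = ((1 + r * Complex.I) ^ 2)⁻¹ := by rw [circlePoint, inv_pow]
      rw [h4, h5]
      field_simp
      ring
    simp only [hid]
    rw [integral_add ((hint l).const_mul _) ((integrable_circlePoint_pow l).const_mul _),
      integral_const_mul, integral_const_mul, ih, integral_circlePoint_pow]
    ring

/-- The mean value property, integrated against a rapidly decreasing weight in a second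
variable. -/
theorem integral_evalEval_circlePoint {ρ : ℂ → ℂ} (hρ : ∀ k : ℕ, Integrable fun w => w ^ k * ρ w)
    (B : Polynomial (Polynomial ℂ)) :
    (∀ θ : ℂ, Integrable fun w => B.evalEval w θ * ρ w) ∧
    Integrable (fun r : ℝ => (((1 + r ^ 2)⁻¹ : ℝ) : ℂ) *
      ∫ w, B.evalEval w (circlePoint r) * ρ w) ∧
    ∫ r : ℝ, (((1 + r ^ 2)⁻¹ : ℝ) : ℂ) * ∫ w, B.evalEval w (circlePoint r) * ρ w
      = Real.pi * ∫ w, B.evalEval w (1 / 2) * ρ w := by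
  induction B using Polynomial.induction_on' with
  | add A B hA hB =>
    have h1 : ∀ θ : ℂ, (fun w => (A + B).evalEval w θ * ρ w)
        = fun w => A.evalEval w θ * ρ w + B.evalEval w θ * ρ w := fun θ => by
      funext w
      rw [Polynomial.evalEval_add, add_mul]
    have h2 : ∀ θ : ℂ, ∫ w, (A + B).evalEval w θ * ρ w
        = (∫ w, A.evalEval w θ * ρ w) + ∫ w, B.evalEval w θ * ρ w := fun θ => by
      rw [h1, integral_add (hA.1 θ) (hB.1 θ)]
    simp only [h2, mul_add]
    refine ⟨fun θ => ?_, hA.2.1.add hB.2.1, ?_⟩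
    · rw [h1]
      exact (hA.1 θ).add (hB.1 θ)
    · rw [integral_add hA.2.1 hB.2.1, hA.2.2, hB.2.2]
  | monomial l b =>
    have hb : Integrable fun w => b.eval w * ρ w := by
      simp only [Polynomial.eval_eq_sum_range, Finset.sum_mul, mul_assoc]
      exact integrable_finsetSum _ fun k _ => (hρ k).const_mul _
    have h1 : ∀ θ : ℂ, (fun w => (Polynomial.monomial l b).evalEval w θ * ρ w)
        = fun w => θ ^ l * (b.eval w * ρ w) := fun θ => by
      funext w
      simp [Polynomial.evalEval, Polynomial.eval_monomial]
      ring
    have h2 : ∀ θ : ℂ, ∫ w, (Polynomial.monomial l b).evalEval w θ * ρ w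
        = θ ^ l * ∫ w, b.eval w * ρ w := fun θ => by rw [h1, integral_const_mul]
    obtain ⟨h3, h4⟩ := integral_circlePoint_pow_mul l
    simp only [h2, ← mul_assoc]
    refine ⟨fun θ => ?_, h3.mul_const _, ?_⟩
    · rw [h1]
      exact hb.const_mul _
    · rw [integral_mul_const, h4]

theorem integral_comp_mul_add (a z : ℂ) (ha : a ≠ 0) (K : ℂ → ℂ) :
    ∫ x : ℂ, K (a * x + z) = (((Complex.normSq a)⁻¹ : ℝ) : ℂ) * ∫ w, K w := by
  have hdet : LinearMap.det (LinearMap.mul ℝ ℂ a) = Complex.normSq a := by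
    rw [← Algebra.norm_complex_apply, Algebra.norm_apply]
    rfl
  have hne : LinearMap.det (LinearMap.mul ℝ ℂ a) ≠ 0 := by
    rw [hdet]
    exact (Complex.normSq_pos.2 ha).ne'
  have hmap := Measure.map_linearMap_addHaar_eq_smul_addHaar (volume : Measure ℂ) hne
  have hemb : MeasurableEmbedding (fun x : ℂ => a * x) :=
    (Homeomorph.mulLeft₀ a ha).measurableEmbedding
  calc ∫ x : ℂ, K (a * x + z) = ∫ y, K (y + z) ∂(Measure.map (fun x : ℂ => a * x) volume) :=
        (hemb.integral_map fun y => K (y + z)).symm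
    _ = ∫ y, K (y + z) ∂(ENNReal.ofReal |(Complex.normSq a)⁻¹| • (volume : Measure ℂ)) := by
        rw [← hdet, ← hmap]
        rfl
    _ = _ := by
        rw [integral_smul_measure, integral_add_right_eq_self,
          ENNReal.toReal_ofReal (abs_nonneg _),
          abs_of_nonneg (inv_nonneg.2 (Complex.normSq_nonneg a))]
        rfl

theorem gaussian_mul_gaussian (x y w z : ℂ) (h : ‖x‖ ^ 2 + ‖y‖ ^ 2 = ‖w‖ ^ 2 + ‖z‖ ^ 2) :
    gaussian x * gaussian y = gaussian w * gaussian z := by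
  simp only [gaussian, ← Complex.ofReal_mul, ← Real.exp_add]
  congr 2
  linarith

theorem pow_mul_gaussian (k : ℕ) (w : ℂ) :
    w ^ k * gaussian w = ((Real.sqrt (Real.pi * k.factorial) : ℝ) : ℂ) * holFun k w := by
  rw [holFun_apply, ← mul_assoc, ← Complex.ofReal_mul, mul_inv_cancel₀ (by positivity),
    Complex.ofReal_one, one_mul]

theorem integrable_pow_mul_gaussian_mul_conj (h : 𝓢(ℂ, ℂ)) (k : ℕ) :
    Integrable fun w => w ^ k * (gaussian w * conj (h w)) := by
  obtain ⟨C, hC⟩ := h.decay 0 0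
  have h1 := integrable_mul_schwartz (f := fun w => conj (h w))
    (Complex.continuous_conj.comp h.continuous) (C := C)
    (fun w => by simpa using hC.2 w) (holFun k)
  refine (h1.const_mul ((Real.sqrt (Real.pi * k.factorial) : ℝ) : ℂ)).congr
    (Eventually.of_forall fun w => ?_)
  simp only []
  linear_combination (-conj (h w)) * pow_mul_gaussian k w

/-- In the variable `w = x + r x^⊥ + z` the Gaussian factors decouple, and the integral in `r` is
given by the mean value property. -/
theorem trilinear_polynomial_mul_gaussian (p q : Polynomial ℂ) (h : 𝓢(ℂ, ℂ)) (z : ℂ) :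
    trilinear (fun z => p.eval z * gaussian z) (fun z => q.eval z * gaussian z) h z
      = Real.pi * gaussian z * ∫ w, p.eval ((w + z) / 2) * q.eval ((w + z) / 2) *
          (gaussian w * conj (h w)) := by
  let ρ : ℂ → ℂ := fun w => gaussian w * conj (h w)
  have hρ : ∀ k : ℕ, Integrable fun w => w ^ k * ρ w := integrable_pow_mul_gaussian_mul_conj h
  let ι : ℂ →+* Polynomial (Polynomial ℂ) := (C : Polynomial ℂ →+* _).comp C
  -- with `θ = circlePoint r`, the points `x + z` and `r x^⊥ + z` are the barycentres
  -- `θ w + (1 - θ) z` and `(1 - θ) w + θ z`; in `Polynomial (Polynomial ℂ)` the outer variable is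
  -- `θ` and the inner one is `w`
  let a : Polynomial (Polynomial ℂ) := X * C X + (1 - X) * ι z
  let b : Polynomial (Polynomial ℂ) := (1 - X) * C X + X * ι z
  let B : Polynomial (Polynomial ℂ) := p.eval₂ ι a * q.eval₂ ι b
  have hev : ∀ (p : Polynomial ℂ) (a : Polynomial (Polynomial ℂ)) (w θ : ℂ),
      (p.eval₂ ι a).evalEval w θ = p.eval (a.evalEval w θ) := by
    intro p a w θ
    have := Polynomial.hom_eval₂ p ι (Polynomial.evalEvalRingHom w θ) a
    simp only [Polynomial.coe_evalEvalRingHom] at this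
    rw [this, Polynomial.eval]
    congr 1
    ext c
    simp [ι]
  have hB : ∀ w θ : ℂ, B.evalEval w θ
      = p.eval (θ * w + (1 - θ) * z) * q.eval ((1 - θ) * w + θ * z) := by
    intro w θ
    rw [Polynomial.evalEval_mul, hev, hev]
    simp [a, b, ι, Polynomial.evalEval, mul_comm z θ]
  have hinner : ∀ r : ℝ, (∫ x : ℂ, p.eval (x + z) * gaussian (x + z) *
      (q.eval (r * (Complex.I * x) + z) * gaussian (r * (Complex.I * x) + z)) *
      conj (h (x + r * (Complex.I * x) + z)))
      = gaussian z * ((((1 + r ^ 2)⁻¹ : ℝ) : ℂ) * ∫ w, B.evalEval w (circlePoint r) * ρ w) := by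
    intro r
    have hr := one_add_mul_I_ne_zero r
    rw [← normSq_one_add_mul_I,
      ← integral_comp_mul_add (1 + r * Complex.I) z hr, ← integral_const_mul]
    refine integral_congr_ae (Eventually.of_forall fun x => ?_)
    simp only []
    have e1 : circlePoint r * ((1 + r * Complex.I) * x + z) + (1 - circlePoint r) * z = x + z := by
      rw [circlePoint]
      field_simp
      ring
    have e2 : (1 - circlePoint r) * ((1 + r * Complex.I) * x + z) + circlePoint r * z
        = r * (Complex.I * x) + z := by
      rw [circlePoint]
      field_simp
      ring
    have e3 : x + r * (Complex.I * x) + z = (1 + r * Complex.I) * x + z := by ring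
    rw [hB, e1, e2, e3]
    -- the segments from `z` to `x + z` and to `r x^⊥ + z` span a rectangle with opposite vertices
    -- `z` and `w`
    have hg := gaussian_mul_gaussian (x + z) (r * (Complex.I * x) + z)
      ((1 + r * Complex.I) * x + z) z (by
        simp only [Complex.sq_norm, Complex.normSq_apply, Complex.add_re, Complex.add_im,
          Complex.mul_re, Complex.mul_im, Complex.I_re, Complex.I_im, Complex.ofReal_re,
          Complex.ofReal_im, Complex.one_re, Complex.one_im]
        ring)
    linear_combination (p.eval (x + z) * q.eval (r * (Complex.I * x) + z) *
      conj (h ((1 + r * Complex.I) * x + z))) * hg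
  rw [trilinear]
  simp only [hinner]
  rw [integral_const_mul, (integral_evalEval_circlePoint hρ B).2.2]
  have e4 : ∀ w : ℂ, (1 / 2 : ℂ) * w + (1 - 1 / 2) * z = (w + z) / 2 := fun w => by ring
  have e5 : ∀ w : ℂ, (1 - 1 / 2 : ℂ) * w + 1 / 2 * z = (w + z) / 2 := fun w => by ring
  simp only [hB, e4, e5]
  ring

theorem sum_antidiagonal_smul_hermiteFun (V : ℕ → ℂ) (N : ℕ) :
    ∑ n ∈ Finset.range (N + 1), ∑ q ∈ Finset.HasAntidiagonal.antidiagonal n,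
      (if q.2 = 0 then V q.1 else 0) • hermiteFun q.1 q.2
      = ∑ n ∈ Finset.range (N + 1), V n • holFun n := by
  refine Finset.sum_congr rfl fun n _ => ?_
  rw [Finset.sum_eq_single (n, 0)]
  · rw [if_pos rfl]
    rfl
  · rintro ⟨a, b⟩ hq hne
    rw [if_neg, zero_smul]
    rintro rfl
    rw [Finset.HasAntidiagonal.mem_antidiagonal] at hq
    exact hne (by simpa using hq)
  · intro h
    exact absurd (Finset.HasAntidiagonal.mem_antidiagonal.2 (add_zero n)) h

theorem proj_holSeries {c : ℕ → ℂ} (hc : LinearGrowth c) (N : ℕ) :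
    proj N (holSeries c) = ∑ n ∈ Finset.range (N + 1), c n • holFun n := by
  rw [← sum_antidiagonal_smul_hermiteFun, proj]
  simp only [coeff_holSeries hc]

theorem integral_mul_conj_holFun (f : 𝓢(ℂ, ℂ)) (j k : ℕ) :
    ∫ z, f z * conj (hermiteFun j k z) = pair f (hermiteFun k j) := by
  rw [pair_eq_integral]
  simp only [conj_hermiteFun]

theorem pair_sum_left {ι : Type*} (A : Finset ι) (f : ι → 𝓢(ℂ, ℂ)) (g : 𝓢(ℂ, ℂ)) :
    pair (∑ i ∈ A, f i) g = ∑ i ∈ A, pair (f i) g :=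
  map_sum (SchwartzMap.toTemperedDistributionCLM ℂ ℂ volume g) f A

theorem integral_pow_mul_gaussian_mul_conj (c : ℕ → ℂ) (N m : ℕ) :
    ∫ w, w ^ m * (gaussian w * conj ((∑ n ∈ Finset.range (N + 1), c n • holFun n) w))
      = if m ∈ Finset.range (N + 1) then
          ((Real.sqrt (Real.pi * m.factorial) : ℝ) : ℂ) * conj (c m) else 0 := by
  set h : 𝓢(ℂ, ℂ) := ∑ n ∈ Finset.range (N + 1), c n • holFun n with hh
  have h1 : ∀ w, w ^ m * (gaussian w * conj (h w)) = ((Real.sqrt (Real.pi * m.factorial) : ℝ) : ℂ)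
      * conj (h w * conj (holFun m w)) := fun w => by
    rw [map_mul, Complex.conj_conj]
    linear_combination (conj (h w)) * pow_mul_gaussian m w
  simp only [h1]
  rw [integral_const_mul, integral_conj, holFun, integral_mul_conj_holFun, hh, pair_sum_left]
  simp only [pair_smul_left, holFun, pair_hermiteFun, and_true]
  simp only [mul_ite, mul_one, mul_zero]
  rw [Finset.sum_ite_eq']
  split_ifs <;> simp

/-- The coefficient computed from the mean value property and the binomial formula, in symmetric
form. -/
theorem interaction_mul_norm_const (i j m : ℕ) (hm : m ≤ i + j) :
    (Real.sqrt (Real.pi * i.factorial))⁻¹ * (Real.sqrt (Real.pi * j.factorial))⁻¹ *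
      (1 / 2) ^ (i + j) * (i + j).choose m * Real.sqrt (Real.pi * m.factorial)
      = interaction i j (i + j - m) m * (Real.sqrt (Real.pi * (i + j - m).factorial))⁻¹ := by
  -- both sides are nonnegative, and their squares are rational in factorials and `π`
  refine (sq_eq_sq₀ (by positivity)
    (mul_nonneg (interaction_nonneg _ _ _ _) (by positivity))).1 ?_
  rw [interaction, if_pos (by omega)]
  simp only [mul_pow, inv_pow, binomialWeight_sq]
  rw [Real.sq_sqrt (by positivity), Real.sq_sqrt (by positivity), Real.sq_sqrt (by positivity),
    Real.sq_sqrt (by positivity), Nat.choose_symm hm]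
  have h1 : ((i + j).choose m : ℝ) * m.factorial * (i + j - m).factorial = (i + j).factorial := by
    exact_mod_cast Nat.choose_mul_factorial_mul_factorial hm
  have h2 : ((i + j).choose i : ℝ) * i.factorial * j.factorial = (i + j).factorial := by
    have := Nat.choose_mul_factorial_mul_factorial (Nat.le_add_right i j)
    rw [Nat.add_sub_cancel_left] at this
    exact_mod_cast this
  rw [← h2] at h1
  rw [one_div_pow]
  field_simp
  linear_combination ((i + j).choose m : ℝ) * h1

/-- The Hermite expansion of `𝒯(u, u, u)` for a finite sum `u` of holomorphic Hermite
functions. -/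
theorem trilinear_holFun_sum (c : ℕ → ℂ) (N : ℕ) :
    let h : 𝓢(ℂ, ℂ) := ∑ n ∈ Finset.range (N + 1), c n • holFun n
    trilinear h h h = ⇑(∑ i ∈ Finset.range (N + 1), ∑ j ∈ Finset.range (N + 1),
      ∑ m ∈ Finset.range (N + 1), (if m ∈ Finset.range (i + j + 1) then
        Real.pi * (interaction i j (i + j - m) m : ℂ) * (c i * c j * conj (c m)) else 0) •
          holFun (i + j - m)) := by
  intro h
  let ν : ℕ → ℂ := fun n => (((Real.sqrt (Real.pi * n.factorial))⁻¹ : ℝ) : ℂ)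
  let p : Polynomial ℂ := ∑ n ∈ Finset.range (N + 1), Polynomial.monomial n (c n * ν n)
  have hp : ∀ z, p.eval z = ∑ n ∈ Finset.range (N + 1), c n * ν n * z ^ n := fun z => by
    simp only [p, Polynomial.eval_finsetSum, Polynomial.eval_monomial]
  have hh : (h : ℂ → ℂ) = fun z => p.eval z * gaussian z := by
    funext z
    simp only [h, sum_apply, smul_apply, hp, Finset.sum_mul, holFun_apply, smul_eq_mul]
    refine Finset.sum_congr rfl fun n _ => ?_
    simp only [ν]
    ring
  have hmom := integral_pow_mul_gaussian_mul_conj c N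
  funext z
  have h1 : trilinear h h h z = Real.pi * gaussian z *
      ∫ w, p.eval ((w + z) / 2) * p.eval ((w + z) / 2) * (gaussian w * conj (h w)) := by
    rw [← trilinear_polynomial_mul_gaussian, ← hh]
  have hint := integrable_pow_mul_gaussian_mul_conj h
  have h2 : ∀ w, p.eval ((w + z) / 2) * p.eval ((w + z) / 2) * (gaussian w * conj (h w))
      = ∑ i ∈ Finset.range (N + 1), ∑ j ∈ Finset.range (N + 1), ∑ m ∈ Finset.range (i + j + 1),
        (c i * ν i * (c j * ν j) * (1 / 2) ^ (i + j) * z ^ (i + j - m) * (i + j).choose m) *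
          (w ^ m * (gaussian w * conj (h w))) := fun w => by
    rw [hp, Finset.sum_mul_sum, Finset.sum_mul]
    refine Finset.sum_congr rfl fun i _ => ?_
    rw [Finset.sum_mul]
    refine Finset.sum_congr rfl fun j _ => ?_
    have e : c i * ν i * ((w + z) / 2) ^ i * (c j * ν j * ((w + z) / 2) ^ j)
        = c i * ν i * (c j * ν j) * (1 / 2) ^ (i + j) * (w + z) ^ (i + j) := by
      rw [div_eq_mul_one_div, mul_pow, mul_pow, pow_add, pow_add]
      ring
    rw [e, add_pow, Finset.mul_sum, Finset.sum_mul]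
    exact Finset.sum_congr rfl fun m _ => by ring
  rw [h1]
  simp only [h2]
  rw [integral_finsetSum _ fun i _ => integrable_finsetSum _ fun j _ =>
    integrable_finsetSum _ fun m _ => (hint m).const_mul _]
  simp only [sum_apply, smul_apply]
  rw [Finset.mul_sum]
  refine Finset.sum_congr rfl fun i _ => ?_
  rw [integral_finsetSum _ fun j _ => integrable_finsetSum _ fun m _ => (hint m).const_mul _,
    Finset.mul_sum]
  refine Finset.sum_congr rfl fun j _ => ?_
  rw [integral_finsetSum _ fun m _ => (hint m).const_mul _]
  simp only [integral_const_mul, hmom, h, mul_ite, mul_zero, ite_smul, zero_smul]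
  rw [Finset.sum_ite_mem, Finset.sum_ite_mem, Finset.inter_comm, Finset.mul_sum]
  refine Finset.sum_congr rfl fun m hm => ?_
  have hm' : m ≤ i + j := by
    have := (Finset.mem_inter.1 hm).2
    rw [Finset.mem_range] at this
    omega
  have key := congrArg (fun x : ℝ => (x : ℂ)) (interaction_mul_norm_const i j m hm')
  push_cast at key
  rw [holFun_apply, smul_eq_mul]
  simp only [ν]
  push_cast
  linear_combination (Real.pi * gaussian z * c i * c j * z ^ (i + j - m) * conj (c m)) * key

/-- In Hermite coefficients, `𝒯_N` is the truncated field. -/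
theorem coeff_truncated {c : ℕ → ℂ} (hc : LinearGrowth c) (N j k : ℕ) :
    coeff (truncated N (holSeries c)) j k = if k = 0 then truncatedField N j c else 0 := by
  let V : ℕ → ℂ := fun a => ∑ i ∈ Finset.range (N + 1), ∑ j ∈ Finset.range (N + 1),
    ∑ m ∈ Finset.range (N + 1), Real.pi * ((interaction i j a m : ℂ) * (c i * c j * conj (c m)))
  have hV : ∀ a b : ℕ, pair (∑ i ∈ Finset.range (N + 1), ∑ j ∈ Finset.range (N + 1),
      ∑ m ∈ Finset.range (N + 1), (if m ∈ Finset.range (i + j + 1) then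
        Real.pi * (interaction i j (i + j - m) m : ℂ) * (c i * c j * conj (c m)) else 0) •
          holFun (i + j - m)) (hermiteFun b a) = if b = 0 then V a else 0 := by
    intro a b
    simp only [pair_sum_left, pair_smul_left, holFun, pair_hermiteFun]
    by_cases hb : b = 0
    · rw [if_pos hb]
      refine Finset.sum_congr rfl fun i _ => Finset.sum_congr rfl fun j _ =>
        Finset.sum_congr rfl fun m _ => ?_
      simp only [hb, and_true]
      by_cases h : i + j = a + m
      · rw [if_pos (Finset.mem_range.2 (by omega)), if_pos (by omega), mul_one, mul_assoc,
          show i + j - m = a by omega]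
      · rw [interaction_eq_zero h]
        by_cases h1 : m ∈ Finset.range (i + j + 1)
        · rw [Finset.mem_range] at h1
          rw [if_neg (show ¬ i + j - m = a by omega)]
          simp
        · rw [if_neg h1]
          simp
    · simp [hb, Ne.symm hb]
  have hproj : projFun N (trilinear (proj N (holSeries c)) (proj N (holSeries c))
      (proj N (holSeries c))) = ∑ n ∈ Finset.range (N + 1), V n • holFun n := by
    rw [proj_holSeries hc, trilinear_holFun_sum, projFun, ← sum_antidiagonal_smul_hermiteFun]
    simp only [integral_mul_conj_holFun, hV]
  have hcoeff : coeff (truncated N (holSeries c)) j k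
      = pair (∑ n ∈ Finset.range (N + 1), V n • holFun n) (hermiteFun k j) := by
    rw [truncated, hproj, pair_comm]
    rfl
  rw [hcoeff]
  simp only [pair_sum_left, pair_smul_left, holFun, pair_hermiteFun]
  by_cases hk : k = 0
  · simp only [hk, and_true, mul_ite, mul_one, mul_zero, if_true, truncatedField]
    rw [Finset.sum_ite_eq']
    simp only [Finset.mem_range, Nat.lt_succ_iff, V, Finset.mul_sum]
  · simp [hk, Ne.symm hk]

end Trilinear

/-! ### The nonlinearity on the support of white noise -/

section Nonlinearity

open scoped NNReal

/-- `τₙ` is the limit in `L²` of the `n`-th coefficient of the truncated nonlinearities. -/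
structure IsLimitField (τ : ℕ → (ℕ → ℂ) → ℂ) : Prop where
  measurable : ∀ n, Measurable (τ n)
  exists_bound : ∃ C : ℝ≥0, (∀ N n, ∫⁻ c, ‖truncatedField N n c‖ₑ ^ 2 ∂gaussianSeq ≤ C) ∧
    ∀ n, ∫⁻ c, ‖τ n c‖ₑ ^ 2 ∂gaussianSeq ≤ C
  tendsto : ∀ n, Tendsto (fun N => ∫⁻ c, ‖truncatedField N n c - τ n c‖ₑ ^ 2 ∂gaussianSeq) atTop
    (𝓝 0)

variable {τ : ℕ → (ℕ → ℂ) → ℂ}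

theorem IsLimitField.measurable_pi (h : IsLimitField τ) : Measurable fun c n => τ n c :=
  measurable_pi_lambda _ h.measurable

theorem IsLimitField.lintegral_seqNormSq_lt_top (h : IsLimitField τ) {σ : ℝ} (hσ : 1 < σ) :
    ∫⁻ c, seqNormSq (-σ) (fun n => τ n c) ∂gaussianSeq < ∞ := by
  obtain ⟨C, -, hC⟩ := h.exists_bound
  exact CRSystem.lintegral_seqNormSq_lt_top hσ h.measurable ENNReal.coe_ne_top hC

theorem IsLimitField.ae_negSobolev (h : IsLimitField τ) :
    ∀ᵐ c ∂gaussianSeq, NegSobolev fun n => τ n c := by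
  obtain ⟨C, -, hC⟩ := h.exists_bound
  exact CRSystem.ae_negSobolev h.measurable ENNReal.coe_ne_top hC

theorem sq_enorm_sub_le (a b : ℂ) : ‖a - b‖ₑ ^ 2 ≤ 2 * ‖a‖ₑ ^ 2 + 2 * ‖b‖ₑ ^ 2 := by
  simpa [sub_eq_add_neg] using sq_enorm_add_le a (-b)

theorem lintegral_sq_enorm_sub_le {α : Type*} [MeasurableSpace α] {μ : Measure α} {f g : α → ℂ}
    (hf : AEMeasurable f μ) (hg : AEMeasurable g μ) :
    ∫⁻ a, ‖f a - g a‖ₑ ^ 2 ∂μ ≤ 2 * ∫⁻ a, ‖f a‖ₑ ^ 2 ∂μ + 2 * ∫⁻ a, ‖g a‖ₑ ^ 2 ∂μ := by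
  have hf2 : AEMeasurable (fun a => ‖f a‖ₑ ^ 2) μ := hf.enorm.pow_const 2
  have hg2 : AEMeasurable (fun a => ‖g a‖ₑ ^ 2) μ := hg.enorm.pow_const 2
  rw [← lintegral_const_mul'' _ hf2, ← lintegral_const_mul'' _ hg2,
    ← lintegral_add_left' (hf2.const_mul 2)]
  exact lintegral_mono fun a => sq_enorm_sub_le _ _

theorem IsLimitField.tendsto_seqNormSq (h : IsLimitField τ) {σ : ℝ} (hσ : 1 < σ) :
    Tendsto (fun N => ∫⁻ c, seqNormSq (-σ) (fun n => truncatedField N n c - τ n c) ∂gaussianSeq)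
      atTop (𝓝 0) := by
  obtain ⟨C, hC, hCτ⟩ := h.exists_bound
  have hm : ∀ N n, Measurable fun c => truncatedField N n c - τ n c := fun N n =>
    (continuous_truncatedField N n).measurable.sub (h.measurable n)
  have hb : ∀ N n, ∫⁻ c, ‖truncatedField N n c - τ n c‖ₑ ^ 2 ∂gaussianSeq ≤ 2 * C + 2 * C := by
    intro N n
    refine (lintegral_sq_enorm_sub_le (continuous_truncatedField N n).measurable.aemeasurable
      (h.measurable n).aemeasurable).trans ?_
    gcongr
    · exact hC N n
    · exact hCτ n
  have he : ∀ N, ∫⁻ c, seqNormSq (-σ) (fun n => truncatedField N n c - τ n c) ∂gaussianSeq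
      = ∫⁻ n, sobolevWeight (-σ) n *
          ∫⁻ c, ‖truncatedField N n c - τ n c‖ₑ ^ 2 ∂gaussianSeq ∂Measure.count := fun N => by
    rw [lintegral_count, lintegral_seqNormSq _ (hm N)]
  simp only [he]
  have h0 : ∫⁻ _ : ℕ, (0 : ℝ≥0∞) ∂Measure.count = 0 := lintegral_zero
  rw [← h0]
  refine tendsto_lintegral_of_dominated_convergence
    (fun n => sobolevWeight (-σ) n * (2 * C + 2 * C)) (fun N => measurable_from_nat)
    (fun N => Eventually.of_forall fun n => ?_) ?_ (Eventually.of_forall fun n => ?_)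
  · exact mul_le_mul_right (hb N n) _
  · rw [lintegral_count, ENNReal.tsum_mul_right]
    exact ENNReal.mul_ne_top (tsum_sobolevWeight_lt_top hσ).ne (by finiteness)
  · have := ENNReal.Tendsto.const_mul (a := sobolevWeight (-σ) n) (h.tendsto n)
      (Or.inr ENNReal.ofReal_ne_top)
    rwa [mul_zero] at this

/-- The coefficients of a distribution on the holomorphic Hermite functions. -/
def holCoeff (f : 𝓢'(ℂ, ℂ)) (n : ℕ) : ℂ := coeff f n 0

theorem measurable_holCoeff : Measurable holCoeff :=
  measurable_pi_lambda _ fun n => measurable_coeff n 0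

theorem holCoeff_holSeries {c : ℕ → ℂ} (hc : LinearGrowth c) : holCoeff (holSeries c) = c := by
  funext n
  rw [holCoeff, coeff_holSeries hc, if_pos rfl]

/-- The nonlinearity with Hermite coefficients `τₙ`. -/
def nonlinearity (τ : ℕ → (ℕ → ℂ) → ℂ) (f : 𝓢'(ℂ, ℂ)) : 𝓢'(ℂ, ℂ) :=
  holSeries fun n => τ n (holCoeff f)

theorem nonlinearity_holSeries {c : ℕ → ℂ} (hc : LinearGrowth c) :
    nonlinearity τ (holSeries c) = holSeries fun n => τ n c := by
  rw [nonlinearity, holCoeff_holSeries hc]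

theorem IsLimitField.isNonlinearity (h : IsLimitField τ) :
    IsNonlinearity (gaussianSeq.map holSeries) (nonlinearity τ) := by
  refine ⟨(measurable_holSeries.comp (h.measurable_pi.comp measurable_holCoeff)).aemeasurable,
    fun σ hσ => ?_⟩
  refine tendsto_of_tendsto_of_tendsto_of_le_of_le tendsto_const_nhds (h.tendsto_seqNormSq hσ)
    (fun _ => zero_le) fun N => ?_
  refine (lintegral_map_le _ _).trans (lintegral_mono_ae ?_)
  filter_upwards [ae_negSobolev_gaussianSeq, h.ae_negSobolev] with c hc hτc
  refine (sobolevNormSq_eq_seqNormSq fun j k => ?_).le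
  have hs : ∀ u v : 𝓢'(ℂ, ℂ), coeff (u - v) j k = coeff u j k - coeff v j k := fun u v => by
    simp only [coeff, sub_apply]
  rw [hs, nonlinearity_holSeries hc.linearGrowth, coeff_truncated hc.linearGrowth,
    coeff_holSeries hτc.linearGrowth]
  split_ifs <;> simp

theorem measurableSet_holomorphic : MeasurableSet {v : 𝓢'(ℂ, ℂ) |
    ∀ j k, coeff v j k = if k = 0 then holCoeff v j else 0} := by
  simp only [Set.ofPred_forall]
  refine MeasurableSet.iInter fun j => MeasurableSet.iInter fun k =>
    measurableSet_eq_fun (measurable_coeff j k) ?_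
  split_ifs
  · exact measurable_coeff j 0
  · exact measurable_const

/-- The white noise measure is carried by the distributions `∑ cₙ φₙ`, on which the coefficients of
`𝒯_N` are polynomials. -/
theorem aemeasurable_coeff_truncated (N j k : ℕ) :
    AEMeasurable (fun v => coeff (truncated N v) j k) (gaussianSeq.map holSeries) := by
  have hae : ∀ᵐ v ∂gaussianSeq.map holSeries, LinearGrowth (holCoeff v) ∧
      ∀ j k, coeff v j k = if k = 0 then holCoeff v j else 0 := by
    refine (ae_map_iff measurable_holSeries.aemeasurable
      ((measurable_holCoeff measurableSet_linearGrowth).inter measurableSet_holomorphic)).2 ?_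
    filter_upwards [ae_negSobolev_gaussianSeq] with c hc
    change LinearGrowth (holCoeff (holSeries c)) ∧ ∀ j k, coeff (holSeries c) j k
      = if k = 0 then holCoeff (holSeries c) j else 0
    rw [holCoeff_holSeries hc.linearGrowth]
    exact ⟨hc.linearGrowth, coeff_holSeries hc.linearGrowth⟩
  refine ⟨fun v => if k = 0 then truncatedField N j (holCoeff v) else 0, ?_, ?_⟩
  · split_ifs
    · exact (continuous_truncatedField N j).measurable.comp measurable_holCoeff
    · exact measurable_const
  · filter_upwards [hae] with v hv
    conv_lhs => rw [eq_holSeries hv.1 hv.2]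
    exact coeff_truncated hv.1 N j k

/-- The nonlinearity is unique up to null sets, as soon as the truncations are measurable. -/
theorem IsNonlinearity.ae_eq {μ : Measure 𝓢'(ℂ, ℂ)} {T T' : 𝓢'(ℂ, ℂ) → 𝓢'(ℂ, ℂ)}
    (hT : IsNonlinearity μ T) (hT' : IsNonlinearity μ T')
    (hm : ∀ N j k, AEMeasurable (fun v => coeff (truncated N v) j k) μ) : T =ᵐ[μ] T' := by
  have hcoeff : ∀ j k, ∀ᵐ v ∂μ, coeff (T v) j k = coeff (T' v) j k := by
    intro j k
    have hA : AEMeasurable (fun v => coeff (T v) j k) μ :=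
      (measurable_coeff j k).comp_aemeasurable hT.aemeasurable
    have hB : AEMeasurable (fun v => coeff (T' v) j k) μ :=
      (measurable_coeff j k).comp_aemeasurable hT'.aemeasurable
    have hlim : ∀ {S : 𝓢'(ℂ, ℂ) → 𝓢'(ℂ, ℂ)}, IsNonlinearity μ S →
        Tendsto (fun N => ∫⁻ v, ‖coeff (truncated N v) j k - coeff (S v) j k‖ₑ ^ 2 ∂μ) atTop
          (𝓝 0) := by
      intro S hS
      set W : ℝ≥0∞ := ENNReal.ofReal ((2 * (j + k : ℝ) + 2) ^ (-2 : ℝ)) with hW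
      have hW0 : W ≠ 0 := by
        rw [hW, Ne, ENNReal.ofReal_eq_zero, not_le]
        positivity
      have hWt : W ≠ ∞ := ENNReal.ofReal_ne_top
      have h1 := ENNReal.Tendsto.const_mul (a := W⁻¹) (hS.tendsto 2 one_lt_two)
        (Or.inr (ENNReal.inv_ne_top.2 hW0))
      rw [mul_zero] at h1
      refine tendsto_of_tendsto_of_tendsto_of_le_of_le tendsto_const_nhds h1
        (fun _ => zero_le) fun N => ?_
      simp only []
      rw [← lintegral_const_mul' _ _ (ENNReal.inv_ne_top.2 hW0)]
      refine lintegral_mono fun v => ?_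
      have h2 : W * ‖coeff (truncated N v) j k - coeff (S v) j k‖ₑ ^ 2
          ≤ sobolevNormSq (-2) (truncated N v - S v) := by
        refine le_trans (le_of_eq ?_) (ENNReal.le_tsum (j, k))
        rw [ENNReal.ofReal_mul (by positivity), ENNReal.ofReal_pow (norm_nonneg _), ofReal_norm]
        simp only [coeff, sub_apply, hW]
      calc _ = W⁻¹ * (W * ‖coeff (truncated N v) j k - coeff (S v) j k‖ₑ ^ 2) := by
            rw [← mul_assoc, ENNReal.inv_mul_cancel hW0 hWt, one_mul]
        _ ≤ _ := by gcongr
    have hsum : Tendsto (fun N =>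
        2 * ∫⁻ v, ‖coeff (truncated N v) j k - coeff (T v) j k‖ₑ ^ 2 ∂μ
          + 2 * ∫⁻ v, ‖coeff (truncated N v) j k - coeff (T' v) j k‖ₑ ^ 2 ∂μ) atTop (𝓝 0) := by
      have := (ENNReal.Tendsto.const_mul (a := 2) (hlim hT) (Or.inr (by finiteness))).add
        (ENNReal.Tendsto.const_mul (a := 2) (hlim hT') (Or.inr (by finiteness)))
      simpa using this
    have hzero : ∫⁻ v, ‖coeff (T v) j k - coeff (T' v) j k‖ₑ ^ 2 ∂μ = 0 := by
      refine le_antisymm (ge_of_tendsto' hsum fun N => ?_) zero_le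
      have h1 := lintegral_sq_enorm_sub_le ((hm N j k).sub hB) ((hm N j k).sub hA)
      simp only [Pi.sub_apply, sub_sub_sub_cancel_left] at h1
      rwa [add_comm] at h1
    have hd : AEMeasurable (fun v => ‖coeff (T v) j k - coeff (T' v) j k‖ₑ ^ 2) μ :=
      (hA.sub hB).enorm.pow_const 2
    rw [lintegral_eq_zero_iff' hd] at hzero
    filter_upwards [hzero] with v hv
    have : ‖coeff (T v) j k - coeff (T' v) j k‖ₑ = 0 := by simpa using hv
    exact sub_eq_zero.1 (enorm_eq_zero.1 this)
  filter_upwards [ae_all_iff.2 fun j => ae_all_iff.2 (hcoeff j)] with v hv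
  exact ext_of_coeff hv

/-- Any representative of the nonlinearity is given by the coefficients `τₙ` on a measurable set
of full measure. -/
theorem IsLimitField.exists_measurableSet (h : IsLimitField τ) {T : 𝓢'(ℂ, ℂ) → 𝓢'(ℂ, ℂ)}
    (hT : IsNonlinearity (gaussianSeq.map holSeries) T) :
    ∃ B : Set (ℕ → ℂ), MeasurableSet B ∧ gaussianSeq Bᶜ = 0 ∧ ∀ c ∈ B,
      NegSobolev c ∧ NegSobolev (fun n => τ n c) ∧ T (holSeries c) = holSeries fun n => τ n c := by
  have h1 := ae_of_ae_map measurable_holSeries.aemeasurable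
    (hT.ae_eq h.isNonlinearity aemeasurable_coeff_truncated)
  have h2 : ∀ᵐ c ∂gaussianSeq, NegSobolev c ∧ NegSobolev (fun n => τ n c) ∧
      T (holSeries c) = holSeries fun n => τ n c := by
    filter_upwards [h1, ae_negSobolev_gaussianSeq, h.ae_negSobolev] with c hc1 hc2 hc3
    exact ⟨hc2, hc3, by rw [hc1, nonlinearity_holSeries hc2.linearGrowth]⟩
  obtain ⟨s, hs, hsm, hs0⟩ := exists_measurable_superset_of_null (mem_ae_iff.1 h2)
  refine ⟨sᶜ, hsm.compl, by rwa [compl_compl], fun c hc => ?_⟩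
  by_contra hn
  exact hc (hs hn)

end Nonlinearity

/-! ### Global weak solutions from trajectories -/

section Trajectories

open scoped NNReal

variable {τ : ℕ → (ℕ → ℂ) → ℂ} {B : Set (ℕ → ℂ)} {x : PathSpace}

/-- A path of Hermite coefficients which gives rise to a global weak solution of the equation with
velocity field `τ`, and which spends almost all times in `B`. -/
structure IsTrajectory (τ : ℕ → (ℕ → ℂ) → ℂ) (B : Set (ℕ → ℂ)) (x : PathSpace) : Prop where
  defect_eq : ∀ (n : ℕ) (t : ℚ), defect (τ n) n t x = 0
  ae_mem : ∀ᵐ s : ℝ, pathAt x s ∈ B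
  sq_integrable : ∀ m R : ℕ, ∫⁻ s in Set.Icc (-(R : ℝ)) R,
    seqNormSq (-(1 + 1 / ((m : ℝ) + 1))) (fun n => τ n (pathAt x s)) < ∞
  initial : NegSobolev (pathAt x 0)

/-- Each condition holds almost surely at a given time or in mean over a bounded time interval,
because the marginal laws are Gaussian. -/
theorem ae_isTrajectory (h : IsLimitField τ) {ν : Measure PathSpace} [IsProbabilityMeasure ν]
    (hmarg : ∀ t, ν.map (fun x => pathAt x t) = gaussianSeq)
    (hdef : ∀ n t, ∀ᵐ x ∂ν, defect (τ n) n t x = 0) (hB : MeasurableSet B)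
    (hB0 : gaussianSeq Bᶜ = 0) : ∀ᵐ x ∂ν, IsTrajectory τ B x := by
  have h1 : ∀ᵐ x ∂ν, ∀ (n : ℕ) (t : ℚ), defect (τ n) n t x = 0 :=
    ae_all_iff.2 fun n => ae_all_iff.2 fun t => hdef n t
  have h2 : ∀ᵐ x : PathSpace ∂ν, ∀ᵐ s : ℝ, pathAt x s ∈ B := by
    have hm : Measurable (Bᶜ.indicator fun _ => (1 : ℝ≥0∞)) := measurable_const.indicator hB.compl
    have h3 := lintegral_lintegral_at hmarg hm Set.univ
    rw [lintegral_indicator hB.compl, lintegral_const, Measure.restrict_apply_univ, hB0, mul_zero,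
      mul_zero] at h3
    simp only [Measure.restrict_univ] at h3
    have hm2 : Measurable fun q : PathSpace × ℝ =>
        Bᶜ.indicator (fun _ => (1 : ℝ≥0∞)) (pathAt q.1 q.2) :=
      hm.comp continuous_pathAt_uncurry.measurable
    rw [lintegral_eq_zero_iff hm2.lintegral_prod_right'] at h3
    filter_upwards [h3] with x hx
    have hx' : ∫⁻ s : ℝ, Bᶜ.indicator (fun _ => (1 : ℝ≥0∞)) (pathAt x s) = 0 := hx
    have hmx : Measurable fun s : ℝ => Bᶜ.indicator (fun _ => (1 : ℝ≥0∞)) (pathAt x s) :=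
      hm.comp (continuous_pathAt_right x).measurable
    rw [lintegral_eq_zero_iff hmx] at hx'
    filter_upwards [hx'] with s hs
    by_contra hn
    simp [Set.indicator_of_mem (show pathAt x s ∈ Bᶜ from hn)] at hs
  have h3 : ∀ᵐ x : PathSpace ∂ν, ∀ m R : ℕ, ∫⁻ s in Set.Icc (-(R : ℝ)) R,
      seqNormSq (-(1 + 1 / ((m : ℝ) + 1))) (fun n => τ n (pathAt x s)) < ∞ := by
    refine ae_all_iff.2 fun m => ae_all_iff.2 fun R => ?_
    have hm : Measurable fun c => seqNormSq (-(1 + 1 / ((m : ℝ) + 1))) (fun n => τ n c) :=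
      (measurable_seqNormSq _).comp h.measurable_pi
    have h4 := lintegral_lintegral_at hmarg hm (Set.Icc (-(R : ℝ)) R)
    have hm2 : Measurable fun q : PathSpace × ℝ =>
        seqNormSq (-(1 + 1 / ((m : ℝ) + 1))) (fun n => τ n (pathAt q.1 q.2)) :=
      hm.comp continuous_pathAt_uncurry.measurable
    refine ae_lt_top hm2.lintegral_prod_right' ?_
    rw [h4, Real.volume_Icc]
    exact ENNReal.mul_ne_top ENNReal.ofReal_ne_top
      (h.lintegral_seqNormSq_lt_top (one_lt_one_add_inv m)).ne
  have h4 : ∀ᵐ x : PathSpace ∂ν, NegSobolev (pathAt x 0) := by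
    refine ae_of_ae_map (continuous_pathAt 0).measurable.aemeasurable ?_
    rw [hmarg 0]
    exact ae_negSobolev_gaussianSeq
  filter_upwards [h1, h2, h3, h4] with x hx1 hx2 hx3 hx4
  exact ⟨hx1, hx2, hx3, hx4⟩

theorem measurable_field_at (h : IsLimitField τ) (x : PathSpace) :
    Measurable fun (s : ℝ) (n : ℕ) => τ n (pathAt x s) :=
  h.measurable_pi.comp (continuous_pathAt_right x).measurable

theorem IsTrajectory.lintegral_lt_top (hx : IsTrajectory τ B x) {σ : ℝ} (hσ : 1 < σ) (R : ℝ) :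
    ∫⁻ s in Set.Icc (-R) R, seqNormSq (-σ) (fun n => τ n (pathAt x s)) < ∞ := by
  obtain ⟨m, hm⟩ := exists_one_add_inv_le hσ
  obtain ⟨k, hk⟩ := exists_nat_ge R
  refine lt_of_le_of_lt ?_ (hx.sq_integrable m k)
  exact (lintegral_mono_set (Set.Icc_subset_Icc (neg_le_neg hk) hk)).trans
    (lintegral_mono fun s => seqNormSq_mono hm _)

theorem exists_uIoc_subset (a b : ℝ) : ∃ R : ℝ, Set.uIoc a b ⊆ Set.Icc (-R) R := by
  refine ⟨|a| + |b|, fun s hs => ?_⟩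
  rw [Set.mem_uIoc] at hs
  have := neg_abs_le a
  have := neg_abs_le b
  have := le_abs_self a
  have := le_abs_self b
  have := abs_nonneg a
  have := abs_nonneg b
  rcases hs with ⟨h1, h2⟩ | ⟨h1, h2⟩ <;> constructor <;> linarith

theorem IsTrajectory.lintegral_component_lt_top (hx : IsTrajectory τ B x) (n : ℕ) (R : ℝ) :
    ∫⁻ s in Set.Icc (-R) R, ‖τ n (pathAt x s)‖ₑ ^ 2 < ∞ := by
  have h0 := sobolevWeight_ne_zero (-2) n
  have h1 : ∫⁻ s in Set.Icc (-R) R, ‖τ n (pathAt x s)‖ₑ ^ 2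
      ≤ ∫⁻ s in Set.Icc (-R) R, (sobolevWeight (-2) n)⁻¹ *
          seqNormSq (-2) (fun n => τ n (pathAt x s)) := by
    refine lintegral_mono fun s => ?_
    have h2 : sobolevWeight (-2) n * ‖τ n (pathAt x s)‖ₑ ^ 2
        ≤ seqNormSq (-2) (fun n => τ n (pathAt x s)) :=
      ENNReal.le_tsum (f := fun n => sobolevWeight (-2) n * ‖τ n (pathAt x s)‖ₑ ^ 2) n
    calc _ = (sobolevWeight (-2) n)⁻¹ * (sobolevWeight (-2) n * ‖τ n (pathAt x s)‖ₑ ^ 2) := by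
          rw [← mul_assoc, ENNReal.inv_mul_cancel h0 ENNReal.ofReal_ne_top, one_mul]
      _ ≤ _ := by gcongr
  refine h1.trans_lt ?_
  rw [lintegral_const_mul' _ _ (ENNReal.inv_ne_top.2 h0)]
  exact ENNReal.mul_lt_top (ENNReal.inv_lt_top.2 (pos_iff_ne_zero.2 h0))
    (hx.lintegral_lt_top one_lt_two R)

theorem IsTrajectory.intervalIntegrable (h : IsLimitField τ) (hx : IsTrajectory τ B x) (n : ℕ)
    (a b : ℝ) : IntervalIntegrable (fun s => τ n (pathAt x s)) volume a b := by
  have hm : Measurable fun s => τ n (pathAt x s) :=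
    (h.measurable n).comp (continuous_pathAt_right x).measurable
  obtain ⟨R, hR⟩ := exists_uIoc_subset a b
  rw [intervalIntegrable_iff]
  refine IntegrableOn.mono_set ⟨hm.aestronglyMeasurable, ?_⟩ hR
  have h1 := sq_lintegral_le (volume.restrict (Set.Icc (-R) R)) hm.enorm.aemeasurable
  rw [Measure.restrict_apply_univ, Real.volume_Icc] at h1
  have h2 := h1.trans_lt (ENNReal.mul_lt_top ENNReal.ofReal_lt_top
    (hx.lintegral_component_lt_top n R))
  rw [hasFiniteIntegral_iff_enorm]
  exact (ENNReal.pow_lt_top_iff.1 h2).resolve_right two_ne_zero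

theorem IsTrajectory.equation (h : IsLimitField τ) (hx : IsTrajectory τ B x) (n : ℕ) (t : ℝ) :
    x n t = x n 0 - Complex.I * ∫ s in (0 : ℝ)..t, τ n (pathAt x s) := by
  have h1 : Continuous fun t : ℝ => ∫ s in (0 : ℝ)..t, τ n (pathAt x s) :=
    intervalIntegral.continuous_primitive (fun a b => hx.intervalIntegrable h n a b) 0
  have h2 : (fun t : ℝ => defect (τ n) n t x) = fun _ => 0 := by
    -- both sides are continuous in time, so rational times suffice
    refine Continuous.ext_on Rat.denseRange_cast ?_ continuous_const ?_
    · unfold defect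
      fun_prop
    · rintro _ ⟨q, rfl⟩
      exact hx.defect_eq n q
  have h3 := congrFun h2 t
  rw [defect] at h3
  linear_combination h3

theorem IsTrajectory.increment (h : IsLimitField τ) (hx : IsTrajectory τ B x) (n : ℕ) (s t : ℝ) :
    x n t - x n s = -Complex.I * ∫ r in s..t, τ n (pathAt x r) := by
  have h1 := intervalIntegral.integral_interval_sub_left (hx.intervalIntegrable h n 0 t)
    (hx.intervalIntegrable h n 0 s)
  rw [hx.equation h n t, hx.equation h n s, ← h1]
  ring

/-- Hölder continuity in time of the trajectory in `ℋ^{-σ}`. -/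
theorem IsTrajectory.seqNormSq_sub_le (h : IsLimitField τ) (hx : IsTrajectory τ B x) (σ R s t : ℝ)
    (hs : s ∈ Set.Icc (-R) R) (ht : t ∈ Set.Icc (-R) R) :
    seqNormSq (-σ) (fun n => x n t - x n s) ≤ ENNReal.ofReal |t - s| *
      ∫⁻ r in Set.Icc (-R) R, seqNormSq (-σ) (fun n => τ n (pathAt x r)) := by
  have hm : ∀ n, Measurable fun r : ℝ => τ n (pathAt x r) := fun n =>
    (h.measurable n).comp (continuous_pathAt_right x).measurable
  rw [lintegral_seqNormSq _ hm, seqNormSq,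
    ← ENNReal.tsum_mul_left]
  refine ENNReal.tsum_le_tsum fun n => ?_
  have hI : ‖-Complex.I‖ₑ = 1 := by rw [← ofReal_norm]; simp
  have hsub : Set.uIoc s t ⊆ Set.Icc (-R) R :=
    Set.uIoc_subset_uIcc.trans (Set.uIcc_subset_Icc hs ht)
  have h1 := sq_enorm_intervalIntegral_le s t (hm n).aestronglyMeasurable
  calc sobolevWeight (-σ) n * ‖x n t - x n s‖ₑ ^ 2
      ≤ sobolevWeight (-σ) n *
          (ENNReal.ofReal |t - s| * ∫⁻ r in Set.Icc (-R) R, ‖τ n (pathAt x r)‖ₑ ^ 2) := by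
        rw [hx.increment h n s t, enorm_mul, hI, one_mul]
        gcongr
        refine h1.trans ?_
        gcongr
    _ = _ := by ring

theorem IsTrajectory.negSobolev (h : IsLimitField τ) (hx : IsTrajectory τ B x) (t : ℝ) :
    NegSobolev (pathAt x t) := by
  intro σ hσ
  have e : pathAt x t = fun n => pathAt x 0 n + (x n t - x n 0) := by
    funext n
    simp only [pathAt]
    ring
  have h1 := hx.seqNormSq_sub_le h σ |t| 0 t ⟨by simp, abs_nonneg t⟩ ⟨neg_abs_le t, le_abs_self t⟩
  rw [e]
  refine (seqNormSq_add_le _ _ _).trans_lt (ENNReal.add_lt_top.2 ⟨?_, ?_⟩)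
  · exact ENNReal.mul_lt_top (by finiteness) (hx.initial σ hσ)
  · refine ENNReal.mul_lt_top (by finiteness) (h1.trans_lt ?_)
    exact ENNReal.mul_lt_top ENNReal.ofReal_lt_top (hx.lintegral_lt_top hσ _)

theorem IsTrajectory.continuousInSobolev (h : IsLimitField τ) (hx : IsTrajectory τ B x) {σ : ℝ}
    (hσ : 1 < σ) : ContinuousInSobolev (-σ) fun t => holSeries (pathAt x t) := by
  have hlin : ∀ t, LinearGrowth (pathAt x t) := fun t => (hx.negSobolev h t).linearGrowth
  refine ⟨fun t => ((hx.negSobolev h t).holSeries_mem).1 σ hσ, fun t₀ => ?_⟩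
  have he : ∀ t, sobolevNormSq (-σ) (holSeries (pathAt x t) - holSeries (pathAt x t₀))
      = seqNormSq (-σ) fun n => x n t - x n t₀ := fun t => by
    refine sobolevNormSq_eq_seqNormSq fun j k => ?_
    have hs : ∀ u v : 𝓢'(ℂ, ℂ), coeff (u - v) j k = coeff u j k - coeff v j k := fun u v => by
      simp only [coeff, sub_apply]
    rw [hs, coeff_holSeries (hlin t), coeff_holSeries (hlin t₀)]
    split_ifs
    · rfl
    · exact sub_zero 0
  simp only [he]
  set R := |t₀| + 1
  set M := ∫⁻ r in Set.Icc (-R) R, seqNormSq (-σ) (fun n => τ n (pathAt x r)) with hM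
  have hMt : M ≠ ∞ := (hx.lintegral_lt_top hσ R).ne
  have hlim : Tendsto (fun t => ENNReal.ofReal |t - t₀| * M) (𝓝 t₀) (𝓝 0) := by
    have h1 : Tendsto (fun t => |t - t₀|) (𝓝 t₀) (𝓝 0) := by
      have : Continuous fun t => |t - t₀| := by fun_prop
      simpa using this.tendsto t₀
    have h2 := ENNReal.Tendsto.mul_const (b := M) (ENNReal.tendsto_ofReal h1) (Or.inr hMt)
    simpa using h2
  refine tendsto_of_tendsto_of_tendsto_of_le_of_le' tendsto_const_nhds hlim
    (Eventually.of_forall fun _ => zero_le) ?_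
  filter_upwards [Metric.ball_mem_nhds t₀ one_pos] with t ht
  rw [Metric.mem_ball, Real.dist_eq, abs_lt] at ht
  have h1 := neg_abs_le t₀
  have h2 := le_abs_self t₀
  exact hx.seqNormSq_sub_le h σ R t₀ t ⟨by linarith, by linarith⟩ ⟨by linarith, by linarith⟩

/-- The pairing of a coefficient sequence with a Schwartz function is controlled by a negative
Sobolev norm. -/
theorem exists_tsum_norm_mul_pair_le (ψ : 𝓢(ℂ, ℂ)) : ∃ A : ℝ, ∀ c : ℕ → ℂ, seqNormSq (-2) c < ∞ →
    Summable (fun n => ‖c n * pair (holFun n) ψ‖) ∧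
      ∑' n, ‖c n * pair (holFun n) ψ‖ ≤ A + (seqNormSq (-2) c).toReal := by
  obtain ⟨C, hC, hψ⟩ := exists_norm_pair_hermiteFun_le ψ 2
  have ha : Summable fun n : ℕ => (2 * C) ^ 2 * (1 / ((n : ℝ) + 1) ^ 2) := by
    have := (summable_nat_add_iff 1).2 (Real.summable_one_div_nat_pow.2 (one_lt_two))
    simpa using this.mul_left ((2 * C) ^ 2)
  refine ⟨∑' n : ℕ, (2 * C) ^ 2 * (1 / ((n : ℝ) + 1) ^ 2), fun c hc => ?_⟩
  have hw : ∀ n, (sobolevWeight (-2) n * ‖c n‖ₑ ^ 2).toReal = (‖c n‖ / (2 * n + 2)) ^ 2 := by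
    intro n
    rw [sobolevWeight, ENNReal.toReal_mul, ENNReal.toReal_ofReal (by positivity),
      ENNReal.toReal_pow, toReal_enorm, Real.rpow_neg (by positivity), Real.rpow_two, div_pow]
    ring
  have hs : Summable fun n : ℕ => (‖c n‖ / (2 * n + 2)) ^ 2 := by
    simp only [← hw]
    exact ENNReal.summable_toReal hc.ne
  have hs2 : (seqNormSq (-2) c).toReal = ∑' n : ℕ, (‖c n‖ / (2 * n + 2)) ^ 2 := by
    rw [seqNormSq, ENNReal.tsum_toReal_eq (ENNReal.ne_top_of_tsum_ne_top hc.ne)]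
    exact tsum_congr hw
  have hterm : ∀ n : ℕ, ‖c n * pair (holFun n) ψ‖
      ≤ (2 * C) ^ 2 * (1 / ((n : ℝ) + 1) ^ 2) + (‖c n‖ / (2 * n + 2)) ^ 2 := by
    intro n
    have h1 := hψ n 0
    rw [pair_comm, Nat.cast_zero, add_zero] at h1
    have hn : (0 : ℝ) < (n : ℝ) + 1 := by positivity
    have h2 : (2 * n + 2) * ‖pair (holFun n) ψ‖ ≤ 2 * C / ((n : ℝ) + 1) := by
      rw [le_div_iff₀ hn]
      calc _ = 2 * (((n : ℝ) + 1) ^ 2 * ‖pair (hermiteFun n 0) ψ‖) := by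
            rw [holFun]
            ring
        _ ≤ 2 * C := by linarith
    calc ‖c n * pair (holFun n) ψ‖
        = (‖c n‖ / (2 * n + 2)) * ((2 * n + 2) * ‖pair (holFun n) ψ‖) := by
          rw [norm_mul]
          field_simp
      _ ≤ (‖c n‖ / (2 * n + 2)) * (2 * C / ((n : ℝ) + 1)) := by gcongr
      _ ≤ (2 * C / ((n : ℝ) + 1)) ^ 2 + (‖c n‖ / (2 * n + 2)) ^ 2 := by
          nlinarith [sq_nonneg (‖c n‖ / (2 * n + 2) - 2 * C / ((n : ℝ) + 1)),
            sq_nonneg (‖c n‖ / (2 * n + 2)), sq_nonneg (2 * C / ((n : ℝ) + 1))]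
      _ = _ := by rw [div_pow, div_eq_mul_one_div ((2 * C) ^ 2)]
  refine ⟨Summable.of_nonneg_of_le (fun n => norm_nonneg _) hterm (ha.add hs), ?_⟩
  rw [hs2, ← ha.tsum_add hs]
  exact (Summable.of_nonneg_of_le (fun n => norm_nonneg _) hterm (ha.add hs)).tsum_le_tsum hterm
    (ha.add hs)

/-- The integrals in time of the modes sum to the integral of the pairing, by dominated convergence.
-/
theorem IsTrajectory.hasSum_integral (h : IsLimitField τ) (hx : IsTrajectory τ B x)
    {f : ℝ → ℂ} {ψ : 𝓢(ℂ, ℂ)} (t : ℝ)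
    (hf : ∀ᵐ s : ℝ, HasSum (fun n => τ n (pathAt x s) * pair (holFun n) ψ) (f s))
    (hfin : ∀ᵐ s : ℝ, seqNormSq (-2) (fun n => τ n (pathAt x s)) < ∞) :
    HasSum (fun n => (∫ s in (0 : ℝ)..t, τ n (pathAt x s)) * pair (holFun n) ψ)
      (∫ s in (0 : ℝ)..t, f s) := by
  obtain ⟨A, hA⟩ := exists_tsum_norm_mul_pair_le ψ
  have hm := measurable_field_at h x
  have hmn : ∀ n, Measurable fun s => τ n (pathAt x s) * pair (holFun n) ψ := fun n =>
    ((measurable_pi_apply n).comp hm).mul_const _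
  obtain ⟨R, hR⟩ := exists_uIoc_subset 0 t
  have hmS : Measurable fun s => seqNormSq (-2) (fun n => τ n (pathAt x s)) :=
    (measurable_seqNormSq _).comp hm
  have hS : IntervalIntegrable
      (fun s => A + (seqNormSq (-2) (fun n => τ n (pathAt x s))).toReal) volume 0 t := by
    refine intervalIntegrable_const.add ?_
    rw [intervalIntegrable_iff]
    exact IntegrableOn.mono_set (integrable_toReal_of_lintegral_ne_top hmS.aemeasurable
      (hx.lintegral_lt_top one_lt_two R).ne) hR
  simp only [← intervalIntegral.integral_mul_const]
  refine intervalIntegral.hasSum_integral_of_dominated_convergence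
    (fun n s => ‖τ n (pathAt x s) * pair (holFun n) ψ‖) (fun n => (hmn n).aestronglyMeasurable)
    (fun n => Eventually.of_forall fun s _ => le_rfl) ?_ ?_ (hf.mono fun s hs _ => hs)
  · filter_upwards [hfin] with s hs _
    exact (hA _ hs).1
  · refine hS.mono_fun' (Measurable.tsum fun n => (hmn n).norm).aestronglyMeasurable ?_
    filter_upwards [ae_restrict_of_ae hfin] with s hs
    rw [Real.norm_of_nonneg (tsum_nonneg fun n => norm_nonneg _)]
    exact (hA _ hs).2

/-- A trajectory in the set where the nonlinearity `T` has coefficients `τ` is a global weak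
solution. -/
theorem IsTrajectory.isGlobalSolution (h : IsLimitField τ) (hx : IsTrajectory τ B x)
    {T : 𝓢'(ℂ, ℂ) → 𝓢'(ℂ, ℂ)} (hB : ∀ c ∈ B, NegSobolev c ∧ NegSobolev (fun n => τ n c) ∧
      T (holSeries c) = holSeries fun n => τ n c) :
    IsGlobalSolution T (holSeries (pathAt x 0)) fun t => holSeries (pathAt x t) := by
  have hlin : ∀ t, LinearGrowth (pathAt x t) := fun t => (hx.negSobolev h t).linearGrowth
  refine ⟨rfl, fun σ hσ => hx.continuousInSobolev h hσ, fun ψ => ?_, fun σ hσ R => ?_,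
    fun t ψ => ?_⟩
  · have hm : Measurable fun s => holSeries (fun n => τ n (pathAt x s)) ψ :=
      (measurable_iff_eval.1 measurable_holSeries ψ).comp (measurable_field_at h x)
    refine hm.aestronglyMeasurable.congr ?_
    filter_upwards [hx.ae_mem] with s hs
    rw [(hB _ hs).2.2]
  · refine lt_of_eq_of_lt (lintegral_congr_ae ?_) (hx.lintegral_lt_top hσ R)
    filter_upwards [ae_restrict_of_ae hx.ae_mem] with s hs
    rw [(hB _ hs).2.2, sobolevNormSq_holSeries (hB _ hs).2.1.linearGrowth]
  · have h1 := hx.hasSum_integral h (f := fun s => T (holSeries (pathAt x s)) ψ) (ψ := ψ) t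
      (by
        filter_upwards [hx.ae_mem] with s hs
        rw [(hB _ hs).2.2]
        exact hasSum_holSeries (hB _ hs).2.1.linearGrowth ψ)
      (by
        filter_upwards [hx.ae_mem] with s hs
        exact (hB _ hs).2.1 2 one_lt_two)
    have h2 := (hasSum_holSeries (hlin 0) ψ).sub (h1.mul_left Complex.I)
    refine (hasSum_holSeries (hlin t) ψ).unique (h2.congr_fun fun n => ?_)
    have h3 := hx.equation h n t
    simp only [pathAt] at h3 ⊢
    rw [h3]
    ring

/-- Almost every trajectory lies in a countable union of compact sets of trajectories, so that the
initial values of these trajectories form a measurable set. -/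
theorem exists_measurable_subset_measurable_image {ν : Measure PathSpace} [IsProbabilityMeasure ν]
    {G : Set PathSpace} (hG : ∀ᵐ x ∂ν, x ∈ G) :
    ∃ K ⊆ G, MeasurableSet K ∧ ν Kᶜ = 0 ∧ MeasurableSet ((fun x => pathAt x 0) '' K) := by
  obtain ⟨s, hs, hsm, hs0⟩ := exists_measurable_superset_of_null (mem_ae_iff.1 hG)
  have hν : ν sᶜ ≠ ∞ := measure_ne_top _ _
  have hex : ∀ m : ℕ, ∃ K ⊆ sᶜ, IsCompact K ∧ ν (sᶜ \ K) < ENNReal.ofReal (1 / ((m : ℝ) + 1)) :=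
    fun m => hsm.compl.exists_isCompact_sdiff_lt hν (by
      rw [Ne, ENNReal.ofReal_eq_zero, not_le]
      positivity)
  choose K hKs hKc hK using hex
  refine ⟨⋃ m, K m, ?_, MeasurableSet.iUnion fun m => (hKc m).measurableSet, ?_, ?_⟩
  · refine Set.iUnion_subset fun m x hx => ?_
    by_contra hn
    exact hKs m hx (hs hn)
  · have h1 : ∀ m : ℕ, ν (⋃ m, K m)ᶜ ≤ ENNReal.ofReal (1 / ((m : ℝ) + 1)) := fun m => by
      have h2 : (⋃ m, K m)ᶜ ⊆ s ∪ (sᶜ \ K m) := by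
        intro x hx
        by_cases hxs : x ∈ s
        · exact Or.inl hxs
        · exact Or.inr ⟨hxs, fun hxK => hx (Set.mem_iUnion.2 ⟨m, hxK⟩)⟩
      refine (measure_mono h2).trans ((measure_union_le _ _).trans ?_)
      rw [hs0, zero_add]
      exact (hK m).le
    have h3 : Tendsto (fun m : ℕ => ENNReal.ofReal (1 / ((m : ℝ) + 1))) atTop (𝓝 0) := by
      have := ENNReal.tendsto_ofReal tendsto_one_div_add_atTop_nhds_zero_nat
      simpa using this
    exact le_antisymm (ge_of_tendsto' h3 h1) zero_le
  · rw [Set.image_iUnion]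
    exact MeasurableSet.iUnion fun m => ((hKc m).image (continuous_pathAt 0)).measurableSet

/-- The image under `c ↦ ∑ cₙ φₙ` of a measurable set of full Gaussian measure has full white noise
measure: it is the measurable set of the distributions with coefficients in the given set. -/
theorem ae_mem_image_holSeries {A : Set (ℕ → ℂ)} (hA : MeasurableSet A)
    (hlin : ∀ c ∈ A, LinearGrowth c) (hA1 : ∀ᵐ c ∂gaussianSeq, c ∈ A) :
    ∀ᵐ f ∂gaussianSeq.map holSeries, f ∈ holSeries '' A := by
  have he : holSeries '' A = {f | holCoeff f ∈ A ∧
      ∀ j k, coeff f j k = if k = 0 then holCoeff f j else 0} := by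
    ext f
    constructor
    · rintro ⟨c, hc, rfl⟩
      have h := holCoeff_holSeries (hlin c hc)
      exact ⟨h.symm ▸ hc, by rw [h]; exact coeff_holSeries (hlin c hc)⟩
    · rintro ⟨h1, h2⟩
      exact ⟨holCoeff f, h1, (eq_holSeries (hlin _ h1) h2).symm⟩
  have hm : MeasurableSet (holSeries '' A) := by
    rw [he, Set.ofPred_and]
    exact (measurable_holCoeff hA).inter measurableSet_holomorphic
  refine (ae_map_iff measurable_holSeries.aemeasurable hm).2 ?_
  exact hA1.mono fun c hc => Set.mem_image_of_mem _ hc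

theorem exists_isLimitField : ∃ τ, IsLimitField τ := by
  obtain ⟨τ, h1, h2, h3⟩ := exists_tendsto_truncatedField
  exact ⟨τ, h1, h2, h3⟩

theorem IsLimitField.exists_stationary (h : IsLimitField τ) : ∃ ν : Measure PathSpace,
    IsProbabilityMeasure ν ∧ (∀ t, ν.map (fun x => pathAt x t) = gaussianSeq) ∧
      ∀ n t, ∀ᵐ x ∂ν, defect (τ n) n t x = 0 := by
  obtain ⟨C, hC, hCτ⟩ := h.exists_bound
  exact exists_stationary_solution h.measurable hC hCτ h.tendsto

end Trajectories

end CRSystem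

end

theorem theorem2p5 {Ω : Type*} [MeasurableSpace Ω] (p : Measure Ω) [IsProbabilityMeasure p]
    (g : ℕ → Ω → ℂ) (hmeas : ∀ n, Measurable (g n)) (hindep : iIndepFun g p)
    (hlaw : ∀ n, p.map (g n) = CRSystem.stdComplexGaussian) :
    (∃ T, CRSystem.IsNonlinearity (CRSystem.whiteNoise p g) T) ∧
    ∀ T, CRSystem.IsNonlinearity (CRSystem.whiteNoise p g) T →
      ∃ S : Set 𝓢'(ℂ, ℂ), S ⊆ CRSystem.Xhol ∧ (∀ᵐ f ∂(CRSystem.whiteNoise p g), f ∈ S) ∧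
        ∃ (Ω' : Type) (_ : MeasurableSpace Ω') (P : Measure Ω') (_ : IsProbabilityMeasure P)
          (u : Ω' → ℝ → 𝓢'(ℂ, ℂ)),
          (∀ f ∈ S, ∃ ω, CRSystem.IsGlobalSolution T f (u ω)) ∧
          (∀ ω, u ω 0 ∈ S ∧ CRSystem.IsGlobalSolution T (u ω 0) (u ω)) ∧
          ∀ t : ℝ, Measurable (fun ω => u ω t) ∧
            P.map (fun ω => u ω t) = CRSystem.whiteNoise p g := by
  rw [CRSystem.whiteNoise_eq p g hmeas hindep hlaw]
  obtain ⟨τ, hτ⟩ := CRSystem.exists_isLimitField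
  refine ⟨⟨_, hτ.isNonlinearity⟩, fun T hT => ?_⟩
  obtain ⟨B, hBm, hB0, hB⟩ := hτ.exists_measurableSet hT
  obtain ⟨ν, hν, hmarg, hdef⟩ := hτ.exists_stationary
  obtain ⟨K, hK, hKm, hK0, hA⟩ := CRSystem.exists_measurable_subset_measurable_image
    (CRSystem.ae_isTrajectory hτ hmarg hdef hBm hB0)
  -- the probability space is `K` with the restriction of `ν`; the process is the evaluation of
  -- the trajectories
  have hmap : (ν.comap (Subtype.val : K → CRSystem.PathSpace)).map Subtype.val = ν := by
    rw [map_comap_subtype_coe hKm, Measure.restrict_eq_self_of_ae_mem (mem_ae_iff.2 hK0)]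
  have hprob : IsProbabilityMeasure (ν.comap (Subtype.val : K → CRSystem.PathSpace)) := by
    constructor
    rw [← measure_univ (μ := ν), ← hmap, Measure.map_apply measurable_subtype_coe MeasurableSet.univ,
      Set.preimage_univ, hmap]
  have hpath : ∀ t : ℝ, Measurable fun x : CRSystem.PathSpace =>
      CRSystem.holSeries (CRSystem.pathAt x t) := fun t =>
    CRSystem.measurable_holSeries.comp (CRSystem.continuous_pathAt t).measurable
  refine ⟨CRSystem.holSeries '' ((fun x => CRSystem.pathAt x 0) '' K), ?_, ?_, K, inferInstance,
    ν.comap Subtype.val, hprob, fun x t => CRSystem.holSeries (CRSystem.pathAt x.1 t), ?_, ?_, ?_⟩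
  · rintro _ ⟨_, ⟨x, hx, rfl⟩, rfl⟩
    exact (hK hx).initial.holSeries_mem
  · refine CRSystem.ae_mem_image_holSeries hA (fun c hc => ?_) ?_
    · obtain ⟨x, hx, rfl⟩ := hc
      exact (hK hx).initial.linearGrowth
    · have h1 : ∀ᵐ x ∂ν, CRSystem.pathAt x 0 ∈ (fun x => CRSystem.pathAt x 0) '' K := by
        filter_upwards [mem_ae_iff.2 hK0] with x hx
        exact Set.mem_image_of_mem _ hx
      rw [← hmarg 0]
      exact (ae_map_iff (CRSystem.continuous_pathAt 0).measurable.aemeasurable hA).2 h1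
  · rintro _ ⟨_, ⟨x, hx, rfl⟩, rfl⟩
    exact ⟨⟨x, hx⟩, (hK hx).isGlobalSolution hτ hB⟩
  · rintro ⟨x, hx⟩
    exact ⟨⟨_, ⟨x, hx, rfl⟩, rfl⟩, (hK hx).isGlobalSolution hτ hB⟩
  · intro t
    refine ⟨(hpath t).comp measurable_subtype_coe, ?_⟩
    calc (ν.comap (Subtype.val : K → CRSystem.PathSpace)).map
          (fun x => CRSystem.holSeries (CRSystem.pathAt x.1 t))
        = ((ν.comap (Subtype.val : K → CRSystem.PathSpace)).map Subtype.val).map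
            fun x => CRSystem.holSeries (CRSystem.pathAt x t) :=
          (Measure.map_map (hpath t) measurable_subtype_coe).symm
      _ = (ν.map fun x => CRSystem.pathAt x t).map CRSystem.holSeries := by
          rw [hmap, Measure.map_map CRSystem.measurable_holSeries
            (CRSystem.continuous_pathAt t).measurable]
          rfl
      _ = CRSystem.gaussianSeq.map CRSystem.holSeries := by rw [hmarg t]
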